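/- Let $G=(V,E)$ be a finite connected graph with at least one edge (loops and multiple edges allowed). A metric on $G$ is a vector $g=(g_e)_{e\in E}$ of positive numbers; it makes each edge $e$ an interval of length $\ell_e=\sqrt{g_e}$, with total length $L(g)=\sum_e\sqrt{g_e}$. A density is a positive function $\rho$ that is smooth on each closed edge (not necessarily continuous across vertices). Consider the eigenvalue problem $$-f''=\lambda\rho f\ \text{ on edges},\qquad f\ \text{continuous on } G,\qquad \sum_{e\in E_v}f_e'(v)=0\ \text{ at every } v\in V,$$ where derivatives are taken with respect to arclength, $E_v$ is the set of edge ends attached to $v$ (a loop counts twice), and $f_e'(v)$ is the derivative at $v$ pointing out of $v$ into $e$. Let $0=\lambda_0(g,\rho)<\lambda_1(g,\rho)\le\lambda_2(g,\rho)\le\cdots$ be its eigenvalues, repeated according to multiplicity. Put $$\overline{\lambda_k}(g,\rho)=\lambda_k(g,\rho)\,L(g)\int_{(G,g)}\rho\,dx .$$ A pair $(g_*,\rho_*)$ is called extremal for $\overline{\lambda_k}$ if for every smooth one-parameter family of pairs $(g(t),\rho(t))$ of metrics and densities, defined for $t$ in an open interval around $0$, with $(g(0),\rho(0))=(g_*,\rho_*)$,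 either $\overline{\lambda_k}(g(t),\rho(t))\le\overline{\lambda_k}(g_*,\rho_*)+o(t)$ or $\overline{\lambda_k}(g(t),\rho(t))\ge\overline{\lambda_k}(g_*,\rho_*)+o(t)$ as $t\to0$. Here smooth means that each $g_e(t)$ is smooth in $t$ and each $\rho_e(t)(x)$ is smooth in $(t,x)$ up to the ends of the edge, where $x\in[0,1]$ is the rescaled arclength on $e$. **Theorem.** Let $k\ge1$. (a) If $(g_*,\rho_*)$ is extremal for $\overline{\lambda_k}$, then $\rho_*$ is constant and there are finitely many eigenfunctions $f_1,\dots,f_n$ with eigenvalue $\lambda_k(g_*,\rho_*)$ such that, at every point of $G$, $$\sum_{i=1}^n|\nabla_{g_*}f_i|_{g_*}^2=1,\qquad \lambda_k(g_*,\rho_*)\sum_{i=1}^n f_i^2=\frac{L(g_*)}{\int_{(G,g_*)}\rho_*\,dx},\tag{1}$$ and such that $(f_1,\dots,f_n):(G,g_*)\to\mathbb R^n$ is an isometric minimal immersion onto a geodesic net in the sphere about the origin of radius $R=\left(\frac{L(g_*)}{\lambda_k(g_*,\rho_*)\int\rho_*}\right)^{1/2}$: each edge is mapped with unit speed along a great circle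 of this sphere, and at every vertex the outward unit tangent vectors of the images of the attached edge ends sum to zero. (b) Conversely, let $g$ be a metric and $\rho$ a density. If there are eigenfunctions $f_1,\dots,f_n$ with eigenvalue $\lambda_k(g,\rho)$ satisfying (1) with $(g,\rho)$ in place of $(g_*,\rho_*)$, and if $\lambda_k(g,\rho)>\lambda_{k-1}(g,\rho)$ or $\lambda_k(g,\rho)<\lambda_{k+1}(g,\rho)$, then $(g,\rho)$ is extremal for $\overline{\lambda_k}$. -/

import Mathlib

open scoped ContDiff Topology

noncomputable section

namespace QuantumGraph

/-- A multigraph with vertex set `V` and edge set `E`; loops and multiple edges are allowed.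
Every edge `e` is identified with `[0, 1]`, where `0` is glued to the vertex `src e` and `1` to the
vertex `tgt e` (the orientation is arbitrary). -/
structure MultiGraph (V E : Type*) where
  src : E → V
  tgt : E → V

/-- Any two vertices are joined by a path of edges. -/
def MultiGraph.Connected {V E : Type*} (G : MultiGraph V E) : Prop :=
  ∀ u v : V, Relation.EqvGen (fun a b => ∃ e, G.src e = a ∧ G.tgt e = b) u v

/-- A function on the disjoint union of the closed edges, given edge by edge in the coordinate
`x ∈ [0, 1]`. -/
abbrev EdgeFun (E F : Type*) := E → unitInterval → F

/-- The restriction `f_e`, as a function on `ℝ` (constant to the left and to the right of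
`[0, 1]`; only its behaviour within `[0, 1]` is ever used). -/
def EdgeFun.onEdge {E F : Type*} (f : EdgeFun E F) (e : E) : ℝ → F :=
  Set.IccExtend zero_le_one (f e)

section Calculus

variable {E F : Type*} [NormedAddCommGroup F] [NormedSpace ℝ F]

/-- The derivative `df/dx` on the edge `e`, one-sided at the two ends of the edge. -/
def EdgeFun.dx (f : EdgeFun E F) : EdgeFun E F :=
  fun e x => derivWithin (f.onEdge e) (Set.Icc 0 1) x

open Classical in
/-- The sum of the derivatives of `f` at the vertex `v`, with respect to arclength
`dx_g = √g_e dx` and in the direction pointing out of `v`, over all ends of edges attached to `v`.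
A loop at `v` contributes both of its ends. -/
def outwardSum {V : Type*} [Fintype E] (G : MultiGraph V E) (g : E → ℝ) (f : EdgeFun E F) (v : V) :
    F :=
  ∑ e, ((if G.src e = v then (√(g e))⁻¹ • f.dx e 0 else 0) +
    (if G.tgt e = v then -((√(g e))⁻¹ • f.dx e 1) else 0))

end Calculus

section Spectrum

variable {V E : Type*} [Fintype E]

/-- The pairs `(g, ρ)` of a metric (a positive number `g_e` on each edge, so that `e` has length
`√g_e`) and a positive density function that is smooth on each closed edge. The density need not
be continuous across vertices. -/
structure Admissible (g : E → ℝ) (ρ : EdgeFun E ℝ) : Prop where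
  metric_pos : ∀ e, 0 < g e
  density_pos : ∀ e x, 0 < ρ e x
  density_smooth : ∀ e, ContDiffOn ℝ ∞ (ρ.onEdge e) (Set.Icc 0 1)

/-- The total length `L(g)`. -/
def totalLength (g : E → ℝ) : ℝ := ∑ e, √(g e)

/-- The integral of `ρ` over `(G, g)` with respect to arclength `dx_g = √g_e dx`. -/
def totalMass (g : E → ℝ) (ρ : EdgeFun E ℝ) : ℝ :=
  ∑ e, ∫ x in (0 : ℝ)..1, ρ.onEdge e x * √(g e)

/-- The squared norm `|∇_g f|_g²`, which in the coordinate `x` is `f'(x)² / g_e`. -/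
def gradSq (g : E → ℝ) (f : EdgeFun E ℝ) (e : E) (x : unitInterval) : ℝ :=
  (f.dx e x) ^ 2 / g e

/-- The Laplacian `Δ_g f`, which in the coordinate `x` is `-f''(x) / g_e`. -/
def laplacian (g : E → ℝ) (f : EdgeFun E ℝ) (e : E) (x : unitInterval) : ℝ :=
  -(f.dx.dx e x) / g e

/-- `f` is an eigenfunction of `Δ_g f = μ ρ f` with eigenvalue `μ`, with the Neumann (Kirchhoff)
vertex conditions. -/
structure IsEigenfunction (G : MultiGraph V E) (g : E → ℝ) (ρ : EdgeFun E ℝ) (μ : ℝ)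
    (f : EdgeFun E ℝ) : Prop where
  ne_zero : f ≠ 0
  smooth : ∀ e, ContDiffOn ℝ 2 (f.onEdge e) (Set.Icc 0 1)
  equation : ∀ e x, laplacian g f e x = μ * ρ e x * f e x
  continuous : ∃ a : V → ℝ, ∀ e, f e 0 = a (G.src e) ∧ f e 1 = a (G.tgt e)
  kirchhoff : ∀ v, outwardSum G g f v = 0

/-- The eigenvalue `λ_k(g, ρ)`, `k = 0, 1, 2, …`: the `k`-th term of the increasing list of all
eigenvalues, repeated according to multiplicity. That is, the least `Λ` such that the
eigenfunctions with eigenvalue at most `Λ` span a space of dimension at least `k + 1`. -/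
def eigenvalue (G : MultiGraph V E) (k : ℕ) (g : E → ℝ) (ρ : EdgeFun E ℝ) : ℝ :=
  sInf {Λ : ℝ | ((k + 1 : ℕ) : Cardinal) ≤
    Module.rank ℝ (Submodule.span ℝ {f : EdgeFun E ℝ | ∃ μ ≤ Λ, IsEigenfunction G g ρ μ f})}

/-- The naturally normalised eigenvalue `λ_k(g, ρ) L(g) ∫ ρ`. -/
def normalisedEigenvalue (G : MultiGraph V E) (k : ℕ) (g : E → ℝ) (ρ : EdgeFun E ℝ) : ℝ :=
  eigenvalue G k g ρ * totalLength g * totalMass g ρ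

/-- A smooth one-parameter family of admissible pairs, for `t ∈ (-ε, ε)`: each `g_e(t)` is smooth
in `t`, and each `ρ_e(t)(x)` is smooth in `(t, x)`, up to the ends of the edge. -/
structure IsSmoothFamily (ε : ℝ) (g : ℝ → E → ℝ) (ρ : ℝ → EdgeFun E ℝ) : Prop where
  admissible : ∀ t ∈ Set.Ioo (-ε) ε, Admissible (g t) (ρ t)
  metric_smooth : ∀ e, ContDiffOn ℝ ∞ (fun t => g t e) (Set.Ioo (-ε) ε)
  density_smooth : ∀ e, ContDiffOn ℝ ∞ (fun p : ℝ × ℝ => (ρ p.1).onEdge e p.2)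
    (Set.Ioo (-ε) ε ×ˢ Set.Icc 0 1)

/-- `(g₀, ρ₀)` is extremal for the functional `F`: along every smooth one-parameter family through
`(g₀, ρ₀)` at `t = 0` one has `F(g(t), ρ(t)) ≤ F(g₀, ρ₀) + o(t)` or
`F(g(t), ρ(t)) ≥ F(g₀, ρ₀) + o(t)` as `t → 0`. -/
def IsExtremal (F : (E → ℝ) → EdgeFun E ℝ → ℝ) (g₀ : E → ℝ) (ρ₀ : EdgeFun E ℝ) : Prop :=
  Admissible g₀ ρ₀ ∧
    ∀ ε > 0, ∀ (g : ℝ → E → ℝ) (ρ : ℝ → EdgeFun E ℝ), IsSmoothFamily ε g ρ → g 0 = g₀ → ρ 0 = ρ₀ →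
      (∃ r : ℝ → ℝ, r =o[𝓝 0] (fun t : ℝ => t) ∧ ∀ᶠ t in 𝓝 0, F (g t) (ρ t) ≤ F g₀ ρ₀ + r t) ∨
      (∃ r : ℝ → ℝ, r =o[𝓝 0] (fun t : ℝ => t) ∧ ∀ᶠ t in 𝓝 0, F g₀ ρ₀ + r t ≤ F (g t) (ρ t))

/-- The two identities `∑ |∇_g f_i|_g² = 1` and `λ_k(g, ρ) ∑ f_i² = L(g) / ∫ ρ`, at every point of
the graph. -/
def SatisfiesIdentities (G : MultiGraph V E) (k : ℕ) (g : E → ℝ) (ρ : EdgeFun E ℝ) {n : ℕ}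
    (f : Fin n → EdgeFun E ℝ) : Prop :=
  ∀ e x, ∑ i, gradSq g (f i) e x = 1 ∧
    eigenvalue G k g ρ * ∑ i, (f i e x) ^ 2 = totalLength g / totalMass g ρ

/-- The map `(f_1, …, f_n)` from the graph to Euclidean space. -/
def coordinateMap {n : ℕ} (f : Fin n → EdgeFun E ℝ) : EdgeFun E (EuclideanSpace ℝ (Fin n)) :=
  fun e x => WithLp.toLp 2 (fun i => f i e x)

/-- `Φ` is an isometric minimal immersion of `(G, g)` onto a geodesic net in the sphere of radius
`R` about the origin: vertices go to points of the sphere; every edge is mapped, with unit speed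
with respect to its arclength `s = √g_e x`, along a great circle, its ends going to the images of
its end vertices; and at every vertex the outward unit tangent vectors add up to zero. -/
structure IsGeodesicNetImmersion (G : MultiGraph V E) (g : E → ℝ) (R : ℝ) {n : ℕ}
    (Φ : EdgeFun E (EuclideanSpace ℝ (Fin n))) : Prop where
  radius_pos : 0 < R
  vertices : ∃ P : V → EuclideanSpace ℝ (Fin n), (∀ v, ‖P v‖ = R) ∧
    ∀ e, Φ e 0 = P (G.src e) ∧ Φ e 1 = P (G.tgt e)
  geodesic : ∀ e, ∃ p w : EuclideanSpace ℝ (Fin n), ‖p‖ = R ∧ ‖w‖ = 1 ∧ inner ℝ p w = 0 ∧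
    ∀ x : unitInterval, Φ e x =
      Real.cos (√(g e) * x / R) • p + (R * Real.sin (√(g e) * x / R)) • w
  balanced : ∀ v, outwardSum G g Φ v = 0

end Spectrum

end QuantumGraph

end

open scoped ContDiff Topology
open Filter MeasureTheory QuantumGraph

set_option linter.unusedSectionVars false

/-! ### Spectral theory of a pair of quadratic forms -/

/-! With `M = ∫ρ`, the normalised eigenvalue is the `k`-th eigenvalue of the pair of forms `L M
∫|∇f|²` and `∫ρ f²`. In the coordinate `x ∈ [0, 1]` both live on one fixed energy space; only the
coefficients, built from `√g` and `√g ρ`, depend on `t`. Let `F` be the value at `t = 0` and let `Q`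
be the derivative of the first form minus `F` times the derivative of the second. On the eigenspace
`Q` governs the first variation: min-max with a subspace `Y` of the eigenspace joined to lower
eigenfunctions bounds the eigenvalue above by `F + t Q` up to `o(t)`, and orthogonality to suitable
eigenfunctions bounds it below. Cross terms between `Y` and the other directions cost only `O(t²)`
(`nonneg_form_add_of_perturbation`, `eventually_nonneg_form_add`).

For (b), the identities (1) make `∑ Q(f_i, f_i)` vanish in every direction
(`sum_variationForm_eq_zero`), so `Q ≤ 0` at one `f_i` and `Q ≥ 0` at another. A gap below or above
`λ_k` allows `Y` to be the line through a single `f_i`; choosing the line by the sign of `t` gives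
the same one-sided bound on both sides of `t = 0`.

For (a), if `Q` were positive definite on the eigenspace in some direction, the bounds with `Y` the
full eigenspace would make the eigenvalue strictly increase through `t = 0` at a linear rate, which
extremality forbids. Since no form of the linear family is definite, convex separation provides
finitely many eigenfunctions with `∑ Q(f_i, f_i) = 0` in every direction of the exponential families
(`exists_posDef_or_exists_sum_eq_zero`, `exists_sum_expVariation_eq_zero`). Varying one edge length
fixes `∑ ∫ f_i'²` on that edge; varying the density by polynomials makes `∑ f_i²` constant
(`identities_of_sum_expVariation_eq_zero`). Differentiating `∑ f_i²` twice and using the equation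
turns the integrated gradient identity into a pointwise one and forces `ρ` to be constant
(`sum_sq_identities`). Each `f_i` then solves a harmonic oscillator equation, so edges trace great
circles, and the Kirchhoff condition is the balance of tangent vectors.

The spectral theory is derived by the direct method from compactness
(`IsCompactPair.exists_minimiser`), and regularity identifies weak and classical eigenvalues
(`eigenvalue_eq_weakEigenvalue`). -/

/-- A symmetric nonnegative form `N` and a symmetric positive definite form `D` on a real vector
space that is complete for `N + D` and compactly embedded in the space normed by `D`. -/
structure IsCompactPair {H : Type*} [AddCommGroup H] [Module ℝ H]
    (N D : LinearMap.BilinForm ℝ H) : Prop where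
  symm_N : ∀ f g, N f g = N g f
  symm_D : ∀ f g, D f g = D g f
  nonneg : ∀ f, 0 ≤ N f f
  pos : ∀ f, f ≠ 0 → 0 < D f f
  compact : ∀ (u : ℕ → H) (C : ℝ), (∀ n, N (u n) (u n) + D (u n) (u n) ≤ C) →
    ∃ φ : ℕ → ℕ, StrictMono φ ∧ ∀ ε > 0, ∃ n₀, ∀ m ≥ n₀, ∀ n ≥ n₀,
      D (u (φ m) - u (φ n)) (u (φ m) - u (φ n)) < ε
  complete : ∀ u : ℕ → H, (∀ ε > 0, ∃ n₀, ∀ m ≥ n₀, ∀ n ≥ n₀,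
      N (u m - u n) (u m - u n) + D (u m - u n) (u m - u n) < ε) →
    ∃ f, ∀ ε > 0, ∃ n₀, ∀ n ≥ n₀, N (u n - f) (u n - f) + D (u n - f) (u n - f) < ε

section FormPair

variable {H : Type*} [AddCommGroup H] [Module ℝ H]

/-- The eigenspace of `N f = μ D f` in the weak sense. -/
def weakEigenspace (N D : LinearMap.BilinForm ℝ H) (μ : ℝ) : Submodule ℝ H where
  carrier := {f | ∀ k, N f k = μ * D f k}
  add_mem' := by
    intro a b ha hb k
    simp only [Set.mem_ofPred_eq] at ha hb
    simp only [map_add, LinearMap.add_apply, ha, hb]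
    ring
  zero_mem' := by intro k; simp
  smul_mem' := by
    intro c a ha k
    simp only [Set.mem_ofPred_eq] at ha
    simp only [map_smul, LinearMap.smul_apply, smul_eq_mul, ha]
    ring

/-- The span of all weak eigenspaces with eigenvalue at most `Λ`. -/
def spectralSpan (N D : LinearMap.BilinForm ℝ H) (Λ : ℝ) : Submodule ℝ H :=
  ⨆ μ : Set.Iic Λ, weakEigenspace N D μ

/-- The `k`-th weak eigenvalue, counted with multiplicity. -/
noncomputable def weakEigenvalue (N D : LinearMap.BilinForm ℝ H) (k : ℕ) : ℝ :=
  sInf {Λ : ℝ | k + 1 ≤ Module.finrank ℝ (spectralSpan N D Λ)}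

theorem weakEigenspace_le_spectralSpan {N D : LinearMap.BilinForm ℝ H} {μ Λ : ℝ} (h : μ ≤ Λ) :
    weakEigenspace N D μ ≤ spectralSpan N D Λ :=
  le_iSup (fun μ : Set.Iic Λ => weakEigenspace N D μ) ⟨μ, h⟩

theorem spectralSpan_mono {N D : LinearMap.BilinForm ℝ H} {Λ Λ' : ℝ} (h : Λ ≤ Λ') :
    spectralSpan N D Λ ≤ spectralSpan N D Λ' :=
  iSup_le fun μ => weakEigenspace_le_spectralSpan (μ.2.trans h)

/-- A symmetric positive definite form has orthogonal projections onto finite-dimensional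
subspaces. -/
theorem exists_form_projection {D : LinearMap.BilinForm ℝ H} (hpos : ∀ f, f ≠ 0 → 0 < D f f)
    (U : Submodule ℝ H) [FiniteDimensional ℝ U] (f : H) :
    ∃ u ∈ U, ∀ v ∈ U, D (f - u) v = 0 := by
  let T : U →ₗ[ℝ] Module.Dual ℝ U :=
    { toFun := fun u => (D u).comp U.subtype
      map_add' := by intro a b; ext; simp
      map_smul' := by intro a b; ext; simp }
  have hT : Function.Injective T := by
    rw [injective_iff_map_eq_zero]
    intro u hu
    by_contra hne
    have h1 := hpos u (by simpa using hne)
    have h2 : T u u = 0 := by rw [hu]; rfl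
    exact h1.ne' h2
  -- Riesz representation in finite dimension: pairing by `D` is injective on `U`, hence onto its
  -- dual.
  have hT' : Function.Surjective T :=
    (LinearMap.injective_iff_surjective_of_finrank_eq_finrank
      (Subspace.dual_finrank_eq (K := ℝ) (V := U)).symm).1 hT
  obtain ⟨u, hu⟩ := hT' ((D f).comp U.subtype)
  refine ⟨u, u.2, fun v hv => ?_⟩
  have := LinearMap.congr_fun hu ⟨v, hv⟩
  have h3 : D u v = D f v := this
  simp [h3]

/-- A nonzero vector of `W` orthogonal to `U` exists if `dim U < dim W`. -/
theorem exists_orthogonal_ne_zero (D : LinearMap.BilinForm ℝ H) (U W : Submodule ℝ H)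
    [FiniteDimensional ℝ U] [FiniteDimensional ℝ W] (hUW : Module.finrank ℝ U < Module.finrank ℝ W) :
    ∃ w ∈ W, w ≠ 0 ∧ ∀ v ∈ U, D w v = 0 := by
  let T : W →ₗ[ℝ] Module.Dual ℝ U :=
    { toFun := fun u => (D u).comp U.subtype
      map_add' := by intro a b; ext; simp
      map_smul' := by intro a b; ext; simp }
  have hT : LinearMap.ker T ≠ ⊥ := by
    apply LinearMap.ker_ne_bot_of_finrank_lt
    rw [Subspace.dual_finrank_eq]
    exact hUW
  obtain ⟨w, hw, hne⟩ := Submodule.exists_mem_ne_zero_of_ne_bot hT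
  refine ⟨w, w.2, by simpa using hne, fun v hv => ?_⟩
  exact LinearMap.congr_fun (LinearMap.mem_ker.1 hw) ⟨v, hv⟩

theorem form_sq_le {B : LinearMap.BilinForm ℝ H} (hs : ∀ f g, B f g = B g f)
    (h0 : ∀ f, 0 ≤ B f f) (f g : H) : (B f g) ^ 2 ≤ B f f * B g g :=
  LinearMap.BilinForm.apply_sq_le_of_symm B h0 ⟨fun f g => by simpa using hs f g⟩ f g

/-- Cauchy-Schwarz for `B` replaces continuity; no topology on `H` is involved. -/
theorem tendsto_form_left {B : LinearMap.BilinForm ℝ H} (hs : ∀ f g, B f g = B g f)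
    (h0 : ∀ f, 0 ≤ B f f) {u : ℕ → H} {f : H}
    (hu : Tendsto (fun n => B (u n - f) (u n - f)) atTop (𝓝 0)) (v : H) :
    Tendsto (fun n => B (u n) v) atTop (𝓝 (B f v)) := by
  have h1 : Tendsto (fun n => B (u n - f) v) atTop (𝓝 0) := by
    have h2 : Tendsto (fun n => √(B (u n - f) (u n - f) * B v v)) atTop (𝓝 0) := by
      have := (hu.mul_const (B v v)).sqrt
      simpa using this
    apply squeeze_zero_norm (fun n => ?_) h2
    rw [Real.norm_eq_abs]
    exact Real.abs_le_sqrt (form_sq_le hs h0 _ _)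
  have h3 := h1.add_const (B f v)
  simpa using h3

theorem tendsto_form_self {B : LinearMap.BilinForm ℝ H} (hs : ∀ f g, B f g = B g f)
    (h0 : ∀ f, 0 ≤ B f f) {u : ℕ → H} {f : H}
    (hu : Tendsto (fun n => B (u n - f) (u n - f)) atTop (𝓝 0)) :
    Tendsto (fun n => B (u n) (u n)) atTop (𝓝 (B f f)) := by
  have h1 := (hu.add ((tendsto_form_left hs h0 hu f).const_mul 2)).sub_const (B f f)
  have h2 : ∀ n, B (u n - f) (u n - f) + 2 * B (u n) f - B f f = B (u n) (u n) := by
    intro n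
    simp only [map_sub, LinearMap.sub_apply, hs f (u n)]
    ring
  simp only [h2] at h1
  convert h1 using 2
  ring

namespace IsCompactPair

variable {N D : LinearMap.BilinForm ℝ H}

theorem pos' (h : IsCompactPair N D) (f : H) : 0 ≤ D f f := by
  by_cases hf : f = 0
  · simp [hf]
  · exact (h.pos f hf).le

theorem eq_zero (h : IsCompactPair N D) {f : H} (hf : D f f ≤ 0) : f = 0 := by
  by_contra hne
  exact absurd (h.pos f hne) (not_lt.2 hf)

theorem orthogonal (h : IsCompactPair N D) {μ ν : ℝ} (hμν : μ ≠ ν) {f g : H}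
    (hf : f ∈ weakEigenspace N D μ) (hg : g ∈ weakEigenspace N D ν) : D f g = 0 := by
  have h1 := hf g
  have h2 := hg f
  rw [h.symm_N, h1, h.symm_D g f] at h2
  have : (μ - ν) * D f g = 0 := by linarith
  exact (mul_eq_zero.1 this).resolve_left (sub_ne_zero.2 hμν)

/-- Eigenvectors with different eigenvalues are orthogonal for both forms, so only diagonal terms
survive, and each carries an eigenvalue at most `Λ`. -/
theorem form_le_of_mem_spectralSpan (h : IsCompactPair N D) {Λ : ℝ} {f : H}
    (hf : f ∈ spectralSpan N D Λ) : N f f ≤ Λ * D f f := by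
  obtain ⟨c, hc, rfl⟩ := (Submodule.mem_iSup_iff_exists_finsupp _ _).1 hf
  have key : ∀ i j : Set.Iic Λ, N (c i) (c j) ≤ Λ * D (c i) (c j) := by
    intro i j
    have h1 := hc i (c j)
    by_cases hij : i = j
    · subst hij
      rw [h1]
      exact mul_le_mul_of_nonneg_right i.2 (h.pos' _)
    · have h2 := h.orthogonal (fun hh => hij (Subtype.ext hh)) (hc i) (hc j)
      rw [h1, h2]
      simp
  simp only [Finsupp.sum, map_sum, LinearMap.sum_apply, Finset.mul_sum]
  exact Finset.sum_le_sum fun i _ => Finset.sum_le_sum fun j _ => key _ _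

theorem form_eq_zero_of_orthogonal (h : IsCompactPair N D) {Λ : ℝ} {k : H}
    (hk : ∀ v ∈ spectralSpan N D Λ, D k v = 0) {u : H} (hu : u ∈ spectralSpan N D Λ) :
    N u k = 0 := by
  obtain ⟨c, hc, rfl⟩ := (Submodule.mem_iSup_iff_exists_finsupp _ _).1 hu
  simp only [Finsupp.sum, map_sum, LinearMap.sum_apply]
  refine Finset.sum_eq_zero fun i _ => ?_
  rw [hc i k, h.symm_D, hk _ (weakEigenspace_le_spectralSpan i.2 (hc i)), mul_zero]

/-- Compactness excludes orthonormal sequences of bounded energy. -/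
theorem not_orthonormal (h : IsCompactPair N D) (u : ℕ → H) (C : ℝ) (h1 : ∀ n, D (u n) (u n) = 1)
    (h2 : ∀ m n, m < n → D (u m) (u n) = 0) (h3 : ∀ n, N (u n) (u n) ≤ C) : False := by
  obtain ⟨φ, hφ, hc⟩ := h.compact u (C + 1) (fun n => by linarith [h1 n, h3 n])
  obtain ⟨n₀, hn⟩ := hc 1 one_pos
  have h4 := hn n₀ le_rfl (n₀ + 1) (Nat.le_succ _)
  have h5 := h2 _ _ (hφ (Nat.lt_succ_self n₀))
  simp only [map_sub, LinearMap.sub_apply, h1, h.symm_D (u (φ (n₀ + 1))) (u (φ n₀))] at h4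
  simp only [Nat.succ_eq_add_one] at h5
  rw [h5] at h4
  norm_num at h4

theorem exists_normalised (h : IsCompactPair N D) {f : H} (hf : f ≠ 0) :
    ∃ c : ℝ, c ≠ 0 ∧ D (c • f) (c • f) = 1 := by
  have h1 := h.pos f hf
  refine ⟨(√(D f f))⁻¹, inv_ne_zero (Real.sqrt_pos.2 h1).ne', ?_⟩
  simp only [map_smul, LinearMap.smul_apply, smul_eq_mul]
  rw [← mul_assoc, ← mul_inv, Real.mul_self_sqrt h1.le, inv_mul_cancel₀ h1.ne']

/-- Otherwise Gram-Schmidt inside the span would produce an infinite `D`-orthonormal sequence with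
`N`-energy at most `Λ`. -/
theorem finiteDimensional_spectralSpan (h : IsCompactPair N D) (Λ : ℝ) :
    FiniteDimensional ℝ (spectralSpan N D Λ) := by
  by_contra hinf
  have hstep : ∀ s : Finset H, (∀ x ∈ s, x ∈ spectralSpan N D Λ ∧ D x x = 1) →
      ∃ y, (y ∈ spectralSpan N D Λ ∧ D y y = 1) ∧ ∀ x ∈ s, D x y = 0 := by
    intro s hs
    have hle : Submodule.span ℝ (s : Set H) ≤ spectralSpan N D Λ :=
      Submodule.span_le.2 fun x hx => (hs x hx).1
    have hlt : Submodule.span ℝ (s : Set H) < spectralSpan N D Λ := by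
      refine lt_of_le_of_ne hle fun heq => hinf ?_
      rw [← heq]
      infer_instance
    obtain ⟨w, hw, hw'⟩ := SetLike.exists_of_lt hlt
    obtain ⟨p, hp, hpo⟩ := exists_form_projection h.pos (Submodule.span ℝ (s : Set H)) w
    have hne : w - p ≠ 0 := fun h0 => hw' (by rw [sub_eq_zero.1 h0]; exact hp)
    obtain ⟨c, -, hc⟩ := h.exists_normalised hne
    refine ⟨c • (w - p), ⟨Submodule.smul_mem _ _ (Submodule.sub_mem _ hw (hle hp)), hc⟩,
      fun x hx => ?_⟩
    rw [map_smul, h.symm_D, hpo x (Submodule.subset_span hx), smul_zero]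
  obtain ⟨u, hu, hu'⟩ := exists_seq_of_forall_finset_exists
    (fun y => y ∈ spectralSpan N D Λ ∧ D y y = 1) (fun x y => D x y = 0) hstep
  refine h.not_orthonormal u Λ (fun n => (hu n).2) hu' fun n => ?_
  have := h.form_le_of_mem_spectralSpan (hu n).1
  rwa [(hu n).2, mul_one] at this

/-- One unit eigenvector for each of infinitely many eigenvalues would again be an orthonormal
sequence of bounded energy. -/
theorem finite_eigenvalues (h : IsCompactPair N D) (Λ : ℝ) :
    {μ : ℝ | μ ≤ Λ ∧ weakEigenspace N D μ ≠ ⊥}.Finite := by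
  by_contra hinf
  have e := Set.Infinite.natEmbedding _ hinf
  have hex : ∀ n, ∃ f ∈ weakEigenspace N D (e n : ℝ), D f f = 1 := by
    intro n
    obtain ⟨f, hf, hne⟩ := Submodule.exists_mem_ne_zero_of_ne_bot (e n).2.2
    obtain ⟨c, -, hc⟩ := h.exists_normalised hne
    exact ⟨c • f, Submodule.smul_mem _ _ hf, hc⟩
  choose u hu hu1 using hex
  refine h.not_orthonormal u Λ hu1 (fun m n hmn => ?_) fun n => ?_
  · refine h.orthogonal (fun heq => hmn.ne (e.injective (Subtype.ext heq))) (hu m) (hu n)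
  · rw [hu n, hu1, mul_one]
    exact (e n).2.1

/-- The direct method: `N / D` attains its infimum on the orthogonal complement of a spectral
subspace, and a minimiser is a weak eigenvector. -/
theorem exists_minimiser (h : IsCompactPair N D) (Λ : ℝ) {w : H} (hw0 : w ≠ 0)
    (hw : ∀ v ∈ spectralSpan N D Λ, D w v = 0) :
    ∃ μ f, f ≠ 0 ∧ f ∈ weakEigenspace N D μ ∧ (∀ v ∈ spectralSpan N D Λ, D f v = 0) ∧
      μ * D w w ≤ N w w := by
  set U := spectralSpan N D Λ with hU
  have := h.finiteDimensional_spectralSpan Λ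
  set S : Set ℝ := {r | ∃ f, (∀ v ∈ U, D f v = 0) ∧ D f f = 1 ∧ N f f = r} with hS
  have hbdd : BddBelow S := ⟨0, by rintro r ⟨f, -, -, rfl⟩; exact h.nonneg f⟩
  have hne : S.Nonempty := by
    obtain ⟨c, -, hc⟩ := h.exists_normalised hw0
    refine ⟨_, c • w, fun v hv => ?_, hc, rfl⟩
    simp [hw v hv]
  set μ := sInf S with hμ
  have hmin : ∀ f, (∀ v ∈ U, D f v = 0) → μ * D f f ≤ N f f := by
    intro f hf
    by_cases hf0 : f = 0
    · simp [hf0]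
    · obtain ⟨c, hc0, hc⟩ := h.exists_normalised hf0
      have h1 : μ ≤ N (c • f) (c • f) :=
        csInf_le hbdd ⟨c • f, fun v hv => by simp [hf v hv], hc, rfl⟩
      simp only [map_smul, LinearMap.smul_apply, smul_eq_mul] at h1 hc
      have hc2 : 0 < c * c := mul_self_pos.2 hc0
      have h2 : c * c * (μ * D f f) ≤ c * c * N f f := by
        calc c * c * (μ * D f f) = μ * (c * (c * D f f)) := by ring
          _ = μ := by rw [hc, mul_one]
          _ ≤ c * (c * N f f) := h1
          _ = c * c * N f f := by ring
      exact le_of_mul_le_mul_left h2 hc2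
  have hseq : ∀ n : ℕ, ∃ f, (∀ v ∈ U, D f v = 0) ∧ D f f = 1 ∧ N f f < μ + 1 / (n + 1) := by
    intro n
    obtain ⟨r, ⟨f, hf1, hf2, hf3⟩, hr⟩ := exists_lt_of_csInf_lt hne
      (show sInf S < μ + 1 / ((n : ℝ) + 1) by
        have : (0 : ℝ) < 1 / ((n : ℝ) + 1) := by positivity
        linarith)
    exact ⟨f, hf1, hf2, by rw [hf3]; exact hr⟩
  choose u hu1 hu2 hu3 using hseq
  obtain ⟨φ, hφ, hc⟩ := h.compact u (μ + 2) (fun n => by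
    have h1 := hu3 n
    have h2 : 1 / ((n : ℝ) + 1) ≤ 1 := by
      rw [div_le_one (by positivity)]
      linarith [Nat.cast_nonneg (α := ℝ) n]
    rw [hu2]
    linarith)
  have hμ0 : 0 ≤ μ := le_csInf hne (by rintro r ⟨f, -, -, rfl⟩; exact h.nonneg f)
  -- Parallelogram law: as `N ≥ μ D` at `u_m + u_n`, near-minimality gives `N(u_m - u_n) ≤ ε/2 + μ
  -- D(u_m - u_n)`. Hence Cauchy in `D` with tolerance `ε / (2 (μ + 1))` implies Cauchy in `N + D`.
  have hcauchy : ∀ ε > 0, ∃ n₀, ∀ m ≥ n₀, ∀ n ≥ n₀,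
      N (u (φ m) - u (φ n)) (u (φ m) - u (φ n)) +
        D (u (φ m) - u (φ n)) (u (φ m) - u (φ n)) < ε := by
    intro ε hε
    obtain ⟨n₁, hn₁⟩ := hc (ε / (2 * (μ + 1))) (by positivity)
    obtain ⟨n₂, hn₂⟩ := exists_nat_one_div_lt (show 0 < ε / 8 by positivity)
    refine ⟨max n₁ n₂, fun m hm n hn => ?_⟩
    have h1 := hn₁ m (le_of_max_le_left hm) n (le_of_max_le_left hn)
    have hb : ∀ j ≥ n₂, N (u (φ j)) (u (φ j)) < μ + ε / 8 := by
      intro j hj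
      have h2 := hu3 (φ j)
      have h3 : 1 / ((φ j : ℝ) + 1) ≤ 1 / ((n₂ : ℝ) + 1) := by
        apply one_div_le_one_div_of_le (by positivity)
        have : n₂ ≤ φ j := hj.trans (hφ.id_le j)
        have : (n₂ : ℝ) ≤ φ j := by exact_mod_cast this
        linarith
      linarith
    have h2 := hb m (le_of_max_le_right hm)
    have h3 := hb n (le_of_max_le_right hn)
    have h4 := hmin (u (φ m) + u (φ n)) (fun v hv => by simp [hu1 _ v hv])
    have h5 := hu2 (φ m)
    have h6 := hu2 (φ n)
    rw [lt_div_iff₀ (by positivity)] at h1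
    simp only [map_sub, LinearMap.sub_apply, map_add, LinearMap.add_apply,
      h.symm_D (u (φ n)) (u (φ m)), h.symm_N (u (φ n)) (u (φ m)), h5, h6] at h1 h4 ⊢
    nlinarith
  obtain ⟨f, hf⟩ := h.complete (fun n => u (φ n)) hcauchy
  have hD0 : Tendsto (fun n => D (u (φ n) - f) (u (φ n) - f)) atTop (𝓝 0) := by
    rw [Metric.tendsto_atTop]
    intro ε hε
    obtain ⟨n₀, hn⟩ := hf ε hε
    refine ⟨n₀, fun n hn' => ?_⟩
    rw [Real.dist_0_eq_abs, abs_of_nonneg (h.pos' _)]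
    linarith [hn n hn', h.nonneg (u (φ n) - f)]
  have hN0 : Tendsto (fun n => N (u (φ n) - f) (u (φ n) - f)) atTop (𝓝 0) := by
    rw [Metric.tendsto_atTop]
    intro ε hε
    obtain ⟨n₀, hn⟩ := hf ε hε
    refine ⟨n₀, fun n hn' => ?_⟩
    rw [Real.dist_0_eq_abs, abs_of_nonneg (h.nonneg _)]
    linarith [hn n hn', h.pos' (u (φ n) - f)]
  have hfU : ∀ v ∈ U, D f v = 0 := fun v hv =>
    tendsto_nhds_unique (tendsto_form_left h.symm_D h.pos' hD0 v)
      (by simp [hu1 _ v hv])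
  have hfD : D f f = 1 :=
    tendsto_nhds_unique (tendsto_form_self h.symm_D h.pos' hD0) (by simp [hu2])
  have hfN : N f f ≤ μ := by
    have h1 := tendsto_form_self h.symm_N h.nonneg hN0
    have h2 : Tendsto (fun n : ℕ => μ + 1 / ((n : ℝ) + 1)) atTop (𝓝 μ) := by
      simpa using tendsto_one_div_add_atTop_nhds_zero_nat.const_add μ
    exact le_of_tendsto_of_tendsto' h1 (h2.comp hφ.tendsto_atTop) fun n => (hu3 _).le
  have hfN' : N f f = μ := le_antisymm hfN (by simpa [hfD] using hmin f hfU)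
  -- Euler-Lagrange: `N - μ D` along `f + t k` is a nonnegative quadratic in `t` without constant
  -- term, so its linear coefficient vanishes.
  have hEL : ∀ k, (∀ v ∈ U, D k v = 0) → N f k = μ * D f k := by
    intro k hk
    have hq : ∀ t : ℝ, 0 ≤ (N k k - μ * D k k) * (t * t) + (2 * (N f k - μ * D f k)) * t + 0 := by
      intro t
      have h1 := hmin (f + t • k) (fun v hv => by simp [hfU v hv, hk v hv])
      simp only [map_add, LinearMap.add_apply, map_smul, LinearMap.smul_apply, smul_eq_mul,
        h.symm_D k f, h.symm_N k f, hfD, hfN'] at h1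
      nlinarith
    have h2 := discrim_le_zero hq
    simp only [discrim, mul_zero, sub_zero] at h2
    have h3 : N f k - μ * D f k = 0 := by nlinarith [sq_nonneg (N f k - μ * D f k)]
    linarith
  refine ⟨μ, f, fun h0 => by simp [h0] at hfD, fun k => ?_, hfU, hmin w hw⟩
  -- An arbitrary test vector splits off its component `p` in `U`, on which both `N f` and `D f`
  -- vanish.
  obtain ⟨p, hp, hpo⟩ := exists_form_projection h.pos U k
  have h1 := hEL (k - p) hpo
  have h2 : N f p = 0 := by rw [h.symm_N]; exact h.form_eq_zero_of_orthogonal hfU hp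
  have h3 := hfU p hp
  simp only [map_sub, h2, h3, sub_zero] at h1
  exact h1

/-- A subspace on which `N ≤ Λ D` is at most as large as the spectral subspace. -/
theorem finrank_le_spectralSpan (h : IsCompactPair N D) {Λ : ℝ} (W : Submodule ℝ H)
    [FiniteDimensional ℝ W] (hW : ∀ f ∈ W, N f f ≤ Λ * D f f) :
    Module.finrank ℝ W ≤ Module.finrank ℝ (spectralSpan N D Λ) := by
  have := h.finiteDimensional_spectralSpan Λ
  by_contra! hlt
  -- A larger `W` would contain `w` orthogonal to the spectral span. The minimiser then has an
  -- eigenvalue at most `Λ` and so lies in the very span to which it is orthogonal.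
  obtain ⟨w, hwW, hw0, hw⟩ := exists_orthogonal_ne_zero D _ _ hlt
  obtain ⟨μ, f, hf0, hf, hfU, hμ⟩ := h.exists_minimiser Λ hw0 hw
  have h1 : μ ≤ Λ := le_of_mul_le_mul_right (hμ.trans (hW w hwW)) (h.pos w hw0)
  exact (h.pos f hf0).ne' (hfU f (weakEigenspace_le_spectralSpan h1 hf))

/-- No finite-dimensional spectral span exhausts `H`, and minimising on its orthogonal complement
yields a further eigenvector. -/
theorem exists_le_finrank (h : IsCompactPair N D) (hinf : ¬ FiniteDimensional ℝ H) (k : ℕ) :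
    ∃ Λ, k ≤ Module.finrank ℝ (spectralSpan N D Λ) := by
  induction k with
  | zero => exact ⟨0, Nat.zero_le _⟩
  | succ k ih =>
    obtain ⟨Λ, hΛ⟩ := ih
    have := h.finiteDimensional_spectralSpan Λ
    have hne : ∃ x, x ∉ spectralSpan N D Λ := by
      by_contra! hall
      have htop : spectralSpan N D Λ = ⊤ := by ext x; simp [hall x]
      rw [htop] at this
      exact hinf (Module.Finite.equiv (Submodule.topEquiv (R := ℝ) (M := H)))
    obtain ⟨x, hx⟩ := hne
    obtain ⟨p, hp, hpo⟩ := exists_form_projection h.pos (spectralSpan N D Λ) x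
    have hne : x - p ≠ 0 := fun h0 => hx (by rw [sub_eq_zero.1 h0]; exact hp)
    obtain ⟨μ, f, hf0, hf, hfU, -⟩ := h.exists_minimiser Λ hne hpo
    refine ⟨max Λ μ, ?_⟩
    have := h.finiteDimensional_spectralSpan (max Λ μ)
    have hfm : f ∈ spectralSpan N D (max Λ μ) :=
      weakEigenspace_le_spectralSpan (le_max_right _ _) hf
    have hlt : spectralSpan N D Λ < spectralSpan N D (max Λ μ) :=
      lt_of_le_of_ne (spectralSpan_mono (le_max_left _ _)) fun heq =>
        (h.pos f hf0).ne' (hfU f (heq ▸ hfm))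
    have := Submodule.finrank_lt_finrank_of_lt hlt
    omega

/-- Around any `Λ` there is an interval without other eigenvalues. -/
theorem exists_gap (h : IsCompactPair N D) (Λ : ℝ) :
    ∃ δ > 0, ∀ μ, |μ - Λ| ≤ δ → weakEigenspace N D μ ≠ ⊥ → μ = Λ := by
  have hfin := (h.finite_eigenvalues (Λ + 1)).subset
    (show {μ : ℝ | μ ≤ Λ + 1 ∧ weakEigenspace N D μ ≠ ⊥} \ {Λ} ⊆ _ from Set.sdiff_subset)
  have hopen := hfin.isClosed.isOpen_compl
  obtain ⟨ε, hε, hball⟩ := Metric.isOpen_iff.1 hopen Λ (by simp)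
  refine ⟨min (ε / 2) 1, by positivity, fun μ hμ hne => ?_⟩
  by_contra hneq
  have h1 : μ ∈ Metric.ball Λ ε := by
    rw [Metric.mem_ball, Real.dist_eq]
    linarith [hμ.trans (min_le_left _ _)]
  refine hball h1 ⟨⟨?_, hne⟩, hneq⟩
  linarith [(abs_le.1 (hμ.trans (min_le_right _ _))).2]

theorem spectralSpan_eq_of_no_eigenvalue {Λ Λ' : ℝ} (hle : Λ ≤ Λ')
    (hno : ∀ μ, Λ < μ → μ ≤ Λ' → weakEigenspace N D μ = ⊥) :
    spectralSpan N D Λ' = spectralSpan N D Λ := by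
  refine le_antisymm (iSup_le fun μ => ?_) (spectralSpan_mono hle)
  by_cases hμ : (μ : ℝ) ≤ Λ
  · exact weakEigenspace_le_spectralSpan hμ
  · rw [hno μ (not_le.1 hμ) μ.2]
    exact bot_le

/-- The infimum defining the eigenvalue is attained: by `exists_gap` the spectral span does not
change just to the right of it. Infinite dimension makes the defining set nonempty, and
nonnegativity of `N` bounds it below by `0`. -/
theorem weakEigenvalue_le_iff (h : IsCompactPair N D) (hinf : ¬ FiniteDimensional ℝ H) (k : ℕ)
    (Λ : ℝ) : weakEigenvalue N D k ≤ Λ ↔ k + 1 ≤ Module.finrank ℝ (spectralSpan N D Λ) := by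
  have := fun Λ => h.finiteDimensional_spectralSpan Λ
  have hbdd : BddBelow {Λ : ℝ | k + 1 ≤ Module.finrank ℝ (spectralSpan N D Λ)} := by
    refine ⟨0, fun Λ hΛ => ?_⟩
    by_contra! hneg
    have hbot : spectralSpan N D Λ = ⊥ := by
      refine (Submodule.eq_bot_iff _).2 fun f hf => ?_
      by_contra hne
      have h1 := h.form_le_of_mem_spectralSpan hf
      nlinarith [h.nonneg f, h.pos f hne]
    have hΛ' : k + 1 ≤ Module.finrank ℝ (spectralSpan N D Λ) := hΛ
    rw [hbot, finrank_bot] at hΛ'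
    omega
  have hmono : ∀ {a b : ℝ}, a ≤ b → Module.finrank ℝ (spectralSpan N D a) ≤
      Module.finrank ℝ (spectralSpan N D b) := fun hab =>
    Submodule.finrank_mono (spectralSpan_mono hab)
  refine ⟨fun hle => ?_, fun hk => csInf_le hbdd hk⟩
  refine le_trans ?_ (hmono hle)
  obtain ⟨δ, hδ, hgap⟩ := h.exists_gap (weakEigenvalue N D k)
  obtain ⟨Λ', hΛ', hlt⟩ := exists_lt_of_csInf_lt
    (show {Λ : ℝ | k + 1 ≤ Module.finrank ℝ (spectralSpan N D Λ)}.Nonempty from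
      h.exists_le_finrank hinf (k + 1))
    (show sInf _ < weakEigenvalue N D k + δ from lt_add_of_pos_right _ hδ)
  have hge : weakEigenvalue N D k ≤ Λ' := csInf_le hbdd hΛ'
  rw [← spectralSpan_eq_of_no_eigenvalue hge]
  · exact hΛ'
  · intro μ h1 h2
    by_contra hne
    exact h1.ne' (hgap μ (abs_le.2 ⟨by linarith, by linarith⟩) hne)

/-- The upper half of the min-max principle. -/
theorem weakEigenvalue_le_of_form_le (h : IsCompactPair N D) (hinf : ¬ FiniteDimensional ℝ H)
    {k : ℕ} {Λ : ℝ} (W : Submodule ℝ H) [FiniteDimensional ℝ W]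
    (hk : k + 1 ≤ Module.finrank ℝ W) (hW : ∀ f ∈ W, N f f ≤ Λ * D f f) :
    weakEigenvalue N D k ≤ Λ :=
  (h.weakEigenvalue_le_iff hinf k Λ).2 (hk.trans (h.finrank_le_spectralSpan W hW))

/-- The lower half of the min-max principle. -/
theorem le_weakEigenvalue_of_le_form (h : IsCompactPair N D) (hinf : ¬ FiniteDimensional ℝ H)
    (B : LinearMap.BilinForm ℝ H) {k : ℕ} {Λ : ℝ} (X : Submodule ℝ H) [FiniteDimensional ℝ X]
    (hk : Module.finrank ℝ X ≤ k)
    (hX : ∀ f, (∀ x ∈ X, B f x = 0) → Λ * D f f ≤ N f f) :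
    Λ ≤ weakEigenvalue N D k := by
  have := h.finiteDimensional_spectralSpan (weakEigenvalue N D k)
  have h1 := (h.weakEigenvalue_le_iff hinf k _).1 le_rfl
  -- Only dimensions are counted, so the constraints may be expressed by any bilinear form `B`,
  -- unrelated to `N` and `D`.
  obtain ⟨w, hwW, hw0, hw⟩ := exists_orthogonal_ne_zero B X
    (spectralSpan N D (weakEigenvalue N D k)) (by omega)
  have h2 := h.form_le_of_mem_spectralSpan hwW
  exact le_of_mul_le_mul_right ((hX w hw).trans h2) (h.pos w hw0)

end IsCompactPair

end FormPair

/-! ### First-order perturbation of eigenvalues -/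

section Perturbation

variable {H : Type*} [AddCommGroup H] [Module ℝ H]

/-- Since `y` and `z` are `B₀`-orthogonal, `B y z` has size `ε`. Weighted by Young's inequality, the
cross term takes a quarter of the coercivity `δ` on `z` and costs only `ε²` on `y`; with `ε` of
order `t`, this is negligible against first-order terms. -/
theorem nonneg_form_add_of_perturbation {B₀ B n : LinearMap.BilinForm ℝ H}
    (hB₀ : ∀ f g, B₀ f g = B₀ g f) (hB : ∀ f g, B f g = B g f) (hn : ∀ f g, n f g = n g f)
    (hn0 : ∀ f, 0 ≤ n f f) {ε δ : ℝ} (hε : 0 ≤ ε) (hδ : 0 < δ) (hεδ : ε ≤ δ / 2)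
    (hclose : ∀ f, |B f f - B₀ f f| ≤ ε * n f f) {y z : H} (hyz : B₀ y z = 0)
    (hz : δ * n z z ≤ B₀ z z) (hy : 4 * ε ^ 2 / δ * n y y ≤ B y y) :
    0 ≤ B (y + z) (y + z) := by
  have hcross : -(4 * ε ^ 2 / δ * n y y + δ / 4 * n z z) ≤ 2 * B y z := by
    have h1 : ∀ s : ℝ, |2 * s * B y z| ≤ ε * (s ^ 2 * n y y + n z z) := by
      intro s
      have h2 := abs_le.1 (hclose (s • y + z))
      have h3 := abs_le.1 (hclose (s • y - z))
      simp only [map_add, map_sub, LinearMap.add_apply, LinearMap.sub_apply, map_smul,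
        LinearMap.smul_apply, smul_eq_mul, hB z y, hB₀ z y, hn z y, hyz] at h2 h3
      rw [abs_le]
      constructor <;> nlinarith
    rcases hε.eq_or_lt with h0 | hpos
    · have h2 := h1 1
      rw [← h0] at h2 ⊢
      have h3 : B y z = 0 := by
        have := abs_nonpos_iff.1 (h2.trans (by simp))
        linarith
      rw [h3]
      have := mul_nonneg hδ.le (hn0 z)
      simp
      linarith
    -- This scaling of `y` balances the two sides of Young's inequality: after division by `s`, the
    -- weights `ε s` and `ε / s` become `4 ε² / δ` and `δ / 4`. The case `ε = 0` is separate because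
    -- then `s = 0`.
    · have h2 := (abs_le.1 (h1 (4 * ε / δ))).1
      have h3 : 0 < 4 * ε / δ := by positivity
      have h4 : (4 * ε / δ) * (-(4 * ε ^ 2 / δ * n y y + δ / 4 * n z z)) ≤
          (4 * ε / δ) * (2 * B y z) := by
        calc (4 * ε / δ) * (-(4 * ε ^ 2 / δ * n y y + δ / 4 * n z z))
            = -(ε * ((4 * ε / δ) ^ 2 * n y y + n z z)) := by field_simp
          _ ≤ 2 * (4 * ε / δ) * B y z := h2
          _ = (4 * ε / δ) * (2 * B y z) := by ring
      exact le_of_mul_le_mul_left h4 h3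
  have h5 := (abs_le.1 (hclose z)).1
  have h6 := mul_le_mul_of_nonneg_right hεδ (hn0 z)
  have h7 := mul_nonneg hδ.le (hn0 z)
  simp only [map_add, LinearMap.add_apply, hB z y]
  linarith

/-- `P t = P 0 + t P' + o(t)` as quadratic forms, uniformly relative to the form `n`. -/
structure HasFormDeriv (n : LinearMap.BilinForm ℝ H) (P : ℝ → LinearMap.BilinForm ℝ H)
    (P' : LinearMap.BilinForm ℝ H) : Prop where
  symm : ∀ t f g, P t f g = P t g f
  bound : ∃ C, 0 ≤ C ∧ ∀ f, |P' f f| ≤ C * n f f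
  expansion : ∀ η > 0, ∀ᶠ t in 𝓝 (0 : ℝ), ∀ f,
    |P t f f - P 0 f f - t * P' f f| ≤ η * |t| * n f f

theorem HasFormDeriv.add {n : LinearMap.BilinForm ℝ H}
    {P R : ℝ → LinearMap.BilinForm ℝ H} {P' R' : LinearMap.BilinForm ℝ H}
    (hP : HasFormDeriv n P P') (hR : HasFormDeriv n R R') :
    HasFormDeriv n (fun t => P t + R t) (P' + R') where
  symm t f g := by simp [hP.symm t f g, hR.symm t f g]
  bound := by
    obtain ⟨C, hC0, hC⟩ := hP.bound
    obtain ⟨C', hC0', hC'⟩ := hR.bound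
    refine ⟨C + C', by positivity, fun f => ?_⟩
    have h1 := abs_add_le (P' f f) (R' f f)
    simp only [LinearMap.add_apply]
    linarith [hC f, hC' f]
  expansion η hη := by
    filter_upwards [hP.expansion (η / 2) (by positivity), hR.expansion (η / 2) (by positivity)]
      with t h1 h2 f
    have h3 := abs_add_le (P t f f - P 0 f f - t * P' f f) (R t f f - R 0 f f - t * R' f f)
    simp only [LinearMap.add_apply]
    calc _ = |P t f f - P 0 f f - t * P' f f + (R t f f - R 0 f f - t * R' f f)| := by
          congr 1; ring
      _ ≤ η * |t| * n f f := by linarith [h1 f, h2 f]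

theorem HasFormDeriv.const_smul {n : LinearMap.BilinForm ℝ H}
    {P : ℝ → LinearMap.BilinForm ℝ H} {P' : LinearMap.BilinForm ℝ H}
    (hP : HasFormDeriv n P P') (c : ℝ) :
    HasFormDeriv n (fun t => c • P t) (c • P') where
  symm t f g := by simp [hP.symm t f g]
  bound := by
    obtain ⟨C, hC0, hC⟩ := hP.bound
    refine ⟨|c| * C, by positivity, fun f => ?_⟩
    simp only [LinearMap.smul_apply, smul_eq_mul, abs_mul]
    have := mul_le_mul_of_nonneg_left (hC f) (abs_nonneg c)
    linarith
  expansion η hη := by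
    filter_upwards [hP.expansion (η / (|c| + 1)) (by positivity)] with t h1 f
    have h2 := mul_le_mul_of_nonneg_left (h1 f) (abs_nonneg c)
    have h4 : 0 ≤ η / (|c| + 1) * |t| * n f f := (abs_nonneg _).trans (h1 f)
    have h3 : (|c| + 1) * (η / (|c| + 1) * |t| * n f f) = η * |t| * n f f := by
      field_simp
    simp only [LinearMap.smul_apply, smul_eq_mul]
    calc _ = |c| * |P t f f - P 0 f f - t * P' f f| := by
          rw [← abs_mul]; congr 1; ring
      _ ≤ η * |t| * n f f := by linarith

/-- `P 0` degenerates on `Y` and is coercive on `Z`, so the sign of `P t` on `Y + Z` is decided by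
`t P'` on `Y`, up to an error absorbed by `η |t| D t`. The condition on `Y` stands under the filter
because it may hold for one sign of `t` only. -/
theorem eventually_nonneg_form_add {n P' D' : LinearMap.BilinForm ℝ H}
    {P D : ℝ → LinearMap.BilinForm ℝ H} (hP : HasFormDeriv n P P') (hD : HasFormDeriv n D D')
    (hn : ∀ f g, n f g = n g f) (hn0 : ∀ f, 0 ≤ n f f) (hDn : ∀ f, |D 0 f f| ≤ n f f)
    {Y Z : Submodule ℝ H} (hYZ : ∀ y ∈ Y, ∀ z ∈ Z, P 0 y z = 0) (hY : ∀ y ∈ Y, P 0 y y = 0)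
    {δ : ℝ} (hδ : 0 < δ) (hZ : ∀ z ∈ Z, δ * n z z ≤ P 0 z z)
    {K : ℝ} (hK : 0 < K) (hYK : ∀ y ∈ Y, n y y ≤ K * D 0 y y) (c : ℝ) {η : ℝ} (hη : 0 < η) :
    ∀ᶠ t in 𝓝 (0 : ℝ), (∀ y ∈ Y, -(c * |t| * D 0 y y) ≤ t * P' y y) →
      ∀ y ∈ Y, ∀ z ∈ Z, 0 ≤ P t (y + z) (y + z) + (c + η) * |t| * D t (y + z) (y + z) := by
  obtain ⟨CP, hCP0, hCP⟩ := hP.bound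
  obtain ⟨CD, hCD0, hCD⟩ := hD.bound
  set A : ℝ := CP + 1 + |c + η| * (CD + 2) with hA
  have hA0 : 0 < A := by positivity
  have hsmall : ∀ {r : ℝ}, 0 < r → ∀ᶠ t in 𝓝 (0 : ℝ), |t| < r := fun hr => by
    have := Metric.ball_mem_nhds (0 : ℝ) hr
    filter_upwards [this] with t ht
    simpa using ht
  set G : ℝ := |c + η| * (CD + 1) + 4 * A ^ 2 / δ with hG
  have hG0 : 0 < G := by positivity
  -- On `Y`, where `n ≤ K D 0`, the margin `η |t| D 0` is spent in two halves: the expansion error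
  -- of `P` takes one, and the second-order terms, collected in `G`, take the other. The bound with
  -- `A` places the perturbation below half the coercivity constant.
  filter_upwards [hP.expansion (min 1 (η / (2 * K))) (by positivity), hD.expansion 1 one_pos,
    hsmall one_pos, hsmall (show 0 < δ / 2 / A by positivity),
    hsmall (show 0 < η / (2 * K) / G by positivity)] with t h1 h2 ht1 ht2 ht3 hyp y hy z hz
  rw [lt_div_iff₀ (by positivity)] at ht2 ht3
  have hDd : ∀ f, |D t f f - D 0 f f| ≤ |t| * (CD + 1) * n f f := by
    intro f
    have h3 := h2 f
    have h4 : |t * D' f f| ≤ |t| * (CD * n f f) := by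
      rw [abs_mul]; exact mul_le_mul_of_nonneg_left (hCD f) (abs_nonneg t)
    have h5 := abs_add_le (D t f f - D 0 f f - t * D' f f) (t * D' f f)
    rw [sub_add_cancel] at h5
    linarith
  have hDt : ∀ f, |D t f f| ≤ (CD + 2) * n f f := by
    intro f
    have h3 := abs_add_le (D t f f - D 0 f f) (D 0 f f)
    rw [sub_add_cancel] at h3
    have h4 : |t| * ((CD + 1) * n f f) ≤ 1 * ((CD + 1) * n f f) :=
      mul_le_mul_of_nonneg_right ht1.le (mul_nonneg (by positivity) (hn0 f))
    linarith [hDd f, hDn f]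
  have hclose : ∀ f, |(P t + ((c + η) * |t|) • D t) f f - P 0 f f| ≤ |t| * A * n f f := by
    intro f
    have h3 : |P t f f - P 0 f f - t * P' f f| ≤ |t| * n f f := by
      refine (h1 f).trans ?_
      have := mul_le_mul_of_nonneg_right (min_le_left 1 (η / (2 * K)))
        (mul_nonneg (abs_nonneg t) (hn0 f))
      linarith
    have h4 : |t * P' f f| ≤ |t| * (CP * n f f) := by
      rw [abs_mul]; exact mul_le_mul_of_nonneg_left (hCP f) (abs_nonneg t)
    have h5 : |(c + η) * |t| * D t f f| ≤ |c + η| * |t| * ((CD + 2) * n f f) := by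
      rw [abs_mul, abs_mul, abs_abs]
      exact mul_le_mul_of_nonneg_left (hDt f) (by positivity)
    have h6 := abs_add_three (P t f f - P 0 f f - t * P' f f) (t * P' f f)
      ((c + η) * |t| * D t f f)
    have h7 : (P t + ((c + η) * |t|) • D t) f f - P 0 f f =
        P t f f - P 0 f f - t * P' f f + t * P' f f + (c + η) * |t| * D t f f := by
      simp only [LinearMap.add_apply, LinearMap.smul_apply, smul_eq_mul]; ring
    rw [h7, hA]
    linarith
  have key := nonneg_form_add_of_perturbation (B₀ := P 0) (B := P t + ((c + η) * |t|) • D t)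
    (hP.symm 0) (fun f g => by simp [hP.symm t f g, hD.symm t f g]) hn hn0
    (show 0 ≤ |t| * A by positivity) hδ ht2.le hclose (hYZ y hy z hz) (hZ z hz) ?_
  · exact key
  · have h3 := (abs_le.1 (h1 y)).1
    have h4 : (c + η) * (D 0 y y - D t y y) ≤ |c + η| * (|t| * (CD + 1) * n y y) := by
      refine (le_abs_self _).trans ?_
      rw [abs_mul, abs_sub_comm (D 0 y y)]
      exact mul_le_mul_of_nonneg_left (hDd y) (abs_nonneg _)
    have h4' := mul_le_mul_of_nonneg_left h4 (abs_nonneg t)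
    have h5 := hyp y hy
    have h6 := hYK y hy
    have h7 : min 1 (η / (2 * K)) * |t| * n y y ≤ η / (2 * K) * (|t| * n y y) := by
      rw [mul_assoc]
      exact mul_le_mul_of_nonneg_right (min_le_right _ _) (mul_nonneg (abs_nonneg t) (hn0 y))
    have h8 : |t| * G * (|t| * n y y) ≤ η / (2 * K) * (|t| * n y y) :=
      mul_le_mul_of_nonneg_right ht3.le (mul_nonneg (abs_nonneg t) (hn0 y))
    have h9 : η / (2 * K) * (|t| * n y y) + η / (2 * K) * (|t| * n y y) ≤ η * |t| * D 0 y y := by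
      calc _ = η * |t| / K * n y y := by field_simp; ring
        _ ≤ η * |t| / K * (K * D 0 y y) := mul_le_mul_of_nonneg_left h6 (by positivity)
        _ = η * |t| * D 0 y y := by field_simp
    rw [hG] at h8
    simp only [LinearMap.add_apply, LinearMap.smul_apply, smul_eq_mul]
    rw [hY y hy] at h3
    have h10 : 4 * (|t| * A) ^ 2 / δ * n y y = |t| * (4 * A ^ 2 / δ) * (|t| * n y y) := by ring
    rw [h10]
    linarith

namespace IsCompactPair

variable {N D : LinearMap.BilinForm ℝ H}

theorem weakEigenvalue_nonneg (h : IsCompactPair N D) (hinf : ¬ FiniteDimensional ℝ H) (k : ℕ) :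
    0 ≤ weakEigenvalue N D k := by
  have h1 := (h.weakEigenvalue_le_iff hinf k _).1 le_rfl
  have hne : spectralSpan N D (weakEigenvalue N D k) ≠ ⊥ := by
    intro h0
    rw [h0, finrank_bot] at h1
    omega
  obtain ⟨f, hf, hf0⟩ := Submodule.exists_mem_ne_zero_of_ne_bot hne
  have h2 := (h.nonneg f).trans (h.form_le_of_mem_spectralSpan hf)
  exact nonneg_of_mul_nonneg_left h2 (h.pos f hf0)

/-- The infimum of `N / D` on the complement is an eigenvalue above `Λ`, and eigenvalues above `Λ`
keep a distance from it. -/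
theorem exists_spectral_gap (h : IsCompactPair N D) (Λ : ℝ) :
    ∃ δ > 0, ∀ z, (∀ v ∈ spectralSpan N D Λ, D z v = 0) → (Λ + δ) * D z z ≤ N z z := by
  obtain ⟨δ, hδ, hgap⟩ := h.exists_gap Λ
  refine ⟨δ, hδ, fun z hz => ?_⟩
  by_cases hz0 : z = 0
  · simp [hz0]
  obtain ⟨μ, f, hf0, hf, hfo, hμ⟩ := h.exists_minimiser Λ hz0 hz
  refine le_trans (mul_le_mul_of_nonneg_right ?_ (h.pos' z)) hμ
  have h1 : Λ < μ := by
    by_contra! hle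
    exact (h.pos f hf0).ne' (hfo f (weakEigenspace_le_spectralSpan hle hf))
  by_contra! hlt
  refine h1.ne' (hgap μ (abs_le.2 ⟨by linarith, by linarith⟩) fun hbot => hf0 ?_)
  rw [hbot] at hf
  simpa using hf

/-- `X` is the `D`-orthogonal complement of `Y` inside the spectral span. These at most `k` linear
constraints leave only `Y` and what is orthogonal to the whole span, as the lower half of min-max
requires. -/
theorem exists_orthogonal_complement (h : IsCompactPair N D) {Λ : ℝ} {Y : Submodule ℝ H}
    (hY : Y ≤ spectralSpan N D Λ) {k : ℕ}
    (hk : Module.finrank ℝ (spectralSpan N D Λ) ≤ k + Module.finrank ℝ Y) :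
    ∃ X : Submodule ℝ H, FiniteDimensional ℝ X ∧ Module.finrank ℝ X ≤ k ∧
      ∀ f, (∀ x ∈ X, D f x = 0) →
        ∃ y ∈ Y, ∃ z, (∀ v ∈ spectralSpan N D Λ, D z v = 0) ∧ f = y + z := by
  have := h.finiteDimensional_spectralSpan Λ
  have : FiniteDimensional ℝ Y := Submodule.finiteDimensional_of_le hY
  let O : Submodule ℝ H :=
    { carrier := {x | ∀ y ∈ Y, D x y = 0}
      add_mem' := fun {a b} ha hb y hy => by simp [ha y hy, hb y hy]
      zero_mem' := fun y _ => by simp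
      smul_mem' := fun c a ha y hy => by simp [ha y hy] }
  have hX : FiniteDimensional ℝ (spectralSpan N D Λ ⊓ O : Submodule ℝ H) :=
    Submodule.finiteDimensional_of_le inf_le_left
  refine ⟨spectralSpan N D Λ ⊓ O, hX, ?_, fun f hf => ?_⟩
  · have h1 := Submodule.finrank_sup_add_finrank_inf_eq (spectralSpan N D Λ ⊓ O) Y
    have h2 : (spectralSpan N D Λ ⊓ O) ⊓ Y = ⊥ := by
      refine (Submodule.eq_bot_iff _).2 fun x hx => h.eq_zero ?_
      exact (hx.1.2 x hx.2).le
    rw [h2, finrank_bot] at h1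
    have h3 := Submodule.finrank_mono (sup_le inf_le_left hY :
      (spectralSpan N D Λ ⊓ O) ⊔ Y ≤ spectralSpan N D Λ)
    omega
  · obtain ⟨p, hp, hpo⟩ := exists_form_projection h.pos (spectralSpan N D Λ) f
    obtain ⟨y, hy, hyo⟩ := exists_form_projection h.pos Y p
    have hmem : p - y ∈ spectralSpan N D Λ ⊓ O :=
      ⟨Submodule.sub_mem _ hp (hY hy), hyo⟩
    have h1 := hf _ hmem
    have h2 := hpo _ hmem.1
    have h3 := hyo y hy
    have h4 : p - y = 0 := by
      apply h.eq_zero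
      have h5 : D p (p - y) = 0 := by
        have : D f (p - y) - D p (p - y) = 0 := by rw [← LinearMap.sub_apply, ← map_sub]; exact h2
        linarith
      have h6 : D y (p - y) = 0 := by rw [h.symm_D]; exact h3
      have : D (p - y) (p - y) = D p (p - y) - D y (p - y) := by simp
      linarith
    have h5 : p = y := sub_eq_zero.1 h4
    exact ⟨y, hy, f - y, by rw [← h5]; exact hpo, by abel⟩

end IsCompactPair

/-! ### First-order bounds for eigenvalues along a family of pairs -/

variable {N D : ℝ → LinearMap.BilinForm ℝ H} {ℓ : ℝ → ℝ} {N' D' : LinearMap.BilinForm ℝ H}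

theorem hasFormDeriv_sub_smul {n : LinearMap.BilinForm ℝ H}
    (hN : HasFormDeriv n (fun t => ℓ t • N t) N') (hD : HasFormDeriv n D D') (F : ℝ) :
    HasFormDeriv n (fun t => ℓ t • N t - F • D t) (N' - F • D') := by
  have e : ∀ A B : LinearMap.BilinForm ℝ H, A - F • B = A + (-F) • B := fun A B => by
    ext f g
    simp [sub_eq_add_neg]
  simp only [e]
  exact hN.add (hD.const_smul (-F))

/-- First-order upper bound for a normalised eigenvalue. -/
theorem eventually_eigenvalue_le (hinf : ¬ FiniteDimensional ℝ H)
    (hpair : ∀ᶠ t in 𝓝 (0 : ℝ), IsCompactPair (N t) (D t)) (hℓ : ∀ᶠ t in 𝓝 (0 : ℝ), 0 < ℓ t)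
    (hN : HasFormDeriv (N 0 + D 0) (fun t => ℓ t • N t) N')
    (hD : HasFormDeriv (N 0 + D 0) D D') {k : ℕ} {Λ : ℝ}
    (hΛ : Λ = weakEigenvalue (N 0) (D 0) k) {Y : Submodule ℝ H}
    (hY : Y ≤ weakEigenspace (N 0) (D 0) Λ) [FiniteDimensional ℝ Y] {δ : ℝ} (hδ : 0 < δ)
    (hk : k + 1 ≤ Module.finrank ℝ (spectralSpan (N 0) (D 0) (Λ - δ)) + Module.finrank ℝ Y)
    (c : ℝ) {η : ℝ} (hη : 0 < η) :
    ∀ᶠ t in 𝓝 (0 : ℝ),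
      (∀ y ∈ Y, t * (N' - (ℓ 0 * Λ) • D') y y ≤ c * |t| * D 0 y y) →
      ℓ t * weakEigenvalue (N t) (D t) k ≤ ℓ 0 * Λ + (c + η) * |t| := by
  have h0 := hpair.self_of_nhds
  have hℓ0 := hℓ.self_of_nhds
  have hΛ0 : 0 ≤ Λ := hΛ ▸ h0.weakEigenvalue_nonneg hinf k
  have hfin := h0.finiteDimensional_spectralSpan (Λ - δ)
  -- For an upper bound the negated form `F D - ℓ N`, with `F = ℓ 0 * Λ`, must stay nonnegative. At
  -- `t = 0` it is coercive on the eigenvectors with eigenvalue at most `Λ - δ`, where `Λ D - N ≥ δ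
  -- D`, and it is zero on `Y`.
  have hB := (hasFormDeriv_sub_smul hN hD (ℓ 0 * Λ)).const_smul (-1)
  have hev := eventually_nonneg_form_add hB hD (fun f g => by simp [h0.symm_N f g, h0.symm_D f g])
    (fun f => add_nonneg (h0.nonneg f) (h0.pos' f))
    (fun f => by
      rw [abs_of_nonneg (h0.pos' f)]
      exact le_add_of_nonneg_left (h0.nonneg f))
    (Y := Y) (Z := spectralSpan (N 0) (D 0) (Λ - δ))
    (fun y hy z _ => by simp [hY hy z]; ring)
    (fun y hy => by simp [hY hy y]; ring)
    (δ := ℓ 0 * δ / (Λ + 1)) (by positivity)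
    (fun u hu => by
      have h1 := h0.form_le_of_mem_spectralSpan hu
      have h2 := h0.pos' u
      have h3 : ℓ 0 * δ / (Λ + 1) * (N 0 + D 0) u u ≤ ℓ 0 * δ / (Λ + 1) * ((Λ + 1) * D 0 u u) := by
        apply mul_le_mul_of_nonneg_left _ (by positivity)
        simp only [LinearMap.add_apply]
        nlinarith
      have h4 : ℓ 0 * δ / (Λ + 1) * ((Λ + 1) * D 0 u u) = ℓ 0 * (δ * D 0 u u) := by
        field_simp
      have h5 : ℓ 0 * (δ * D 0 u u) ≤ ℓ 0 * (Λ * D 0 u u - N 0 u u) :=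
        mul_le_mul_of_nonneg_left (by linarith) hℓ0.le
      refine h3.trans (h4.le.trans (h5.trans (le_of_eq ?_)))
      simp; ring)
    (K := Λ + 1) (by positivity)
    (fun y hy => by simp [hY hy y]; linarith) c hη
  filter_upwards [hev, hpair, hℓ] with t h1 ht hℓt hyp
  have h2 := h1 (fun y hy => by
    have := hyp y hy
    simp only [LinearMap.smul_apply, smul_eq_mul] at this ⊢
    linarith)
  have hdis : spectralSpan (N 0) (D 0) (Λ - δ) ⊓ Y = ⊥ := by
    refine (Submodule.eq_bot_iff _).2 fun x hx => h0.eq_zero ?_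
    have h3 := h0.form_le_of_mem_spectralSpan hx.1
    rw [hY hx.2 x] at h3
    nlinarith
  have hrank := Submodule.finrank_sup_add_finrank_inf_eq (spectralSpan (N 0) (D 0) (Λ - δ)) Y
  rw [hdis, finrank_bot] at hrank
  -- The trial space is chosen at `t = 0` and kept for all small `t`.
  have h4 := ht.weakEigenvalue_le_of_form_le hinf (k := k)
    (Λ := (ℓ 0 * Λ + (c + η) * |t|) / ℓ t) (spectralSpan (N 0) (D 0) (Λ - δ) ⊔ Y) (by omega)
    (fun f hf => by
      obtain ⟨u, hu, y, hy, rfl⟩ := Submodule.mem_sup.1 hf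
      have h5 := h2 y hy u hu
      rw [add_comm y u] at h5
      simp only [LinearMap.smul_apply, LinearMap.sub_apply, smul_eq_mul] at h5
      rw [div_mul_eq_mul_div, le_div_iff₀ hℓt]
      linarith)
  rw [le_div_iff₀ hℓt] at h4
  linarith

/-- First-order lower bound for a normalised eigenvalue. -/
theorem eventually_le_eigenvalue (hinf : ¬ FiniteDimensional ℝ H)
    (hpair : ∀ᶠ t in 𝓝 (0 : ℝ), IsCompactPair (N t) (D t)) (hℓ : ∀ᶠ t in 𝓝 (0 : ℝ), 0 < ℓ t)
    (hN : HasFormDeriv (N 0 + D 0) (fun t => ℓ t • N t) N')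
    (hD : HasFormDeriv (N 0 + D 0) D D') {k : ℕ} {Λ : ℝ}
    (hΛ : Λ = weakEigenvalue (N 0) (D 0) k) {Y : Submodule ℝ H}
    (hY : Y ≤ weakEigenspace (N 0) (D 0) Λ)
    (hk : Module.finrank ℝ (spectralSpan (N 0) (D 0) Λ) ≤ k + Module.finrank ℝ Y)
    (c : ℝ) {η : ℝ} (hη : 0 < η) :
    ∀ᶠ t in 𝓝 (0 : ℝ),
      (∀ y ∈ Y, c * |t| * D 0 y y ≤ t * (N' - (ℓ 0 * Λ) • D') y y) →
      ℓ 0 * Λ + (c - η) * |t| ≤ ℓ t * weakEigenvalue (N t) (D t) k := by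
  have h0 := hpair.self_of_nhds
  have hℓ0 := hℓ.self_of_nhds
  have hΛ0 : 0 ≤ Λ := hΛ ▸ h0.weakEigenvalue_nonneg hinf k
  have hB := hasFormDeriv_sub_smul hN hD (ℓ 0 * Λ)
  obtain ⟨δ, hδ, hgap⟩ := h0.exists_spectral_gap Λ
  obtain ⟨X, hXfin, hXk, hX⟩ := h0.exists_orthogonal_complement
    (hY.trans (weakEigenspace_le_spectralSpan le_rfl)) hk
  let Z : Submodule ℝ H :=
    { carrier := {x | ∀ v ∈ spectralSpan (N 0) (D 0) Λ, D 0 x v = 0}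
      add_mem' := fun {a b} ha hb y hy => by simp [ha y hy, hb y hy]
      zero_mem' := fun y _ => by simp
      smul_mem' := fun c a ha y hy => by simp [ha y hy] }
  have hev := eventually_nonneg_form_add hB hD (fun f g => by simp [h0.symm_N f g, h0.symm_D f g])
    (fun f => add_nonneg (h0.nonneg f) (h0.pos' f))
    (fun f => by
      rw [abs_of_nonneg (h0.pos' f)]
      exact le_add_of_nonneg_left (h0.nonneg f))
    (Y := Y) (Z := Z)
    (fun y hy z _ => by simp [hY hy z]; ring)
    (fun y hy => by simp [hY hy y]; ring)
    (δ := ℓ 0 * (δ / (Λ + δ + 1))) (by positivity)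
    (fun u hu => by
      have h1 := hgap u hu
      have h2 := h0.pos' u
      -- With this `θ`, adding `θ N` to `1 - θ` times the bound `N ≥ (Λ + δ) D` gives exactly `N - Λ
      -- D ≥ θ (N + D)`, which is coercivity for the energy norm.
      set θ := δ / (Λ + δ + 1) with hθ
      have hθ1 : θ ≤ 1 := by
        rw [hθ, div_le_one (by positivity)]; linarith
      have hθ2 : θ * (Λ + δ + 1) = δ := by rw [hθ]; field_simp
      have h3 : (1 - θ) * ((Λ + δ) * D 0 u u) ≤ (1 - θ) * N 0 u u :=
        mul_le_mul_of_nonneg_left h1 (by linarith)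
      have h4 : θ * (N 0 u u + D 0 u u) ≤ N 0 u u - Λ * D 0 u u := by
        have : θ * (Λ + δ + 1) * D 0 u u = δ * D 0 u u := by rw [hθ2]
        linarith
      have h5 := mul_le_mul_of_nonneg_left h4 hℓ0.le
      simp
      linarith)
    (K := Λ + 1) (by positivity)
    (fun y hy => by simp [hY hy y]; linarith) (-c) hη
  filter_upwards [hev, hpair, hℓ] with t h1 ht hℓt hyp
  have h2 := h1 (fun y hy => by
    have := hyp y hy
    linarith)
  -- Orthogonality to `X` is measured by `D 0` for every `t`, so the decomposition `f = y + z` found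
  -- at `t = 0` remains available.
  have h4 := ht.le_weakEigenvalue_of_le_form hinf (D 0) (k := k)
    (Λ := (ℓ 0 * Λ + (c - η) * |t|) / ℓ t) X hXk
    (fun f hf => by
      obtain ⟨y, hy, z, hz, rfl⟩ := hX f hf
      have h5 := h2 y hy z hz
      simp only [LinearMap.smul_apply, LinearMap.sub_apply, smul_eq_mul] at h5
      rw [div_mul_eq_mul_div, div_le_iff₀ hℓt]
      linarith)
  rw [div_le_iff₀ hℓt] at h4
  linarith

end Perturbation

/-! ### The energy space of a graph -/

/-- Square integrable functions on an edge. -/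
noncomputable abbrev EdgeL2 : Type := Lp ℝ 2 (volume.restrict (Set.Ioc (0 : ℝ) 1))

theorem EdgeL2.integrable (h : EdgeL2) : Integrable h (volume.restrict (Set.Ioc (0 : ℝ) 1)) :=
  (Lp.memLp h).integrable (by norm_num)

theorem EdgeL2.intervalIntegrable (h : EdgeL2) {a b : ℝ} (ha : a ∈ Set.Icc (0 : ℝ) 1)
    (hb : b ∈ Set.Icc (0 : ℝ) 1) : IntervalIntegrable h volume a b := by
  rw [intervalIntegrable_iff]
  refine IntegrableOn.mono_set (h.integrable : IntegrableOn h (Set.Ioc (0 : ℝ) 1) volume) ?_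
  rw [Set.uIoc]
  exact Set.Ioc_subset_Ioc (le_min ha.1 hb.1) (max_le ha.2 hb.2)

theorem EdgeL2.abs_integral_le (h : EdgeL2) {a b : ℝ} (ha : 0 ≤ a) (hab : a ≤ b) (hb : b ≤ 1) :
    |∫ x in a..b, h x| ≤ √(b - a) * ‖h‖ := by
  have hsub : Set.Ioc a b ⊆ Set.Ioc (0 : ℝ) 1 := Set.Ioc_subset_Ioc ha hb
  have hμ : (volume.restrict (Set.Ioc (0 : ℝ) 1)) (Set.Ioc a b) = ENNReal.ofReal (b - a) := by
    rw [Measure.restrict_apply measurableSet_Ioc, Set.inter_eq_left.2 hsub, Real.volume_Ioc]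
  have hfin : (volume.restrict (Set.Ioc (0 : ℝ) 1)) (Set.Ioc a b) ≠ ⊤ := by
    rw [hμ]; exact ENNReal.ofReal_ne_top
  have h1 := L2.inner_indicatorConstLp_one (𝕜 := ℝ) measurableSet_Ioc hfin h
  rw [Measure.restrict_restrict measurableSet_Ioc, Set.inter_eq_left.2 hsub,
    ← intervalIntegral.integral_of_le hab] at h1
  rw [← h1]
  refine (abs_real_inner_le_norm _ _).trans (mul_le_mul_of_nonneg_right ?_ (norm_nonneg _))
  rw [norm_indicatorConstLp (by norm_num) (by norm_num), measureReal_def, hμ,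
    ENNReal.toReal_ofReal (by linarith)]
  simp [Real.sqrt_eq_rpow]

/-- `x ↦ ∫₀ˣ h` as a continuous function. -/
noncomputable def primitive (h : EdgeL2) : C(unitInterval, ℝ) where
  toFun x := ∫ s in (0 : ℝ)..x, h s
  continuous_toFun := by
    have h1 := (intervalIntegral.continuousOn_primitive_interval (μ := volume) (f := h) (a := 0)
      (b := 1) (by
        rw [Set.uIcc_of_le zero_le_one, integrableOn_Icc_iff_integrableOn_Ioc]
        exact h.integrable))
    rw [Set.uIcc_of_le zero_le_one] at h1
    exact h1.comp_continuous continuous_subtype_val fun x => x.2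

theorem primitive_apply (h : EdgeL2) (x : unitInterval) :
    primitive h x = ∫ s in (0 : ℝ)..x, h s := rfl

theorem primitive_add (h k : EdgeL2) : primitive (h + k) = primitive h + primitive k := by
  ext x
  simp only [primitive_apply, ContinuousMap.add_apply]
  rw [← intervalIntegral.integral_add (h.intervalIntegrable (by simp) x.2)
    (k.intervalIntegrable (by simp) x.2)]
  apply intervalIntegral.integral_congr_ae_restrict
  refine ae_mono (Measure.restrict_mono ?_ le_rfl) (Lp.coeFn_add h k)
  rw [Set.uIoc_of_le x.2.1]
  exact Set.Ioc_subset_Ioc le_rfl x.2.2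

theorem primitive_smul (c : ℝ) (h : EdgeL2) : primitive (c • h) = c • primitive h := by
  ext x
  simp only [primitive_apply, ContinuousMap.smul_apply]
  rw [← intervalIntegral.integral_smul]
  apply intervalIntegral.integral_congr_ae_restrict
  refine ae_mono (Measure.restrict_mono ?_ le_rfl) (Lp.coeFn_smul c h)
  rw [Set.uIoc_of_le x.2.1]
  exact Set.Ioc_subset_Ioc le_rfl x.2.2

theorem abs_primitive_sub_le (h : EdgeL2) (x y : unitInterval) :
    |primitive h x - primitive h y| ≤ √|(x : ℝ) - y| * ‖h‖ := by
  wlog hxy : (y : ℝ) ≤ x generalizing x y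
  · rw [abs_sub_comm, abs_sub_comm (x : ℝ)]
    exact this y x (not_le.1 hxy).le
  rw [primitive_apply, primitive_apply, intervalIntegral.integral_interval_sub_left
    (h.intervalIntegrable (by simp) x.2) (h.intervalIntegrable (by simp) y.2),
    abs_of_nonneg (sub_nonneg.2 hxy)]
  exact h.abs_integral_le y.2.1 hxy x.2.2

theorem primitive_zero_apply (h : EdgeL2) : primitive h 0 = 0 := by
  simp [primitive_apply]

theorem norm_primitive_le (h : EdgeL2) : ‖primitive h‖ ≤ ‖h‖ := by
  rw [ContinuousMap.norm_le _ (norm_nonneg _)]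
  intro x
  have h1 := abs_primitive_sub_le h x 0
  rw [primitive_zero_apply, sub_zero] at h1
  rw [Real.norm_eq_abs]
  refine h1.trans (mul_le_of_le_one_left (norm_nonneg _) ?_)
  rw [Real.sqrt_le_one]
  simp only [Set.Icc.coe_zero, sub_zero]
  rw [abs_of_nonneg x.2.1]
  exact x.2.2

theorem ae_hasDerivAt_primitive (h : EdgeL2) :
    ∀ᵐ x ∂(volume.restrict (Set.Ioc (0 : ℝ) 1)),
      HasDerivAt (fun y => ∫ s in (0 : ℝ)..y, h s) (h x) x := by
  have h1 := (h.intervalIntegrable (a := 0) (b := 1) (by simp) (by simp)).ae_hasDerivAt_integral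
  rw [ae_restrict_iff' measurableSet_Ioc]
  filter_upwards [h1] with x hx hx'
  refine hx ?_ 0 (by simp)
  rw [Set.uIcc_of_le zero_le_one]
  exact Set.Ioc_subset_Icc_self hx'

theorem ae_deriv_eq (h : EdgeL2) :
    ∀ᵐ x ∂(volume.restrict (Set.Ioc (0 : ℝ) 1)),
      deriv (fun y => ∫ s in (0 : ℝ)..y, h s) x = h x := by
  filter_upwards [ae_hasDerivAt_primitive h] with x hx using hx.deriv

/-- By Lebesgue differentiation `h` is almost everywhere the derivative of its primitive. -/
theorem primitive_eq_zero {h : EdgeL2} (h0 : primitive h = 0) : h = 0 := by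
  rw [Lp.eq_zero_iff_ae_eq_zero]
  have h1 := ae_hasDerivAt_primitive h
  rw [EventuallyEq, ae_restrict_iff' measurableSet_Ioc] at *
  have hne : ∀ᵐ x : ℝ, x ≠ 1 := by simp [ae_iff, measure_singleton]
  filter_upwards [h1, hne] with x hx hx1 hx'
  have hlt : x < 1 := lt_of_le_of_ne hx'.2 hx1
  have h2 : (fun y => ∫ s in (0 : ℝ)..y, h s) =ᶠ[𝓝 x] fun _ => 0 := by
    filter_upwards [Ioo_mem_nhds hx'.1 hlt] with y hy
    exact DFunLike.congr_fun h0 (⟨y, hy.1.le, hy.2.le⟩ : unitInterval)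
  have h3 := (hx hx').congr_of_eventuallyEq h2.symm
  exact h3.unique (hasDerivAt_const x (0 : ℝ))

/-- The integral of a continuous function over an edge, in the coordinate `x ∈ [0, 1]`. -/
noncomputable def edgeIntegral : C(unitInterval, ℝ) →ₗ[ℝ] ℝ where
  toFun φ := ∫ x in (0 : ℝ)..1, Set.IccExtend zero_le_one φ x
  map_add' φ ψ := by
    rw [← intervalIntegral.integral_add
      ((φ.continuous.Icc_extend' (h := zero_le_one)).intervalIntegrable _ _)
      ((ψ.continuous.Icc_extend' (h := zero_le_one)).intervalIntegrable _ _)]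
    rfl
  map_smul' c φ := by
    rw [RingHom.id_apply, ← intervalIntegral.integral_smul]
    rfl

theorem edgeIntegral_apply (φ : C(unitInterval, ℝ)) :
    edgeIntegral φ = ∫ x in (0 : ℝ)..1, Set.IccExtend zero_le_one φ x := rfl

theorem edgeIntegral_mono {φ ψ : C(unitInterval, ℝ)} (h : ∀ x, φ x ≤ ψ x) :
    edgeIntegral φ ≤ edgeIntegral ψ :=
  intervalIntegral.integral_mono zero_le_one
    ((φ.continuous.Icc_extend' (h := zero_le_one)).intervalIntegrable _ _)
    ((ψ.continuous.Icc_extend' (h := zero_le_one)).intervalIntegrable _ _) fun _ => h _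

theorem edgeIntegral_const (c : ℝ) : edgeIntegral (ContinuousMap.const _ c) = c := by
  simp [edgeIntegral_apply, Set.IccExtend]

theorem edgeIntegral_nonneg {φ : C(unitInterval, ℝ)} (h : ∀ x, 0 ≤ φ x) : 0 ≤ edgeIntegral φ := by
  have := edgeIntegral_mono (φ := 0) h
  rwa [map_zero] at this

theorem abs_edgeIntegral_le (φ : C(unitInterval, ℝ)) : |edgeIntegral φ| ≤ ‖φ‖ := by
  rw [abs_le]
  constructor
  · have := edgeIntegral_mono (φ := ContinuousMap.const _ (-‖φ‖)) (ψ := φ)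
      fun x => (abs_le.1 (φ.norm_coe_le_norm x)).1
    rwa [edgeIntegral_const] at this
  · have := edgeIntegral_mono (φ := φ) (ψ := ContinuousMap.const _ ‖φ‖)
      fun x => (abs_le.1 (φ.norm_coe_le_norm x)).2
    rwa [edgeIntegral_const] at this

theorem edgeIntegral_pos {φ : C(unitInterval, ℝ)} (h : ∀ x, 0 ≤ φ x) {x : unitInterval}
    (hx : 0 < φ x) : 0 < edgeIntegral φ := by
  refine intervalIntegral.integral_pos zero_lt_one
    (φ.continuous.Icc_extend' (h := zero_le_one)).continuousOn (fun y _ => h _) ⟨x, x.2, ?_⟩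
  rwa [Set.IccExtend_val]

section EnergySpace

variable {V E : Type*}

/-- The value on the edge `e` of the function with given initial values and derivatives. -/
noncomputable def edgeValue (e : E) : ((E → ℝ) × (E → EdgeL2)) →ₗ[ℝ] C(unitInterval, ℝ) where
  toFun p := ContinuousMap.const _ (p.1 e) + primitive (p.2 e)
  map_add' p q := by
    ext x
    simp only [Prod.fst_add, Prod.snd_add, Pi.add_apply, primitive_add, ContinuousMap.add_apply,
      ContinuousMap.const_apply]
    ring
  map_smul' c p := by
    ext x
    simp only [Prod.smul_fst, Prod.smul_snd, Pi.smul_apply, primitive_smul,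
      ContinuousMap.add_apply, ContinuousMap.const_apply, ContinuousMap.smul_apply, smul_eq_mul,
      RingHom.id_apply]
    ring

theorem edgeValue_apply (e : E) (p : (E → ℝ) × (E → EdgeL2)) (x : unitInterval) :
    edgeValue e p x = p.1 e + primitive (p.2 e) x := rfl

theorem edgeValue_zero_apply (e : E) (p : (E → ℝ) × (E → EdgeL2)) :
    edgeValue e p 0 = p.1 e := by
  rw [edgeValue_apply, primitive_zero_apply, add_zero]

variable [Fintype E]

theorem norm_edgeValue_le (e : E) (p : (E → ℝ) × (E → EdgeL2)) : ‖edgeValue e p‖ ≤ 2 * ‖p‖ := by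
  have h1 : ‖p.1 e‖ ≤ ‖p‖ := (norm_le_pi_norm p.1 e).trans (norm_fst_le p)
  have h2 : ‖p.2 e‖ ≤ ‖p‖ := (norm_le_pi_norm p.2 e).trans (norm_snd_le p)
  rw [ContinuousMap.norm_le _ (by positivity)]
  intro x
  rw [edgeValue_apply]
  have h3 := (primitive (p.2 e)).norm_coe_le_norm x
  linarith [norm_add_le (p.1 e) (primitive (p.2 e) x), norm_primitive_le (p.2 e)]

/-- The functions on the graph with square integrable derivative on each edge that are continuous
at the vertices. -/
def energySpace (G : MultiGraph V E) : Submodule ℝ ((E → ℝ) × (E → EdgeL2)) where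
  carrier := {p | ∃ a : V → ℝ, ∀ e, edgeValue e p 0 = a (G.src e) ∧ edgeValue e p 1 = a (G.tgt e)}
  add_mem' := by
    rintro p q ⟨a, ha⟩ ⟨b, hb⟩
    refine ⟨a + b, fun e => ?_⟩
    simp [ha e, hb e]
  zero_mem' := ⟨0, fun e => by simp⟩
  smul_mem' := by
    rintro c p ⟨a, ha⟩
    refine ⟨c • a, fun e => ?_⟩
    simp [ha e]

variable {G : MultiGraph V E}

/-- End values depend continuously on the initial values and derivatives, and continuity at the
vertices asks that they lie in a subspace of a finite-dimensional space. -/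
theorem isClosed_energySpace : IsClosed (energySpace G : Set ((E → ℝ) × (E → EdgeL2))) := by
  let L : (V → ℝ) →ₗ[ℝ] (E → ℝ × ℝ) :=
    { toFun := fun a e => (a (G.src e), a (G.tgt e))
      map_add' := fun a b => rfl
      map_smul' := fun c a => rfl }
  have h1 : IsClosed ((LinearMap.range L : Submodule ℝ (E → ℝ × ℝ)) : Set (E → ℝ × ℝ)) :=
    Submodule.closed_of_finiteDimensional _
  have hc : ∀ e : E, Continuous (edgeValue e) := fun e =>
    ((edgeValue e).mkContinuous 2 (norm_edgeValue_le e)).continuous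
  have h2 : Continuous fun p : (E → ℝ) × (E → EdgeL2) =>
      fun e => ((edgeValue e p 0, edgeValue e p 1) : ℝ × ℝ) := by
    refine continuous_pi fun e => Continuous.prodMk ?_ ?_
    · exact (continuous_eval_const (0 : unitInterval)).comp (hc e)
    · exact (continuous_eval_const (1 : unitInterval)).comp (hc e)
  convert h1.preimage h2 using 1
  ext p
  constructor
  · rintro ⟨a, ha⟩
    exact ⟨a, funext fun e => Prod.ext (ha e).1.symm (ha e).2.symm⟩
  · rintro ⟨a, ha⟩
    exact ⟨a, fun e => ⟨(congrArg Prod.fst (congrFun ha e)).symm,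
      (congrArg Prod.snd (congrFun ha e)).symm⟩⟩

/-- The restriction of an element of the energy space to an edge. -/
noncomputable def edgeVal (G : MultiGraph V E) (e : E) : energySpace G →ₗ[ℝ] C(unitInterval, ℝ) :=
  (edgeValue e).comp (energySpace G).subtype

/-- The derivative of an element of the energy space on an edge. -/
def edgeDeriv (G : MultiGraph V E) (e : E) : energySpace G →ₗ[ℝ] EdgeL2 where
  toFun p := p.1.2 e
  map_add' _ _ := rfl
  map_smul' _ _ := rfl

theorem edgeVal_apply (e : E) (p : energySpace G) (x : unitInterval) :
    edgeVal G e p x = edgeVal G e p 0 + primitive (edgeDeriv G e p) x := by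
  change edgeValue e p.1 x = edgeValue e p.1 0 + _
  rw [edgeValue_zero_apply, edgeValue_apply]
  rfl

theorem exists_vertexValue (p : energySpace G) :
    ∃ a : V → ℝ, ∀ e, edgeVal G e p 0 = a (G.src e) ∧ edgeVal G e p 1 = a (G.tgt e) := p.2

theorem energySpace_ext {p q : energySpace G} (h : ∀ e x, edgeVal G e p x = edgeVal G e q x) :
    p = q := by
  rw [← sub_eq_zero]
  have h0 : ∀ e, edgeVal G e (p - q) = 0 := fun e => by
    ext x
    simp [h e x]
  refine Subtype.ext (Prod.ext (funext fun e => ?_) (funext fun e => ?_))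
  · have h1 : edgeValue e (p - q : energySpace G).1 0 = 0 := DFunLike.congr_fun (h0 e) 0
    rwa [edgeValue_zero_apply] at h1
  · refine primitive_eq_zero (h := (p - q : energySpace G).1.2 e) ?_
    ext x
    have h1 := edgeVal_apply e (p - q) x
    rw [h0 e] at h1
    have h2 : primitive (edgeDeriv G e (p - q)) x = 0 := by simpa [-map_sub] using h1.symm
    exact h2

/-- The form `∑ c_e ∫ f' k' + ∑ ∫ w_e f k`, in the coordinate `x` on each edge. -/
noncomputable def energyForm (G : MultiGraph V E) :
    ((E → ℝ) × (E → C(unitInterval, ℝ))) →ₗ[ℝ] LinearMap.BilinForm ℝ (energySpace G) where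
  toFun q := LinearMap.mk₂ ℝ
    (fun f k => ∑ e, (q.1 e * inner ℝ (edgeDeriv G e f) (edgeDeriv G e k) +
      edgeIntegral (q.2 e * edgeVal G e f * edgeVal G e k)))
    (fun f f' k => by
      simp only [map_add, inner_add_left, mul_add, add_mul, ← Finset.sum_add_distrib]
      exact Finset.sum_congr rfl fun e _ => by ring)
    (fun c f k => by
      simp only [map_smul, inner_smul_left, smul_eq_mul, Finset.mul_sum, mul_smul_comm,
        smul_mul_assoc]
      exact Finset.sum_congr rfl fun e _ => by simp; ring)
    (fun f k k' => by
      simp only [map_add, inner_add_right, mul_add, ← Finset.sum_add_distrib]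
      exact Finset.sum_congr rfl fun e _ => by ring)
    (fun c f k => by
      simp only [map_smul, inner_smul_right, smul_eq_mul, Finset.mul_sum, mul_smul_comm]
      exact Finset.sum_congr rfl fun e _ => by ring)
  map_add' q q' := by
    ext f k
    simp only [LinearMap.mk₂_apply, LinearMap.add_apply, Prod.fst_add, Prod.snd_add, Pi.add_apply,
      add_mul, map_add, ← Finset.sum_add_distrib]
    exact Finset.sum_congr rfl fun e _ => by ring
  map_smul' c q := by
    ext f k
    simp only [LinearMap.mk₂_apply, LinearMap.smul_apply, Prod.smul_fst, Prod.smul_snd,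
      Pi.smul_apply, smul_mul_assoc, map_smul, smul_eq_mul, Finset.mul_sum, RingHom.id_apply]
    exact Finset.sum_congr rfl fun e _ => by ring

theorem energyForm_apply (q : (E → ℝ) × (E → C(unitInterval, ℝ))) (f k : energySpace G) :
    energyForm G q f k = ∑ e, (q.1 e * inner ℝ (edgeDeriv G e f) (edgeDeriv G e k) +
      edgeIntegral (q.2 e * edgeVal G e f * edgeVal G e k)) := rfl

theorem energyForm_symm (q : (E → ℝ) × (E → C(unitInterval, ℝ))) (f k : energySpace G) :
    energyForm G q f k = energyForm G q k f := by
  simp only [energyForm_apply]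
  refine Finset.sum_congr rfl fun e _ => ?_
  rw [real_inner_comm, mul_right_comm]

theorem energyForm_self_mono {q q' : (E → ℝ) × (E → C(unitInterval, ℝ))}
    (h1 : ∀ e, q.1 e ≤ q'.1 e) (h2 : ∀ e x, q.2 e x ≤ q'.2 e x) (f : energySpace G) :
    energyForm G q f f ≤ energyForm G q' f f := by
  simp only [energyForm_apply]
  refine Finset.sum_le_sum fun e _ => add_le_add ?_ (edgeIntegral_mono fun x => ?_)
  · exact mul_le_mul_of_nonneg_right (h1 e) real_inner_self_nonneg
  · simp only [ContinuousMap.mul_apply, mul_assoc]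
    exact mul_le_mul_of_nonneg_right (h2 e x) (mul_self_nonneg _)

/-- The standard form `∑ ∫ f' ^ 2 + f ^ 2`. -/
noncomputable abbrev stdForm (G : MultiGraph V E) : LinearMap.BilinForm ℝ (energySpace G) :=
  energyForm G (1, 1)

theorem stdForm_apply_self (f : energySpace G) : stdForm G f f =
    ∑ e, (‖edgeDeriv G e f‖ ^ 2 + edgeIntegral (edgeVal G e f * edgeVal G e f)) := by
  simp only [stdForm, energyForm_apply, Pi.one_apply, one_mul, real_inner_self_eq_norm_sq]

theorem stdForm_nonneg (f : energySpace G) : 0 ≤ stdForm G f f := by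
  rw [stdForm_apply_self]
  exact Finset.sum_nonneg fun e _ => add_nonneg (sq_nonneg _)
    (edgeIntegral_nonneg fun x => mul_self_nonneg _)

theorem abs_energyForm_le (q : (E → ℝ) × (E → C(unitInterval, ℝ))) (f : energySpace G) :
    |energyForm G q f f| ≤ ‖q‖ * stdForm G f f := by
  have h0 : ∀ c : ℝ, c * stdForm G f f = energyForm G (c • (1, 1)) f f := fun c => by
    rw [map_smul]
    rfl
  have h1 : ∀ e, |q.1 e| ≤ ‖q‖ := fun e => (norm_le_pi_norm q.1 e).trans (norm_fst_le q)
  have h2 : ∀ e x, |q.2 e x| ≤ ‖q‖ := fun e x =>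
    ((q.2 e).norm_coe_le_norm x).trans ((norm_le_pi_norm q.2 e).trans (norm_snd_le q))
  rw [abs_le, ← neg_mul, h0, h0]
  constructor
  · refine energyForm_self_mono (fun e => ?_) (fun e x => ?_) f
    · simpa using (abs_le.1 (h1 e)).1
    · simpa using (abs_le.1 (h2 e x)).1
  · refine energyForm_self_mono (fun e => ?_) (fun e x => ?_) f
    · simpa using (abs_le.1 (h1 e)).2
    · simpa using (abs_le.1 (h2 e x)).2

/-- One-dimensional Sobolev inequality: the oscillation on an edge is at most the norm of the
derivative; averaging over the comparison point `y` does the rest. -/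
theorem edgeVal_sq_le (f : energySpace G) (e : E) (x : unitInterval) :
    (edgeVal G e f x) ^ 2 ≤ 2 * stdForm G f f := by
  have hosc : ∀ y, (edgeVal G e f x) ^ 2 ≤ 2 * ‖edgeDeriv G e f‖ ^ 2 +
      2 * (edgeVal G e f y * edgeVal G e f y) := by
    intro y
    have h1 := abs_primitive_sub_le (edgeDeriv G e f) x y
    have h2 : √|(x : ℝ) - y| ≤ 1 := by
      rw [Real.sqrt_le_one]
      exact abs_le.2 ⟨by linarith [x.2.1, y.2.2], by linarith [x.2.2, y.2.1]⟩
    have h3 := mul_le_of_le_one_left (norm_nonneg (edgeDeriv G e f)) h2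
    have h4 : (edgeVal G e f x - edgeVal G e f y) ^ 2 ≤ ‖edgeDeriv G e f‖ ^ 2 := by
      rw [edgeVal_apply e f x, edgeVal_apply e f y, add_sub_add_left_eq_sub, ← sq_abs]
      exact pow_le_pow_left₀ (abs_nonneg _) (h1.trans h3) 2
    nlinarith [sq_nonneg (edgeVal G e f x - 2 * edgeVal G e f y)]
  have h1 := edgeIntegral_mono (φ := ContinuousMap.const _ ((edgeVal G e f x) ^ 2))
    (ψ := ContinuousMap.const _ (2 * ‖edgeDeriv G e f‖ ^ 2) +
      (2 : ℝ) • (edgeVal G e f * edgeVal G e f)) fun y => by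
        simpa using hosc y
  rw [map_add, map_smul, edgeIntegral_const, edgeIntegral_const, smul_eq_mul] at h1
  have h2 := Finset.single_le_sum (f := fun e => ‖edgeDeriv G e f‖ ^ 2 +
    edgeIntegral (edgeVal G e f * edgeVal G e f)) (fun e _ => add_nonneg (sq_nonneg _)
    (edgeIntegral_nonneg fun x => mul_self_nonneg _)) (Finset.mem_univ e)
  rw [← stdForm_apply_self] at h2
  linarith

theorem norm_sq_le_stdForm (f : energySpace G) : ‖f‖ ^ 2 ≤ 2 * stdForm G f f := by
  have h0 := stdForm_nonneg f
  have h1 : ‖f‖ ≤ √(2 * stdForm G f f) := by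
    change ‖f.1‖ ≤ _
    rw [Prod.norm_def]
    refine max_le ?_ ?_
    · rw [pi_norm_le_iff_of_nonneg (Real.sqrt_nonneg _)]
      intro e
      rw [← edgeValue_zero_apply]
      exact Real.abs_le_sqrt (edgeVal_sq_le f e 0)
    · rw [pi_norm_le_iff_of_nonneg (Real.sqrt_nonneg _)]
      intro e
      apply Real.le_sqrt_of_sq_le
      have h2 := Finset.single_le_sum (f := fun e => ‖edgeDeriv G e f‖ ^ 2 +
        edgeIntegral (edgeVal G e f * edgeVal G e f)) (fun e _ => add_nonneg (sq_nonneg _)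
        (edgeIntegral_nonneg fun x => mul_self_nonneg _)) (Finset.mem_univ e)
      rw [← stdForm_apply_self] at h2
      have h3 : 0 ≤ edgeIntegral (edgeVal G e f * edgeVal G e f) :=
        edgeIntegral_nonneg fun x => mul_self_nonneg _
      change ‖edgeDeriv G e f‖ ^ 2 ≤ _
      linarith
  calc ‖f‖ ^ 2 ≤ √(2 * stdForm G f f) ^ 2 := pow_le_pow_left₀ (norm_nonneg _) h1 2
    _ = _ := Real.sq_sqrt (by positivity)

theorem stdForm_le_norm_sq (f : energySpace G) :
    stdForm G f f ≤ Fintype.card E * (5 * ‖f‖ ^ 2) := by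
  rw [stdForm_apply_self, ← nsmul_eq_mul]
  refine Finset.sum_le_card_nsmul _ _ _ fun e _ => ?_
  have h1 : ‖edgeDeriv G e f‖ ≤ ‖f‖ := (norm_le_pi_norm f.1.2 e).trans (norm_snd_le f.1)
  have h2 : ‖edgeVal G e f‖ ≤ 2 * ‖f‖ := norm_edgeValue_le e f.1
  have h3 := abs_edgeIntegral_le (edgeVal G e f * edgeVal G e f)
  have h4 := norm_mul_le (edgeVal G e f) (edgeVal G e f)
  have h5 := pow_le_pow_left₀ (norm_nonneg _) h1 2
  have h6 := pow_le_pow_left₀ (norm_nonneg _) h2 2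
  have h7 := le_abs_self (edgeIntegral (edgeVal G e f * edgeVal G e f))
  nlinarith

/-- Bounded sequences of the energy space have uniformly Cauchy subsequences. -/
theorem exists_cauchySeq_edgeVal (u : ℕ → energySpace G) (R : ℝ) (hu : ∀ n, ‖u n‖ ≤ R) :
    ∃ φ : ℕ → ℕ, StrictMono φ ∧ CauchySeq fun n => fun e => edgeVal G e (u (φ n)) := by
  let ι : C(unitInterval, ℝ) ≃ᵢ BoundedContinuousFunction unitInterval ℝ :=
    ContinuousMap.isometryEquivBoundedOfCompact _ _
  have hR : 0 ≤ R := (norm_nonneg _).trans (hu 0)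
  have hcpt : ∀ e : E, IsCompact (closure (Set.range fun n => ι (edgeVal G e (u n)))) := by
    intro e
    refine BoundedContinuousFunction.arzela_ascoli (Metric.closedBall (0 : ℝ) (2 * R))
      (isCompact_closedBall _ _) _ ?_ ?_
    · rintro _ x ⟨n, rfl⟩
      rw [mem_closedBall_zero_iff]
      refine ((edgeVal G e (u n)).norm_coe_le_norm x).trans ?_
      exact (norm_edgeValue_le e (u n).1).trans (mul_le_mul_of_nonneg_left (hu n) zero_le_two)
    · intro x₀
      rw [Metric.equicontinuousAt_iff_pair]
      intro ε hε
      -- Equicontinuity comes from the common Hölder bound `√|x - x'| * R` given by Cauchy-Schwarz.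
      have hcont : ContinuousAt (fun p : unitInterval × unitInterval =>
          √|(p.1 : ℝ) - p.2| * R) (x₀, x₀) := by fun_prop
      have hnear : ∀ᶠ p in 𝓝 (x₀, x₀), √|((p : unitInterval × unitInterval).1 : ℝ) - p.2| * R < ε :=
        hcont.eventually_lt continuousAt_const (by simpa using hε)
      rw [nhds_prod_eq] at hnear
      obtain ⟨t, ht, hU⟩ := Filter.eventually_prod_self_iff
        (r := fun a b : unitInterval => √|(a : ℝ) - b| * R < ε) |>.1 hnear
      refine ⟨t, ht, fun x hx x' hx' => ?_⟩
      rintro ⟨_, n, rfl⟩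
      have h1 := abs_primitive_sub_le (edgeDeriv G e (u n)) x x'
      have h2 : ‖edgeDeriv G e (u n)‖ ≤ R :=
        ((norm_le_pi_norm (u n).1.2 e).trans (norm_snd_le (u n).1)).trans (hu n)
      have h3 := hU x hx x' hx'
      have h4 := mul_le_mul_of_nonneg_left h2 (Real.sqrt_nonneg |(x : ℝ) - x'|)
      change dist (edgeVal G e (u n) x) (edgeVal G e (u n) x') < ε
      rw [Real.dist_eq, edgeVal_apply e (u n) x, edgeVal_apply e (u n) x', add_sub_add_left_eq_sub]
      exact (h1.trans h4).trans_lt h3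
  obtain ⟨a, -, φ, hφ, ha⟩ := (isCompact_univ_pi hcpt).tendsto_subseq
    (x := fun n e => ι (edgeVal G e (u n))) fun n e _ => subset_closure ⟨n, rfl⟩
  refine ⟨φ, hφ, ?_⟩
  have h1 : Tendsto (fun n => fun e => edgeVal G e (u (φ n))) atTop (𝓝 fun e => ι.symm (a e)) := by
    rw [tendsto_pi_nhds] at ha ⊢
    intro e
    have h2 := (ι.symm.continuous.tendsto (a e)).comp (ha e)
    simpa [Function.comp_def] using h2
  exact h1.cauchySeq

theorem exists_pos_le_of_finite {c : E → ℝ} (hc : ∀ e, 0 < c e) : ∃ κ > 0, ∀ e, κ ≤ c e := by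
  have h0 : 0 ≤ ∑ e, (c e)⁻¹ := Finset.sum_nonneg fun e _ => (inv_pos.2 (hc e)).le
  refine ⟨(1 + ∑ e, (c e)⁻¹)⁻¹, by positivity, fun e => ?_⟩
  have h1 := Finset.single_le_sum (f := fun e => (c e)⁻¹) (fun e _ => (inv_pos.2 (hc e)).le)
    (Finset.mem_univ e)
  exact inv_le_of_inv_le₀ (hc e) (by linarith)

theorem exists_pos_le_of_continuous {w : E → C(unitInterval, ℝ)} (hw : ∀ e x, 0 < w e x) :
    ∃ κ > 0, ∀ e x, κ ≤ w e x := by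
  have h1 : ∀ e, ∃ x₀, ∀ x, w e x₀ ≤ w e x := fun e => by
    obtain ⟨x₀, -, h⟩ := isCompact_univ.exists_isMinOn Set.univ_nonempty (w e).continuous.continuousOn
    exact ⟨x₀, fun x => h (Set.mem_univ x)⟩
  choose x₀ hx₀ using h1
  obtain ⟨κ, hκ, h⟩ := exists_pos_le_of_finite fun e => hw e (x₀ e)
  exact ⟨κ, hκ, fun e x => (h e).trans (hx₀ e x)⟩

/-- Positive coefficients are bounded below by compactness, so `N + D` is equivalent to the squared
norm of the energy space. Completeness then follows from closedness, and compactness from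
Arzelà-Ascoli. -/
theorem isCompactPair_energyForm {c : E → ℝ} {w : E → C(unitInterval, ℝ)} (hc : ∀ e, 0 < c e)
    (hw : ∀ e x, 0 < w e x) :
    IsCompactPair (energyForm G (c, 0)) (energyForm G (0, w)) := by
  obtain ⟨κ₁, hκ₁, hcκ⟩ := exists_pos_le_of_finite hc
  obtain ⟨κ₂, hκ₂, hwκ⟩ := exists_pos_le_of_continuous hw
  have hsum : ∀ f k, energyForm G (c, 0) f k + energyForm G (0, w) f k = energyForm G (c, w) f k := by
    intro f k
    rw [← LinearMap.add_apply, ← LinearMap.add_apply, ← map_add]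
    simp
  have hlow : ∀ f, min κ₁ κ₂ * stdForm G f f ≤ energyForm G (c, w) f f := by
    intro f
    have h0 : min κ₁ κ₂ * stdForm G f f = energyForm G (min κ₁ κ₂ • (1, 1)) f f := by
      rw [map_smul]
      rfl
    rw [h0]
    refine energyForm_self_mono (fun e => ?_) (fun e x => ?_) f
    · simpa using Or.inl (hcκ e)
    · simpa using Or.inr (hwκ e x)
  have hκ : 0 < min κ₁ κ₂ := lt_min hκ₁ hκ₂
  have hnn : ∀ f e, 0 ≤ edgeIntegral (w e * edgeVal G e f * edgeVal G e f) := fun f e =>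
    edgeIntegral_nonneg fun x => by
      rw [ContinuousMap.mul_apply, ContinuousMap.mul_apply, mul_assoc]
      exact mul_nonneg (hw e x).le (mul_self_nonneg _)
  refine ⟨energyForm_symm _, energyForm_symm _, fun f => ?_, fun f hf => ?_, fun u C hu => ?_,
    fun u hu => ?_⟩
  · simp only [energyForm_apply]
    refine Finset.sum_nonneg fun e _ => ?_
    simp only [Pi.zero_apply, zero_mul, map_zero, add_zero]
    exact mul_nonneg (hc e).le real_inner_self_nonneg
  · have hex : ∃ e x, edgeVal G e f x ≠ 0 := by
      by_contra! hall
      exact hf (energySpace_ext fun e x => by simp [hall e x])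
    obtain ⟨e, x, hx⟩ := hex
    simp only [energyForm_apply, Pi.zero_apply, zero_mul, zero_add]
    refine Finset.sum_pos' (fun e _ => hnn f e) ⟨e, Finset.mem_univ e, ?_⟩
    refine edgeIntegral_pos (x := x) (fun y => ?_) ?_
    · rw [ContinuousMap.mul_apply, ContinuousMap.mul_apply, mul_assoc]
      exact mul_nonneg (hw e y).le (mul_self_nonneg _)
    · rw [ContinuousMap.mul_apply, ContinuousMap.mul_apply, mul_assoc]
      exact mul_pos (hw e x) (mul_self_pos.2 hx)
  · have hb : ∀ n, ‖u n‖ ≤ √(2 * (C / min κ₁ κ₂)) := by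
      intro n
      apply Real.le_sqrt_of_sq_le
      refine (norm_sq_le_stdForm _).trans (mul_le_mul_of_nonneg_left ?_ zero_le_two)
      rw [le_div_iff₀ hκ, mul_comm]
      exact (hlow _).trans ((hsum _ _).symm.le.trans (hu n))
    obtain ⟨φ, hφ, hcau⟩ := exists_cauchySeq_edgeVal u _ hb
    refine ⟨φ, hφ, fun ε hε => ?_⟩
    set B : ℝ := Fintype.card E * (‖w‖ + 1) + 1 with hB
    have hBpos : 0 < B := by positivity
    obtain ⟨n₀, hn₀⟩ := Metric.cauchySeq_iff.1 hcau (√(ε / B)) (by positivity)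
    refine ⟨n₀, fun m hm n hn => ?_⟩
    have h1 := (hn₀ m hm n hn)
    rw [dist_eq_norm] at h1
    have h2 : energyForm G (0, w) (u (φ m) - u (φ n)) (u (φ m) - u (φ n)) ≤
        Fintype.card E * (‖w‖ * (ε / B)) := by
      simp only [energyForm_apply, Pi.zero_apply, zero_mul, zero_add]
      rw [← nsmul_eq_mul]
      refine Finset.sum_le_card_nsmul _ _ _ fun e _ => ?_
      refine (le_abs_self _).trans ((abs_edgeIntegral_le _).trans ?_)
      have h3 : ‖edgeVal G e (u (φ m) - u (φ n))‖ ≤ √(ε / B) := by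
        rw [map_sub]
        exact (norm_le_pi_norm (fun e => edgeVal G e (u (φ m)) - edgeVal G e (u (φ n))) e).trans h1.le
      have h4 := norm_mul_le (w e * edgeVal G e (u (φ m) - u (φ n)))
        (edgeVal G e (u (φ m) - u (φ n)))
      have h5 := norm_mul_le (w e) (edgeVal G e (u (φ m) - u (φ n)))
      have h6 : ‖edgeVal G e (u (φ m) - u (φ n))‖ * ‖edgeVal G e (u (φ m) - u (φ n))‖ ≤ ε / B := by
        refine (mul_le_mul h3 h3 (norm_nonneg _) (Real.sqrt_nonneg _)).trans ?_
        rw [Real.mul_self_sqrt (by positivity)]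
      calc _ ≤ ‖w e‖ * ‖edgeVal G e (u (φ m) - u (φ n))‖ *
            ‖edgeVal G e (u (φ m) - u (φ n))‖ :=
            h4.trans (mul_le_mul_of_nonneg_right h5 (norm_nonneg _))
        _ ≤ ‖w‖ * (ε / B) := by
          rw [mul_assoc]
          exact mul_le_mul (norm_le_pi_norm w e) h6 (by positivity) (norm_nonneg _)
    refine h2.trans_lt ?_
    have h3 : B * (ε / B) = ε := by field_simp
    have h4 : 0 < ε / B := by positivity
    have h5 : (0 : ℝ) ≤ Fintype.card E := by positivity
    nlinarith
  · have hcau : CauchySeq u := by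
      rw [Metric.cauchySeq_iff]
      intro ε hε
      obtain ⟨n₀, hn₀⟩ := hu (min κ₁ κ₂ * (ε ^ 2 / 2)) (by positivity)
      refine ⟨n₀, fun m hm n hn => ?_⟩
      have h1 := hn₀ m hm n hn
      rw [hsum] at h1
      have h2 := lt_of_mul_lt_mul_left ((hlow _).trans_lt h1) hκ.le
      have h3 := norm_sq_le_stdForm (u m - u n)
      rw [dist_eq_norm]
      exact lt_of_pow_lt_pow_left₀ 2 hε.le (by linarith)
    have : CompleteSpace (energySpace G) :=
      (isClosed_energySpace (G := G)).completeSpace_coe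
    obtain ⟨f, hf⟩ := cauchySeq_tendsto_of_complete hcau
    refine ⟨f, fun ε hε => ?_⟩
    set B : ℝ := ‖(c, w)‖ * (Fintype.card E * 5) + 1 with hB
    have hBpos : 0 < B := by positivity
    obtain ⟨n₀, hn₀⟩ := Metric.tendsto_atTop.1 hf (√(ε / B)) (by positivity)
    refine ⟨n₀, fun n hn => ?_⟩
    have h1 := hn₀ n hn
    rw [dist_eq_norm] at h1
    rw [hsum]
    have h2 : ‖u n - f‖ ^ 2 < ε / B := by
      rw [← Real.lt_sqrt (norm_nonneg _)]
      exact h1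
    have h3 := (le_abs_self _).trans (abs_energyForm_le (c, w) (u n - f))
    have h4 := mul_le_mul_of_nonneg_left (stdForm_le_norm_sq (u n - f)) (norm_nonneg (c, w))
    have h5 : B * ‖u n - f‖ ^ 2 < ε := by
      rw [lt_div_iff₀ hBpos] at h2
      linarith
    have h6 := sq_nonneg ‖u n - f‖
    rw [hB] at h5
    nlinarith

end EnergySpace

/-! ### Calculus on an edge -/

theorem continuous_extend (φ : C(unitInterval, ℝ)) :
    Continuous (Set.IccExtend (zero_le_one (α := ℝ)) φ) :=
  φ.continuous.Icc_extend'

/-- A continuous function on an edge as a square integrable one. -/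
noncomputable def toEdgeL2 (φ : C(unitInterval, ℝ)) : EdgeL2 :=
  MemLp.toLp (Set.IccExtend (zero_le_one (α := ℝ)) φ)
    (MemLp.of_bound (continuous_extend φ).aestronglyMeasurable ‖φ‖
      (Eventually.of_forall fun _ => φ.norm_coe_le_norm _))

theorem coeFn_toEdgeL2 (φ : C(unitInterval, ℝ)) :
    toEdgeL2 φ =ᵐ[volume.restrict (Set.Ioc (0 : ℝ) 1)] Set.IccExtend zero_le_one φ :=
  MemLp.coeFn_toLp _

theorem inner_toEdgeL2 (φ : C(unitInterval, ℝ)) (k : EdgeL2) :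
    inner ℝ (toEdgeL2 φ) k = ∫ x in (0 : ℝ)..1, Set.IccExtend zero_le_one φ x * k x := by
  rw [L2.inner_def, intervalIntegral.integral_of_le zero_le_one]
  refine integral_congr_ae ?_
  filter_upwards [coeFn_toEdgeL2 φ] with x hx
  rw [hx]
  simp [mul_comm]

theorem inner_toEdgeL2_toEdgeL2 (φ ψ : C(unitInterval, ℝ)) :
    inner ℝ (toEdgeL2 φ) (toEdgeL2 ψ) = edgeIntegral (φ * ψ) := by
  rw [inner_toEdgeL2, edgeIntegral_apply, intervalIntegral.integral_of_le zero_le_one,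
    intervalIntegral.integral_of_le zero_le_one]
  refine integral_congr_ae ?_
  filter_upwards [coeFn_toEdgeL2 ψ] with x hx
  rw [hx]
  rfl

theorem primitive_toEdgeL2 (φ : C(unitInterval, ℝ)) (x : unitInterval) :
    primitive (toEdgeL2 φ) x = ∫ s in (0 : ℝ)..x, Set.IccExtend zero_le_one φ s := by
  rw [primitive_apply]
  apply intervalIntegral.integral_congr_ae_restrict
  refine ae_mono (Measure.restrict_mono ?_ le_rfl) (coeFn_toEdgeL2 φ)
  rw [Set.uIoc_of_le x.2.1]
  exact Set.Ioc_subset_Ioc le_rfl x.2.2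

/-- `u'` is the derivative of `u` on the edge. -/
def IsEdgeDeriv (u u' : unitInterval → ℝ) : Prop :=
  ∀ x : unitInterval, HasDerivWithinAt (Set.IccExtend (zero_le_one (α := ℝ)) u) (u' x)
    (Set.Icc 0 1) x

theorem isEdgeDeriv_of_eq_add_primitive {v : unitInterval → ℝ} {u : C(unitInterval, ℝ)} {c : ℝ}
    (h : ∀ x, v x = c + primitive (toEdgeL2 u) x) : IsEdgeDeriv v u := by
  intro x
  have h1 : HasDerivAt (fun y => c + ∫ s in (0 : ℝ)..y, Set.IccExtend zero_le_one u s)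
      (Set.IccExtend zero_le_one u x) x := by
    refine HasDerivAt.const_add c ?_
    exact intervalIntegral.integral_hasDerivAt_right
      ((continuous_extend u).intervalIntegrable _ _)
      ((continuous_extend u).stronglyMeasurableAtFilter _ _) (continuous_extend u).continuousAt
  rw [Set.IccExtend_val] at h1
  have hv : ∀ y ∈ Set.Icc (0 : ℝ) 1, Set.IccExtend (zero_le_one (α := ℝ)) v y =
      c + ∫ s in (0 : ℝ)..y, Set.IccExtend zero_le_one u s := by
    intro y hy
    rw [Set.IccExtend_of_mem _ _ hy, h, primitive_toEdgeL2]
  exact h1.hasDerivWithinAt.congr hv (hv x x.2)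

theorem IsEdgeDeriv.eq_add_primitive {v : unitInterval → ℝ} {u : C(unitInterval, ℝ)}
    (h : IsEdgeDeriv v u) (x : unitInterval) : v x = v 0 + primitive (toEdgeL2 u) x := by
  have h1 := intervalIntegral.integral_eq_sub_of_hasDerivAt_of_le (a := 0) (b := (x : ℝ)) x.2.1
    (f := Set.IccExtend (zero_le_one (α := ℝ)) v) (f' := Set.IccExtend zero_le_one u)
    (fun y hy => ((h ⟨y, hy.1, hy.2.trans x.2.2⟩).continuousWithinAt.mono
      (Set.Icc_subset_Icc le_rfl x.2.2)))
    (fun y hy => by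
      have hy' : y ∈ Set.Icc (0 : ℝ) 1 := ⟨hy.1.le, hy.2.le.trans x.2.2⟩
      rw [Set.IccExtend_of_mem _ _ hy']
      exact (h ⟨y, hy'⟩).hasDerivAt (Icc_mem_nhds hy.1 (hy.2.trans_le x.2.2)))
    ((continuous_extend u).intervalIntegrable _ _)
  rw [primitive_toEdgeL2, h1, Set.IccExtend_val]
  have h0 : Set.IccExtend (zero_le_one (α := ℝ)) v 0 = v 0 :=
    Set.IccExtend_of_mem _ _ (by simp)
  rw [h0]
  ring

theorem uniqueDiffOn_unit : UniqueDiffOn ℝ (Set.Icc (0 : ℝ) 1) := uniqueDiffOn_Icc zero_lt_one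

theorem IsEdgeDeriv.dx_eq {E : Type*} {f : EdgeFun E ℝ} {e : E} {u : unitInterval → ℝ}
    (h : IsEdgeDeriv (f e) u) : f.dx e = u :=
  funext fun x => (h x).derivWithin (uniqueDiffOn_unit _ x.2)

theorem isEdgeDeriv_dx {E : Type*} {f : EdgeFun E ℝ} {e : E}
    (h : DifferentiableOn ℝ (f.onEdge e) (Set.Icc 0 1)) : IsEdgeDeriv (f e) (f.dx e) :=
  fun x => (h x x.2).hasDerivWithinAt

theorem continuous_of_continuousOn_extend {u : unitInterval → ℝ}
    (h : ContinuousOn (Set.IccExtend (zero_le_one (α := ℝ)) u) (Set.Icc 0 1)) : Continuous u := by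
  have h1 := h.comp_continuous continuous_subtype_val fun x : unitInterval => x.2
  exact h1.congr fun x => Set.IccExtend_val _ _ x

theorem onEdge_dx_eqOn {E : Type*} (f : EdgeFun E ℝ) (e : E) :
    Set.EqOn (f.dx.onEdge e) (derivWithin (f.onEdge e) (Set.Icc 0 1)) (Set.Icc 0 1) := by
  intro x hx
  exact Set.IccExtend_of_mem _ _ hx

theorem contDiffOn_onEdge_dx {E : Type*} {f : EdgeFun E ℝ} {e : E} {n : ℕ}
    (h : ContDiffOn ℝ (n + 1 : ℕ) (f.onEdge e) (Set.Icc 0 1)) :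
    ContDiffOn ℝ n (f.dx.onEdge e) (Set.Icc 0 1) := by
  have h1 : ContDiffOn ℝ n (derivWithin (f.onEdge e) (Set.Icc 0 1)) (Set.Icc 0 1) :=
    h.derivWithin uniqueDiffOn_unit (by norm_cast)
  exact h1.congr (onEdge_dx_eqOn f e)

theorem contDiffOn_two_of_isEdgeDeriv {E : Type*} {f : EdgeFun E ℝ} {e : E}
    {u u' : C(unitInterval, ℝ)} (h : IsEdgeDeriv (f e) u) (h' : IsEdgeDeriv u u') :
    ContDiffOn ℝ 2 (f.onEdge e) (Set.Icc 0 1) := by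
  have key : ∀ {v : unitInterval → ℝ} {u : unitInterval → ℝ} {n : ℕ}, IsEdgeDeriv v u →
      ContDiffOn ℝ n (Set.IccExtend (zero_le_one (α := ℝ)) u) (Set.Icc 0 1) →
      ContDiffOn ℝ (n + 1 : ℕ) (Set.IccExtend (zero_le_one (α := ℝ)) v) (Set.Icc 0 1) := by
    intro v u n hvu hu
    push_cast
    rw [contDiffOn_succ_iff_derivWithin uniqueDiffOn_unit]
    refine ⟨fun x hx => (hvu ⟨x, hx⟩).differentiableWithinAt, by simp, hu.congr fun x hx => ?_⟩
    rw [(hvu ⟨x, hx⟩).derivWithin (uniqueDiffOn_unit _ hx), Set.IccExtend_of_mem _ _ hx]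
  have h0 : ContDiffOn ℝ (0 : ℕ) (Set.IccExtend (zero_le_one (α := ℝ)) u') (Set.Icc 0 1) := by
    rw [Nat.cast_zero, contDiffOn_zero]
    exact (continuous_extend u').continuousOn
  exact key h (key h' h0)

/-- Integration by parts against a function with square integrable derivative. -/
theorem inner_toEdgeL2_eq {u u' : C(unitInterval, ℝ)} (hu : IsEdgeDeriv u u') (c : ℝ)
    {k : EdgeL2} {φ : C(unitInterval, ℝ)} (hφ : ∀ x, φ x = c + primitive k x) :
    inner ℝ (toEdgeL2 u) k = u 1 * φ 1 - u 0 * φ 0 - edgeIntegral (u' * φ) := by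
  set U : ℝ → ℝ := fun x => ∫ s in (0 : ℝ)..x, toEdgeL2 u' s with hU
  set P : ℝ → ℝ := fun x => ∫ s in (0 : ℝ)..x, k s with hP
  have hint : ∀ h : EdgeL2, IntervalIntegrable h volume 0 1 := fun h =>
    h.intervalIntegrable (by simp) (by simp)
  -- Integration by parts is applied to the primitives `U` and `P`, which are absolutely continuous
  -- on all of `[0, 1]`; the constants `u 0` and `c` are restored afterwards.
  have hUac : AbsolutelyContinuousOnInterval U 0 1 :=
    (hint _).absolutelyContinuousOnInterval_intervalIntegral (by simp)
  have hPac : AbsolutelyContinuousOnInterval P 0 1 :=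
    (hint _).absolutelyContinuousOnInterval_intervalIntegral (by simp)
  have h1 := hUac.integral_mul_deriv_eq_deriv_mul hPac
  have hUv : ∀ x : unitInterval, u x = u 0 + U x := fun x => hu.eq_add_primitive x
  have hPv : ∀ x : unitInterval, φ x = c + P x := hφ
  have hU0 : U 0 = 0 := by simp [hU]
  have hP0 : P 0 = 0 := by simp [hP]
  have h2 : ∫ x in (0 : ℝ)..1, U x * deriv P x = inner ℝ (toEdgeL2 u) k - u 0 * P 1 := by
    rw [inner_toEdgeL2, hP]
    simp only
    rw [← intervalIntegral.integral_const_mul, ← intervalIntegral.integral_sub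
      ((hint k).continuousOn_mul (continuous_extend u).continuousOn) ((hint k).const_mul _),
      intervalIntegral.integral_of_le zero_le_one, intervalIntegral.integral_of_le zero_le_one]
    refine integral_congr_ae ?_
    filter_upwards [ae_deriv_eq k, ae_restrict_mem measurableSet_Ioc] with x hx hx'
    have h3 := hUv ⟨x, hx'.1.le, hx'.2⟩
    rw [hx, Set.IccExtend_of_mem _ _ (⟨hx'.1.le, hx'.2⟩ : x ∈ Set.Icc (0 : ℝ) 1), h3]
    ring
  have h3 : ∫ x in (0 : ℝ)..1, deriv U x * P x = edgeIntegral (u' * φ) - c * U 1 := by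
    rw [edgeIntegral_apply, hU]
    simp only
    rw [← intervalIntegral.integral_const_mul, ← intervalIntegral.integral_sub
      ((continuous_extend _).intervalIntegrable _ _) ((hint _).const_mul _),
      intervalIntegral.integral_of_le zero_le_one, intervalIntegral.integral_of_le zero_le_one]
    refine integral_congr_ae ?_
    filter_upwards [ae_deriv_eq (toEdgeL2 u'), coeFn_toEdgeL2 u',
      ae_restrict_mem measurableSet_Ioc] with x hx hx2 hx'
    have h3 := hPv ⟨x, hx'.1.le, hx'.2⟩
    rw [hx, hx2, Set.IccExtend_of_mem _ _ (⟨hx'.1.le, hx'.2⟩ : x ∈ Set.Icc (0 : ℝ) 1),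
      Set.IccExtend_of_mem _ _ (⟨hx'.1.le, hx'.2⟩ : x ∈ Set.Icc (0 : ℝ) 1),
      ContinuousMap.mul_apply, h3]
    ring
  have hu1 : u 1 = u 0 + U 1 := hUv 1
  have hφ1 : φ 1 = c + P 1 := hPv 1
  have hφ0 : φ 0 = c + P 0 := hPv 0
  rw [h2, h3, hU0, hP0] at h1
  rw [hP0] at hφ0
  rw [hu1, hφ1, hφ0]
  linarith

/-- A square integrable function orthogonal to all functions of mean zero is constant. -/
theorem eq_toEdgeL2_const {z : EdgeL2} (h : ∀ k : EdgeL2, primitive k 1 = 0 → inner ℝ z k = 0) :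
    ∃ m : ℝ, z = toEdgeL2 (ContinuousMap.const _ m) := by
  have hone : ∀ k : EdgeL2, inner ℝ (toEdgeL2 1) k = primitive k 1 := by
    intro k
    rw [inner_toEdgeL2, primitive_apply]
    simp [Set.IccExtend]
  have hsmul : ∀ m : ℝ, toEdgeL2 (ContinuousMap.const _ m) = m • toEdgeL2 1 := by
    intro m
    rw [toEdgeL2, toEdgeL2, ← MemLp.toLp_const_smul]
    apply MemLp.toLp_congr
    refine Eventually.of_forall fun x => ?_
    simp [Set.IccExtend]
  -- The constant has to be the mean of `z`. The difference has mean zero, so it is orthogonal to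
  -- `z` and to constants, hence to itself.
  refine ⟨primitive z 1, ?_⟩
  rw [hsmul]
  have h11 : inner ℝ (toEdgeL2 1) (toEdgeL2 1) = (1 : ℝ) := by
    rw [inner_toEdgeL2_toEdgeL2, mul_one]
    exact edgeIntegral_const 1
  have hk0 : primitive (z - primitive z 1 • toEdgeL2 1) 1 = 0 := by
    rw [← hone, inner_sub_right, inner_smul_right, h11, hone, mul_one, sub_self]
  have h1 := h _ hk0
  have h2 : inner ℝ (z - primitive z 1 • toEdgeL2 1) (z - primitive z 1 • toEdgeL2 1) = (0 : ℝ) := by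
    rw [inner_sub_left, h1, inner_smul_left, hone, hk0]
    simp
  exact sub_eq_zero.1 (inner_self_eq_zero.1 h2)

/-! ### Weak and classical eigenfunctions -/

section Spectrum

variable {V E : Type*} [Fintype E] {G : MultiGraph V E}

open Classical in
/-- The continuous function underlying a function on an edge, and `0` if there is none. -/
noncomputable def toContinuous (φ : unitInterval → ℝ) : C(unitInterval, ℝ) :=
  if h : Continuous φ then ⟨φ, h⟩ else 0

theorem toContinuous_apply {φ : unitInterval → ℝ} (h : Continuous φ) (x : unitInterval) :
    toContinuous φ x = φ x := by
  rw [toContinuous, dif_pos h]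
  rfl

theorem QuantumGraph.Admissible.continuous {g : E → ℝ} {ρ : EdgeFun E ℝ} (h : Admissible g ρ)
    (e : E) : Continuous (ρ e) :=
  continuous_of_continuousOn_extend (h.density_smooth e).continuousOn

/-- The coefficients `√g_e ρ_e` of the mass form in the coordinate `x ∈ [0, 1]`. -/
noncomputable def massCoeff (g : E → ℝ) (ρ : EdgeFun E ℝ) (e : E) : C(unitInterval, ℝ) :=
  √(g e) • toContinuous (ρ e)

theorem massCoeff_apply {g : E → ℝ} {ρ : EdgeFun E ℝ} (h : Admissible g ρ) (e : E)
    (x : unitInterval) : massCoeff g ρ e x = √(g e) * ρ e x := by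
  rw [massCoeff, ContinuousMap.smul_apply, toContinuous_apply (h.continuous e), smul_eq_mul]

theorem massCoeff_pos {g : E → ℝ} {ρ : EdgeFun E ℝ} (h : Admissible g ρ) (e : E)
    (x : unitInterval) : 0 < massCoeff g ρ e x := by
  rw [massCoeff_apply h]
  exact mul_pos (Real.sqrt_pos.2 (h.metric_pos e)) (h.density_pos e x)

/-- The Dirichlet form `∫ |∇f|²` of a metric. -/
noncomputable def gradForm (G : MultiGraph V E) (g : E → ℝ) :
    LinearMap.BilinForm ℝ (energySpace G) :=
  energyForm G (fun e => (√(g e))⁻¹, 0)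

/-- The form `∫ ρ f²` of a metric and a density. -/
noncomputable def massForm (G : MultiGraph V E) (g : E → ℝ) (ρ : EdgeFun E ℝ) :
    LinearMap.BilinForm ℝ (energySpace G) :=
  energyForm G (0, massCoeff g ρ)

theorem gradForm_apply (g : E → ℝ) (f k : energySpace G) : gradForm G g f k =
    ∑ e, (√(g e))⁻¹ * inner ℝ (edgeDeriv G e f) (edgeDeriv G e k) := by
  simp [gradForm, energyForm_apply]

theorem massForm_apply (g : E → ℝ) (ρ : EdgeFun E ℝ) (f k : energySpace G) : massForm G g ρ f k =
    ∑ e, edgeIntegral (massCoeff g ρ e * edgeVal G e f * edgeVal G e k) := by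
  simp [massForm, energyForm_apply]

theorem QuantumGraph.Admissible.isCompactPair {g : E → ℝ} {ρ : EdgeFun E ℝ}
    (h : Admissible g ρ) : IsCompactPair (gradForm G g) (massForm G g ρ) :=
  isCompactPair_energyForm (fun e => inv_pos.2 (Real.sqrt_pos.2 (h.metric_pos e)))
    (massCoeff_pos h)

/-- An element of the energy space as a function on the graph. -/
noncomputable def toEdgeFun (G : MultiGraph V E) : energySpace G →ₗ[ℝ] EdgeFun E ℝ where
  toFun p e x := edgeVal G e p x
  map_add' p q := by
    funext e x
    simp
  map_smul' c p := by
    funext e x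
    simp

theorem toEdgeFun_apply (p : energySpace G) (e : E) (x : unitInterval) :
    toEdgeFun G p e x = edgeVal G e p x := rfl

theorem toEdgeFun_injective : Function.Injective (toEdgeFun G) := fun _ _ h =>
  energySpace_ext fun e x => congrFun (congrFun h e) x

/-- Supplies classical functions as elements of the energy space: eigenfunctions, and the test
functions used below. -/
theorem exists_toEdgeFun_eq {f : EdgeFun E ℝ} (hf : ∀ e, ContDiffOn ℝ 1 (f.onEdge e) (Set.Icc 0 1))
    (ha : ∃ a : V → ℝ, ∀ e, f e 0 = a (G.src e) ∧ f e 1 = a (G.tgt e)) :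
    ∃ p : energySpace G, toEdgeFun G p = f := by
  have hder : ∀ e, IsEdgeDeriv (f e) (f.dx e) := fun e =>
    isEdgeDeriv_dx ((hf e).differentiableOn (by norm_num))
  have hcont : ∀ e, Continuous (f.dx e) := fun e => by
    refine continuous_of_continuousOn_extend ?_
    have h1 := contDiffOn_onEdge_dx (f := f) (e := e) (n := 0) (by simpa using hf e)
    exact h1.continuousOn
  have hval : ∀ e x, edgeValue e ((fun e => f e 0, fun e => toEdgeL2 ⟨f.dx e, hcont e⟩) :
      (E → ℝ) × (E → EdgeL2)) x = f e x := fun e x => by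
    rw [edgeValue_apply]
    exact (IsEdgeDeriv.eq_add_primitive (u := ⟨f.dx e, hcont e⟩) (hder e) x).symm
  obtain ⟨a, ha⟩ := ha
  refine ⟨⟨(fun e => f e 0, fun e => toEdgeL2 ⟨f.dx e, hcont e⟩), a, fun e => ?_⟩, ?_⟩
  · rw [hval, hval]
    exact ha e
  · funext e x
    exact hval e x

theorem edgeDeriv_eq_of_isEdgeDeriv {p : energySpace G} {e : E} {u : C(unitInterval, ℝ)}
    (h : IsEdgeDeriv (edgeVal G e p) u) : edgeDeriv G e p = toEdgeL2 u := by
  rw [← sub_eq_zero]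
  apply primitive_eq_zero
  ext x
  have h1 := h.eq_add_primitive x
  rw [edgeVal_apply] at h1
  have h2 : primitive (edgeDeriv G e p) x = primitive (toEdgeL2 u) x := by linarith
  have h3 : primitive (edgeDeriv G e p - toEdgeL2 u + toEdgeL2 u) x =
      primitive (edgeDeriv G e p - toEdgeL2 u) x + primitive (toEdgeL2 u) x := by
    rw [primitive_add]
    rfl
  rw [sub_add_cancel] at h3
  rw [ContinuousMap.zero_apply]
  linarith

/-- Green's formula. -/
theorem gradForm_eq {g : E → ℝ} {p : energySpace G} {u u' : E → C(unitInterval, ℝ)}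
    (hu : ∀ e, IsEdgeDeriv (edgeVal G e p) (u e)) (hu' : ∀ e, IsEdgeDeriv (u e) (u' e))
    (k : energySpace G) : gradForm G g p k =
      ∑ e, (√(g e))⁻¹ * (u e 1 * edgeVal G e k 1 - u e 0 * edgeVal G e k 0) -
        ∑ e, (√(g e))⁻¹ * edgeIntegral (u' e * edgeVal G e k) := by
  rw [gradForm_apply, ← Finset.sum_sub_distrib]
  refine Finset.sum_congr rfl fun e _ => ?_
  rw [edgeDeriv_eq_of_isEdgeDeriv (hu e), inner_toEdgeL2_eq (hu' e) _ (edgeVal_apply e k)]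
  ring

/-- Regrouping edge ends by vertex turns the boundary terms of Green's formula into Kirchhoff sums;
a loop contributes twice on both sides. -/
theorem sum_boundary_eq [Fintype V] (g : E → ℝ) (f : EdgeFun E ℝ) (a : V → ℝ) :
    ∑ e, (√(g e))⁻¹ * (f.dx e 1 * a (G.tgt e) - f.dx e 0 * a (G.src e)) =
      -∑ v, a v * outwardSum G g f v := by
  classical
  simp only [outwardSum, Finset.mul_sum]
  rw [Finset.sum_comm, ← Finset.sum_neg_distrib]
  refine Finset.sum_congr rfl fun e _ => ?_
  simp only [mul_add, Finset.sum_add_distrib, mul_ite, mul_zero]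
  have h1 : ∀ (w : V) (c : V → ℝ), ∑ v, (if w = v then c v else 0) = c w := fun w c => by simp
  rw [h1, h1]
  simp only [smul_eq_mul]
  ring

theorem mem_weakEigenspace_of_isEigenfunction [Fintype V] {g : E → ℝ} {ρ : EdgeFun E ℝ}
    (hgρ : Admissible g ρ) {μ : ℝ} {p : energySpace G}
    (hf : IsEigenfunction G g ρ μ (toEdgeFun G p)) :
    p ∈ weakEigenspace (gradForm G g) (massForm G g ρ) μ := by
  intro k
  set f := toEdgeFun G p with hfdef
  have hd1 : ∀ e, ContDiffOn ℝ (1 : ℕ) (f.dx.onEdge e) (Set.Icc 0 1) := fun e =>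
    contDiffOn_onEdge_dx (by simpa using hf.smooth e)
  have hd2 : ∀ e, ContDiffOn ℝ (0 : ℕ) (f.dx.dx.onEdge e) (Set.Icc 0 1) := fun e =>
    contDiffOn_onEdge_dx (by simpa using hd1 e)
  let u : E → C(unitInterval, ℝ) := fun e =>
    ⟨f.dx e, continuous_of_continuousOn_extend (hd1 e).continuousOn⟩
  let u' : E → C(unitInterval, ℝ) := fun e =>
    ⟨f.dx.dx e, continuous_of_continuousOn_extend (hd2 e).continuousOn⟩
  have hu : ∀ e, IsEdgeDeriv (edgeVal G e p) (u e) := fun e =>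
    isEdgeDeriv_dx (f := f) ((hf.smooth e).differentiableOn (by norm_num))
  have hu' : ∀ e, IsEdgeDeriv (u e) (u' e) := fun e =>
    isEdgeDeriv_dx (f := f.dx) ((hd1 e).differentiableOn (by norm_num))
  obtain ⟨a, ha⟩ := exists_vertexValue k
  rw [gradForm_eq hu hu', massForm_apply, Finset.mul_sum]
  have h1 := sum_boundary_eq (G := G) g f a
  simp only [hf.kirchhoff, mul_zero, Finset.sum_const_zero, neg_zero] at h1
  have h2 : ∑ e, (√(g e))⁻¹ * (u e 1 * edgeVal G e k 1 - u e 0 * edgeVal G e k 0) = 0 := by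
    refine Eq.trans (Finset.sum_congr rfl fun e _ => ?_) h1
    rw [(ha e).1, (ha e).2]
    rfl
  rw [h2, zero_sub, ← Finset.sum_neg_distrib]
  refine Finset.sum_congr rfl fun e _ => ?_
  suffices h3 : (-(√(g e))⁻¹) • (u' e * edgeVal G e k) =
      μ • (massCoeff g ρ e * edgeVal G e p * edgeVal G e k) by
    have h4 := congrArg edgeIntegral h3
    rw [map_smul, map_smul, smul_eq_mul, smul_eq_mul] at h4
    linarith
  ext x
  have hg := hgρ.metric_pos e
  have h3 := hf.equation e x
  rw [laplacian, div_eq_iff hg.ne'] at h3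
  have h4 : u' e x = -(μ * ρ e x * f e x * g e) := by
    have : u' e x = f.dx.dx e x := rfl
    linarith
  have h5 : f e x = edgeVal G e p x := rfl
  simp only [ContinuousMap.smul_apply, ContinuousMap.mul_apply,
    smul_eq_mul, massCoeff_apply hgρ, h4, h5]
  have h6 : (√(g e))⁻¹ * g e = √(g e) := by
    rw [inv_mul_eq_div, Real.div_sqrt]
  linear_combination (μ * ρ e x * edgeVal G e p x * edgeVal G e k x) * h6

open Classical in
/-- The function on a single edge with a given derivative of mean zero. -/
noncomputable def singleEdge (G : MultiGraph V E) (e : E) (k : EdgeL2) (hk : primitive k 1 = 0) :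
    energySpace G :=
  ⟨(0, Pi.single e k), 0, fun e' => by
    by_cases h : e' = e
    · subst h
      simp [edgeValue_apply, hk, primitive_zero_apply]
    · have h0 : primitive (0 : EdgeL2) = 0 := by
        simpa using primitive_smul 0 (0 : EdgeL2)
      simp [edgeValue_apply, h, h0]⟩

theorem edgeDeriv_singleEdge (e : E) {k : EdgeL2} (hk : primitive k 1 = 0) :
    edgeDeriv G e (singleEdge G e k hk) = k := by
  simp [edgeDeriv, singleEdge]

theorem edgeDeriv_singleEdge_of_ne {e e' : E} (h : e' ≠ e) {k : EdgeL2} (hk : primitive k 1 = 0) :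
    edgeDeriv G e' (singleEdge G e k hk) = 0 := by
  simp [edgeDeriv, singleEdge, h]

theorem edgeVal_singleEdge (e : E) {k : EdgeL2} (hk : primitive k 1 = 0) :
    edgeVal G e (singleEdge G e k hk) = primitive k := by
  ext x
  have h0 : edgeVal G e (singleEdge G e k hk) 0 = 0 := by
    change edgeValue e _ 0 = 0
    rw [edgeValue_zero_apply]
    rfl
  rw [edgeVal_apply, h0, edgeDeriv_singleEdge, zero_add]

theorem edgeVal_singleEdge_of_ne {e e' : E} (h : e' ≠ e) {k : EdgeL2} (hk : primitive k 1 = 0) :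
    edgeVal G e' (singleEdge G e k hk) = 0 := by
  ext x
  have h0 : edgeVal G e' (singleEdge G e k hk) 0 = 0 := by
    change edgeValue e' _ 0 = 0
    rw [edgeValue_zero_apply]
    rfl
  have h1 : primitive (0 : EdgeL2) = 0 := by
    simpa using primitive_smul 0 (0 : EdgeL2)
  rw [edgeVal_apply, h0, edgeDeriv_singleEdge_of_ne h, h1]
  simp

/-- Interior regularity of weak eigenvectors. -/
theorem exists_edgeDeriv_of_mem_weakEigenspace {g : E → ℝ} {ρ : EdgeFun E ℝ}
    (hgρ : Admissible g ρ) {μ : ℝ} {p : energySpace G}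
    (hp : p ∈ weakEigenspace (gradForm G g) (massForm G g ρ) μ) (e : E) :
    ∃ u : C(unitInterval, ℝ), IsEdgeDeriv (edgeVal G e p) u ∧
      IsEdgeDeriv u (-(μ * √(g e)) • (massCoeff g ρ e * edgeVal G e p) : C(unitInterval, ℝ)) := by
  have hs : 0 < √(g e) := Real.sqrt_pos.2 (hgρ.metric_pos e)
  set W := primitive (toEdgeL2 (massCoeff g ρ e * edgeVal G e p)) with hW
  have hWd : IsEdgeDeriv W (massCoeff g ρ e * edgeVal G e p : C(unitInterval, ℝ)) :=
    isEdgeDeriv_of_eq_add_primitive (c := 0) fun x => by rw [zero_add]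
  -- Testing with functions supported on `e` and integrating the mass term by parts leaves `f' / √g
  -- + μ W` orthogonal to all mean-zero functions. It is therefore constant, and `f'` has a
  -- continuous representative.
  have horth : ∀ k : EdgeL2, primitive k 1 = 0 →
      inner ℝ ((√(g e))⁻¹ • edgeDeriv G e p + μ • toEdgeL2 W) k = 0 := by
    intro k hk
    have h1 := hp (singleEdge G e k hk)
    rw [gradForm_apply, massForm_apply, Finset.sum_eq_single e
      (fun e' _ h => by rw [edgeDeriv_singleEdge_of_ne h, inner_zero_right, mul_zero])
      (fun h => absurd (Finset.mem_univ e) h), Finset.sum_eq_single e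
      (fun e' _ h => by rw [edgeVal_singleEdge_of_ne h, mul_zero, map_zero])
      (fun h => absurd (Finset.mem_univ e) h), edgeDeriv_singleEdge, edgeVal_singleEdge] at h1
    have h2 := inner_toEdgeL2_eq hWd 0 (k := k) (φ := primitive k) fun x => by rw [zero_add]
    rw [hk, primitive_zero_apply] at h2
    rw [inner_add_left, inner_smul_left, inner_smul_left, h2]
    simp only [conj_trivial]
    rw [h1]
    ring
  obtain ⟨m, hm⟩ := eq_toEdgeL2_const horth
  set u : C(unitInterval, ℝ) := √(g e) • (ContinuousMap.const _ m - μ • W) with hu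
  have hcomb : toEdgeL2 u = √(g e) • (toEdgeL2 (ContinuousMap.const _ m) - μ • toEdgeL2 W) := by
    refine Lp.ext ?_
    filter_upwards [coeFn_toEdgeL2 u, coeFn_toEdgeL2 (ContinuousMap.const _ m), coeFn_toEdgeL2 W,
      Lp.coeFn_smul (√(g e)) (toEdgeL2 (ContinuousMap.const _ m) - μ • toEdgeL2 W),
      Lp.coeFn_sub (toEdgeL2 (ContinuousMap.const _ m)) (μ • toEdgeL2 W),
      Lp.coeFn_smul μ (toEdgeL2 W)] with x h1 h2 h3 h4 h5 h6
    rw [h1, h4, Pi.smul_apply, h5, Pi.sub_apply, h6, Pi.smul_apply, h2, h3]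
    simp [hu, Set.IccExtend]
  have hder : edgeDeriv G e p = toEdgeL2 u := by
    rw [hcomb, ← hm, add_sub_cancel_right, smul_smul, mul_inv_cancel₀ hs.ne', one_smul]
  refine ⟨u, isEdgeDeriv_of_eq_add_primitive (c := edgeVal G e p 0) fun x => ?_, fun x => ?_⟩
  · rw [edgeVal_apply e p x, hder]
  · have h1 := (((hasDerivWithinAt_const (x : ℝ) (Set.Icc (0 : ℝ) 1) m).sub
      ((hWd x).const_mul μ)).const_mul (√(g e)))
    have h2 : (-(μ * √(g e)) • (massCoeff g ρ e * edgeVal G e p) : C(unitInterval, ℝ)) x =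
        √(g e) * (0 - μ * (massCoeff g ρ e * edgeVal G e p) x) := by
      rw [ContinuousMap.smul_apply, smul_eq_mul]
      ring
    rw [h2]
    exact h1

theorem isEigenfunction_of_mem_weakEigenspace [Fintype V] {g : E → ℝ} {ρ : EdgeFun E ℝ}
    (hgρ : Admissible g ρ) {μ : ℝ} {p : energySpace G} (hp0 : p ≠ 0)
    (hp : p ∈ weakEigenspace (gradForm G g) (massForm G g ρ) μ) :
    IsEigenfunction G g ρ μ (toEdgeFun G p) := by
  choose u hu hu' using exists_edgeDeriv_of_mem_weakEigenspace hgρ hp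
  set f := toEdgeFun G p with hf
  have hdx : ∀ e, f.dx e = u e := fun e => IsEdgeDeriv.dx_eq (f := f) (hu e)
  have hddx : ∀ e, f.dx.dx e = (-(μ * √(g e)) • (massCoeff g ρ e * edgeVal G e p) :
      C(unitInterval, ℝ)) := fun e => IsEdgeDeriv.dx_eq (by rw [hdx]; exact hu' e)
  refine ⟨fun h0 => hp0 (toEdgeFun_injective (by rw [← hf, h0, map_zero])),
    fun e => contDiffOn_two_of_isEdgeDeriv (hu e) (hu' e), fun e x => ?_, exists_vertexValue p,
    fun v => ?_⟩
  · have hg := hgρ.metric_pos e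
    rw [laplacian, hddx, div_eq_iff hg.ne']
    simp only [ContinuousMap.smul_apply, ContinuousMap.mul_apply, smul_eq_mul, massCoeff_apply hgρ]
    have h1 : √(g e) * √(g e) = g e := Real.mul_self_sqrt hg.le
    have h2 : f e x = edgeVal G e p x := rfl
    rw [h2]
    linear_combination (μ * ρ e x * edgeVal G e p x) * h1
  · classical
    -- Testing with the edgewise affine function that is `1` at `v` and `0` at the other vertices
    -- isolates the Kirchhoff sum at `v`.
    set a : V → ℝ := fun w => if w = v then 1 else 0 with ha
    obtain ⟨k, hk⟩ := exists_toEdgeFun_eq (G := G)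
      (f := fun e x => a (G.src e) + (x : ℝ) * (a (G.tgt e) - a (G.src e))) (fun e => by
        have h1 : ContDiffOn ℝ 1 (fun x : ℝ => a (G.src e) + x * (a (G.tgt e) - a (G.src e)))
          (Set.Icc 0 1) := by fun_prop
        exact h1.congr fun x hx => Set.IccExtend_of_mem _ _ hx)
      ⟨a, fun e => by simp⟩
    have hk0 : ∀ e, edgeVal G e k 0 = a (G.src e) := fun e => by
      rw [← toEdgeFun_apply, hk]; simp
    have hk1 : ∀ e, edgeVal G e k 1 = a (G.tgt e) := fun e => by
      rw [← toEdgeFun_apply, hk]; simp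
    have h1 := hp k
    rw [gradForm_eq hu hu', massForm_apply] at h1
    have h2 := sum_boundary_eq (G := G) g f a
    have h3 : ∑ e, (√(g e))⁻¹ * (u e 1 * edgeVal G e k 1 - u e 0 * edgeVal G e k 0) =
        -∑ w, a w * outwardSum G g f w := by
      rw [← h2]
      refine Finset.sum_congr rfl fun e _ => ?_
      rw [hk0, hk1, hdx]
    have h4 : ∑ w, a w * outwardSum G g f w = outwardSum G g f v := by simp [ha]
    have h5 : ∑ e, (√(g e))⁻¹ * edgeIntegral
        ((-(μ * √(g e)) • (massCoeff g ρ e * edgeVal G e p)) * edgeVal G e k) =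
        -(μ * ∑ e, edgeIntegral (massCoeff g ρ e * edgeVal G e p * edgeVal G e k)) := by
      rw [Finset.mul_sum, ← Finset.sum_neg_distrib]
      refine Finset.sum_congr rfl fun e _ => ?_
      have hs : 0 < √(g e) := Real.sqrt_pos.2 (hgρ.metric_pos e)
      rw [smul_mul_assoc, map_smul, smul_eq_mul]
      field_simp
    rw [h3, h4, h5] at h1
    linarith

/-! ### Infinite dimension of the energy space and equality of weak and classical eigenvalues -/

theorem contDiff_polynomial_eval (q : Polynomial ℝ) (n : WithTop ℕ∞) :
    ContDiff ℝ n fun x : ℝ => q.eval x := by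
  simpa only [Polynomial.coe_aeval_eq_eval] using Polynomial.contDiff_aeval (𝕜 := ℝ) q n

/-- The functions `x (1 - x) q(x)` on one edge, with `q` a polynomial, vanish at the vertices and
already span an infinite-dimensional space. -/
theorem not_finiteDimensional_energySpace [Nonempty E] : ¬ FiniteDimensional ℝ (energySpace G) := by
  classical
  intro hfin
  obtain ⟨e₀⟩ := ‹Nonempty E›
  let T : Polynomial ℝ →ₗ[ℝ] EdgeFun E ℝ :=
    { toFun := fun q e x => if e = e₀ then (Polynomial.X * (1 - Polynomial.X) * q).eval (x : ℝ) else 0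
      map_add' := fun q r => by
        funext e x
        by_cases h : e = e₀ <;> simp [h, mul_add]
      map_smul' := fun c q => by
        funext e x
        by_cases h : e = e₀
        · simp [h]
        · simp [h] }
  have hTinj : Function.Injective T := by
    rw [injective_iff_map_eq_zero]
    intro q hq
    have h1 : Polynomial.X * (1 - Polynomial.X) * q = 0 := by
      refine Polynomial.eq_zero_of_infinite_isRoot _
        ((Set.Icc_infinite (zero_lt_one (α := ℝ))).mono fun x hx => ?_)
      have h2 := congrFun (congrFun hq e₀) ⟨x, hx⟩
      simpa [T] using h2
    rcases mul_eq_zero.1 h1 with h2 | h2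
    · rcases mul_eq_zero.1 h2 with h3 | h3
      · exact absurd h3 Polynomial.X_ne_zero
      · have := congrArg (Polynomial.eval 0) h3
        simp at this
    · exact h2
  have hrange : LinearMap.range T ≤ LinearMap.range (toEdgeFun G) := by
    rintro _ ⟨q, rfl⟩
    obtain ⟨p, hp⟩ := exists_toEdgeFun_eq (G := G) (f := T q) (fun e => by
      have h1 : ContDiffOn ℝ 1 (fun x : ℝ => if e = e₀ then
          (Polynomial.X * (1 - Polynomial.X) * q).eval x else 0) (Set.Icc 0 1) := by
        by_cases h : e = e₀
        · simp only [h, if_true]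
          exact (contDiff_polynomial_eval _ _).contDiffOn
        · simp only [h, if_false]
          exact contDiffOn_const
      exact h1.congr fun x hx => Set.IccExtend_of_mem _ _ hx)
      ⟨0, fun e => by simp [T]⟩
    exact ⟨p, hp⟩
  have : FiniteDimensional ℝ (LinearMap.range T) := Submodule.finiteDimensional_of_le hrange
  have h2 : Module.Finite ℝ (Polynomial ℝ) :=
    Module.Finite.equiv (LinearEquiv.ofInjective T hTinj).symm
  exact Polynomial.not_finite h2

/-- By regularity the injection `toEdgeFun` carries each spectral span onto the span of classical
eigenfunctions; both are finite-dimensional, so cardinal rank and `finrank` count alike. -/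
theorem eigenvalue_eq_weakEigenvalue [Fintype V] {g : E → ℝ} {ρ : EdgeFun E ℝ}
    (hgρ : Admissible g ρ) (k : ℕ) :
    eigenvalue G k g ρ = weakEigenvalue (gradForm G g) (massForm G g ρ) k := by
  have hpair := hgρ.isCompactPair (G := G)
  rw [eigenvalue, weakEigenvalue]
  congr 1
  ext Λ
  have hfin := hpair.finiteDimensional_spectralSpan Λ
  have hspan : Submodule.span ℝ {f : EdgeFun E ℝ | ∃ μ ≤ Λ, IsEigenfunction G g ρ μ f} =
      (spectralSpan (gradForm G g) (massForm G g ρ) Λ).map (toEdgeFun G) := by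
    apply le_antisymm
    · refine Submodule.span_le.2 ?_
      rintro f ⟨μ, hμ, hf⟩
      obtain ⟨p, rfl⟩ := exists_toEdgeFun_eq
        (fun e => (hf.smooth e).of_le (by norm_num)) hf.continuous
      exact ⟨p, weakEigenspace_le_spectralSpan hμ (mem_weakEigenspace_of_isEigenfunction hgρ hf),
        rfl⟩
    · rw [spectralSpan, Submodule.map_iSup]
      refine iSup_le fun μ => ?_
      rintro _ ⟨p, hp, rfl⟩
      by_cases hp0 : p = 0
      · simp [hp0]
      · exact Submodule.subset_span ⟨μ, μ.2, isEigenfunction_of_mem_weakEigenspace hgρ hp0 hp⟩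
  have e := Submodule.equivMapOfInjective _ (toEdgeFun_injective (G := G))
    (spectralSpan (gradForm G g) (massForm G g ρ) Λ)
  have hfin' := Module.Finite.equiv e
  simp only [Set.mem_ofPred_eq]
  rw [hspan, ← Module.finrank_eq_rank, ← e.finrank_eq, Nat.cast_le]

end Spectrum

/-! ### Smooth families of metrics and densities -/

/-- The pointwise `t`-derivative is a derivative in the sup norm: it is uniformly continuous on a
compact rectangle, and the mean value inequality for `F(s, x) - s ψ(0, x)` transfers this to the
difference quotients. -/
theorem exists_hasDerivAt_toContinuous {ε : ℝ} (hε : 0 < ε) {φ : ℝ → unitInterval → ℝ}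
    (h : ContDiffOn ℝ ∞ (fun p : ℝ × ℝ => Set.IccExtend (zero_le_one (α := ℝ)) (φ p.1) p.2)
      (Set.Ioo (-ε) ε ×ˢ Set.Icc 0 1)) :
    ∃ φ' : C(unitInterval, ℝ), HasDerivAt (fun t => toContinuous (φ t)) φ' 0 := by
  set F : ℝ × ℝ → ℝ := fun p => Set.IccExtend (zero_le_one (α := ℝ)) (φ p.1) p.2 with hF
  set S : Set (ℝ × ℝ) := Set.Ioo (-ε) ε ×ˢ Set.Icc 0 1 with hS
  have hSd : UniqueDiffOn ℝ S := isOpen_Ioo.uniqueDiffOn.prod uniqueDiffOn_unit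
  set ψ : ℝ × ℝ → ℝ := fun p => fderivWithin ℝ F S p (1, 0) with hψ
  have hψc : ContinuousOn ψ S :=
    (h.continuousOn_fderivWithin hSd (by simp)).clm_apply continuousOn_const
  have hder : ∀ s ∈ Set.Ioo (-ε) ε, ∀ x ∈ Set.Icc (0 : ℝ) 1,
      HasDerivAt (fun s => F (s, x)) (ψ (s, x)) s := by
    intro s hs x hx
    have h1 : HasFDerivWithinAt F (fderivWithin ℝ F S (s, x)) S (s, x) :=
      ((h.differentiableOn (by simp)) (s, x) ⟨hs, hx⟩).hasFDerivWithinAt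
    have h2 : HasDerivWithinAt (fun s : ℝ => (s, x)) ((1 : ℝ), (0 : ℝ)) (Set.Ioo (-ε) ε) s :=
      (hasDerivAt_id s).hasDerivWithinAt.prodMk (hasDerivWithinAt_const s _ x)
    have h3 := h1.comp_hasDerivWithinAt s h2
      (show Set.MapsTo (fun s : ℝ => (s, x)) (Set.Ioo (-ε) ε) S from fun y hy => ⟨hy, hx⟩)
    exact h3.hasDerivAt (isOpen_Ioo.mem_nhds hs)
  have hcont : ∀ t ∈ Set.Ioo (-ε) ε, Continuous (φ t) := fun t ht => by
    apply continuous_of_continuousOn_extend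
    have h1 : ContinuousOn (fun x : ℝ => F (t, x)) (Set.Icc 0 1) :=
      h.continuousOn.comp (by fun_prop) fun x hx => ⟨ht, hx⟩
    exact h1
  have h0 : (0 : ℝ) ∈ Set.Ioo (-ε) ε := ⟨by linarith, hε⟩
  let φ' : C(unitInterval, ℝ) := ⟨fun x => ψ (0, x),
    hψc.comp_continuous (f := fun x : unitInterval => ((0 : ℝ), (x : ℝ))) (by fun_prop)
      fun x => ⟨h0, x.2⟩⟩
  refine ⟨φ', ?_⟩
  rw [hasDerivAt_iff_isLittleO, Asymptotics.isLittleO_iff]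
  intro c hc
  have hK : IsCompact (Set.Icc (-(ε / 2)) (ε / 2) ×ˢ Set.Icc (0 : ℝ) 1) :=
    isCompact_Icc.prod isCompact_Icc
  have huc := hK.uniformContinuousOn_of_continuous (hψc.mono (Set.prod_mono
    (fun y hy => ⟨by linarith [hy.1], by linarith [hy.2]⟩) le_rfl))
  rw [Metric.uniformContinuousOn_iff] at huc
  obtain ⟨δ, hδ, hucδ⟩ := huc c hc
  have hnear : Metric.ball (0 : ℝ) (min δ (ε / 2)) ∈ 𝓝 (0 : ℝ) :=
    Metric.ball_mem_nhds _ (by positivity)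
  filter_upwards [hnear] with t ht
  rw [mem_ball_zero_iff, Real.norm_eq_abs, lt_min_iff] at ht
  have hIoo : ∀ s : ℝ, |s| ≤ |t| → s ∈ Set.Ioo (-ε) ε := fun s hs => by
    have := abs_lt.1 (hs.trans_lt ht.2)
    exact ⟨by linarith [this.1], by linarith [this.2]⟩
  rw [ContinuousMap.norm_le _ (by positivity)]
  intro x
  rw [sub_zero, ContinuousMap.sub_apply, ContinuousMap.sub_apply, ContinuousMap.smul_apply,
    toContinuous_apply (hcont t (hIoo t le_rfl)), toContinuous_apply (hcont 0 h0)]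
  have hFφ : ∀ s, F (s, x) = φ s x := fun s => Set.IccExtend_val _ _ x
  have hmv := (convex_Icc (-|t|) |t|).norm_image_sub_le_of_norm_hasDerivWithin_le
    (f := fun s => F (s, (x : ℝ)) - s * ψ (0, x)) (f' := fun s => ψ (s, x) - 1 * ψ (0, x)) (C := c)
    (fun s hs => ((hder s (hIoo s (abs_le.2 hs)) x x.2).sub
      ((hasDerivAt_id s).mul_const _)).hasDerivWithinAt)
    (fun s hs => by
      rw [one_mul, ← dist_eq_norm]
      have hs' : |s| ≤ |t| := abs_le.2 hs
      have h5 := abs_lt.1 (hs'.trans_lt ht.2)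
      refine (hucδ (s, x) ⟨⟨h5.1.le, h5.2.le⟩, x.2⟩ (0, x) ⟨⟨by linarith, by linarith⟩, x.2⟩ ?_).le
      rw [Prod.dist_eq, dist_self, max_eq_left dist_nonneg, Real.dist_0_eq_abs]
      exact hs'.trans_lt ht.1)
    (x := 0) (y := t) ⟨by simp, by simp⟩ ⟨neg_abs_le t, le_abs_self t⟩
  simp only [hFφ, zero_mul, sub_zero] at hmv
  have h6 : φ t x - φ 0 x - t • φ' x = φ t x - t * ψ (0, x) - φ 0 x := by
    simp only [smul_eq_mul, φ', ContinuousMap.coe_mk]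
    ring
  rw [h6]
  exact hmv

section Family

variable {V E : Type*} [Fintype E] {G : MultiGraph V E}

theorem QuantumGraph.IsSmoothFamily.exists_hasDerivAt {ε : ℝ} (hε : 0 < ε) {g : ℝ → E → ℝ}
    {ρ : ℝ → EdgeFun E ℝ} (h : IsSmoothFamily ε g ρ) :
    ∃ (s' : E → ℝ) (w' : E → C(unitInterval, ℝ)), HasDerivAt (fun t e => √(g t e)) s' 0 ∧
      HasDerivAt (fun t => massCoeff (g t) (ρ t)) w' 0 := by
  have h0 : (0 : ℝ) ∈ Set.Ioo (-ε) ε := ⟨by linarith, hε⟩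
  have h1 : ∀ e, ∃ s', HasDerivAt (fun t => √(g t e)) s' 0 := fun e => by
    have h2 := ((h.metric_smooth e).differentiableOn (by simp)).differentiableAt
      (isOpen_Ioo.mem_nhds h0)
    exact ⟨_, h2.hasDerivAt.sqrt ((h.admissible 0 h0).metric_pos e).ne'⟩
  have h3 : ∀ e, ∃ φ' : C(unitInterval, ℝ), HasDerivAt (fun t => toContinuous (ρ t e)) φ' 0 :=
    fun e => exists_hasDerivAt_toContinuous hε (h.density_smooth e)
  choose s' hs' using h1
  choose φ' hφ' using h3
  exact ⟨s', _, hasDerivAt_pi.2 hs', hasDerivAt_pi.2 fun e => (hs' e).smul (hφ' e)⟩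

/-- The integral over an edge as a continuous linear map. -/
noncomputable def edgeIntegralCLM : C(unitInterval, ℝ) →L[ℝ] ℝ :=
  edgeIntegral.mkContinuous 1 fun φ => by
    rw [one_mul]
    exact abs_edgeIntegral_le φ

theorem totalMass_eq {g : E → ℝ} {ρ : EdgeFun E ℝ} (h : Admissible g ρ) :
    totalMass g ρ = ∑ e, edgeIntegral (massCoeff g ρ e) := by
  rw [totalMass]
  refine Finset.sum_congr rfl fun e _ => ?_
  rw [edgeIntegral_apply]
  congr 1
  funext x
  rw [Set.IccExtend_apply, massCoeff_apply h, mul_comm]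
  rfl

theorem totalLength_pos [Nonempty E] {g : E → ℝ} {ρ : EdgeFun E ℝ} (h : Admissible g ρ) :
    0 < totalLength g :=
  Finset.sum_pos (fun e _ => Real.sqrt_pos.2 (h.metric_pos e)) Finset.univ_nonempty

theorem totalMass_pos [Nonempty E] {g : E → ℝ} {ρ : EdgeFun E ℝ} (h : Admissible g ρ) :
    0 < totalMass g ρ := by
  rw [totalMass_eq h]
  exact Finset.sum_pos (fun e _ => edgeIntegral_pos (x := 0) (fun y => (massCoeff_pos h e y).le)
    (massCoeff_pos h e 0)) Finset.univ_nonempty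

/-- Forms depend linearly on their coefficients and are bounded by the coefficient norm times
`stdForm`, so differentiating the coefficients in norm is enough. -/
theorem hasFormDeriv_energyForm {n : LinearMap.BilinForm ℝ (energySpace G)} {K : ℝ} (hK : 0 < K)
    (hn : ∀ f, stdForm G f f ≤ K * n f f) {q : ℝ → (E → ℝ) × (E → C(unitInterval, ℝ))}
    {q' : (E → ℝ) × (E → C(unitInterval, ℝ))} (hq : HasDerivAt q q' 0) :
    HasFormDeriv n (fun t => energyForm G (q t)) (energyForm G q') where
  symm t := energyForm_symm (q t)
  bound := by
    refine ⟨‖q'‖ * K, by positivity, fun f => (abs_energyForm_le q' f).trans ?_⟩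
    rw [mul_assoc]
    exact mul_le_mul_of_nonneg_left (hn f) (norm_nonneg _)
  expansion η hη := by
    rw [hasDerivAt_iff_isLittleO, Asymptotics.isLittleO_iff] at hq
    filter_upwards [hq (show 0 < η / K by positivity)] with t ht f
    rw [sub_zero, Real.norm_eq_abs] at ht
    have h1 : energyForm G (q t) f f - energyForm G (q 0) f f - t * energyForm G q' f f =
        energyForm G (q t - q 0 - t • q') f f := by
      rw [map_sub, map_sub, map_smul]
      rfl
    rw [h1]
    refine (abs_energyForm_le _ f).trans ?_
    calc ‖q t - q 0 - t • q'‖ * stdForm G f f ≤ η / K * |t| * (K * n f f) :=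
          mul_le_mul ht (hn f) (stdForm_nonneg f) (by positivity)
      _ = η * |t| * n f f := by field_simp

theorem exists_stdForm_le {g : E → ℝ} {ρ : EdgeFun E ℝ} (h : Admissible g ρ) :
    ∃ K > 0, ∀ f, stdForm G f f ≤ K * (gradForm G g + massForm G g ρ) f f := by
  obtain ⟨κ₁, hκ₁, hcκ⟩ := exists_pos_le_of_finite (c := fun e => (√(g e))⁻¹)
    fun e => inv_pos.2 (Real.sqrt_pos.2 (h.metric_pos e))
  obtain ⟨κ₂, hκ₂, hwκ⟩ := exists_pos_le_of_continuous (massCoeff_pos h)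
  have hκ : 0 < min κ₁ κ₂ := lt_min hκ₁ hκ₂
  refine ⟨(min κ₁ κ₂)⁻¹, inv_pos.2 hκ, fun f => ?_⟩
  have h0 : min κ₁ κ₂ * stdForm G f f = energyForm G (min κ₁ κ₂ • (1, 1)) f f := by
    rw [map_smul]
    rfl
  have h1 : gradForm G g + massForm G g ρ = energyForm G (fun e => (√(g e))⁻¹, massCoeff g ρ) := by
    rw [gradForm, massForm, ← map_add]
    simp
  rw [h1, ← div_eq_inv_mul, le_div_iff₀ hκ, mul_comm, h0]
  refine energyForm_self_mono (fun e => ?_) (fun e x => ?_) f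
  · simpa using Or.inl (hcκ e)
  · simpa using Or.inr (hwκ e x)

/-- The derivative of `L ∫ρ` in the direction `(s', w')`, where `s'` and `w'` are the derivatives
of `√g` and `√g ρ`. -/
noncomputable def normDeriv (g : E → ℝ) (ρ : EdgeFun E ℝ) (s' : E → ℝ)
    (w' : E → C(unitInterval, ℝ)) : ℝ :=
  (∑ e, s' e) * totalMass g ρ + totalLength g * ∑ e, edgeIntegral (w' e)

/-- The quadratic form on an eigenspace that gives the first variation of the normalised
eigenvalue `F`. -/
noncomputable def variationForm (G : MultiGraph V E) (g : E → ℝ) (ρ : EdgeFun E ℝ) (F : ℝ)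
    (s' : E → ℝ) (w' : E → C(unitInterval, ℝ)) : LinearMap.BilinForm ℝ (energySpace G) :=
  energyForm G (fun e => normDeriv g ρ s' w' * (√(g e))⁻¹ -
    totalLength g * totalMass g ρ * (s' e / g e), -(F • w'))

theorem hasDerivAt_norm {g : ℝ → E → ℝ} {ρ : ℝ → EdgeFun E ℝ}
    (hadm : ∀ᶠ t in 𝓝 (0 : ℝ), Admissible (g t) (ρ t)) {s' : E → ℝ}
    {w' : E → C(unitInterval, ℝ)} (hs : HasDerivAt (fun t e => √(g t e)) s' 0)
    (hw : HasDerivAt (fun t => massCoeff (g t) (ρ t)) w' 0) :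
    HasDerivAt (fun t => totalLength (g t) * totalMass (g t) (ρ t))
      (normDeriv (g 0) (ρ 0) s' w') 0 := by
  have h1 : HasDerivAt (fun t => totalLength (g t)) (∑ e, s' e) 0 :=
    HasDerivAt.fun_sum fun e _ => hasDerivAt_pi.1 hs e
  have h2 : HasDerivAt (fun t => ∑ e, edgeIntegral (massCoeff (g t) (ρ t) e))
      (∑ e, edgeIntegral (w' e)) 0 :=
    HasDerivAt.fun_sum fun e _ =>
      edgeIntegralCLM.hasFDerivAt.comp_hasDerivAt 0 (hasDerivAt_pi.1 hw e)
  have h3 : HasDerivAt (fun t => totalMass (g t) (ρ t)) (∑ e, edgeIntegral (w' e)) 0 :=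
    h2.congr_of_eventuallyEq (hadm.mono fun t ht => totalMass_eq ht)
  exact h1.mul h3

theorem hasDerivAt_gradCoeff {g : ℝ → E → ℝ} {ρ : ℝ → EdgeFun E ℝ}
    (hadm : ∀ᶠ t in 𝓝 (0 : ℝ), Admissible (g t) (ρ t)) {s' : E → ℝ}
    (hs : HasDerivAt (fun t e => √(g t e)) s' 0) :
    HasDerivAt (fun t e => (√(g t e))⁻¹) (fun e => -s' e / g 0 e) 0 := by
  refine hasDerivAt_pi.2 fun e => ?_
  have h0 := hadm.self_of_nhds.metric_pos e
  have h1 := (hasDerivAt_pi.1 hs e).inv (Real.sqrt_pos.2 h0).ne'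
  rwa [Real.sq_sqrt h0.le] at h1

/-- The normalising factor `L ∫ρ` is absorbed into the Dirichlet form, and the product rule is
applied to the coefficient `L ∫ρ / √g`. -/
theorem hasFormDeriv_family {g : ℝ → E → ℝ} {ρ : ℝ → EdgeFun E ℝ}
    (hadm : ∀ᶠ t in 𝓝 (0 : ℝ), Admissible (g t) (ρ t)) {s' : E → ℝ}
    {w' : E → C(unitInterval, ℝ)} (hs : HasDerivAt (fun t e => √(g t e)) s' 0)
    (hw : HasDerivAt (fun t => massCoeff (g t) (ρ t)) w' 0) :
    HasFormDeriv (gradForm G (g 0) + massForm G (g 0) (ρ 0))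
        (fun t => (totalLength (g t) * totalMass (g t) (ρ t)) • gradForm G (g t))
        (energyForm G (fun e => normDeriv (g 0) (ρ 0) s' w' * (√(g 0 e))⁻¹ -
          totalLength (g 0) * totalMass (g 0) (ρ 0) * (s' e / g 0 e), 0)) ∧
      HasFormDeriv (gradForm G (g 0) + massForm G (g 0) (ρ 0))
        (fun t => massForm G (g t) (ρ t)) (energyForm G (0, w')) := by
  have h0 := hadm.self_of_nhds
  obtain ⟨K, hK, hn⟩ := exists_stdForm_le (G := G) h0
  have hℓ := hasDerivAt_norm hadm hs hw
  have hp := hasDerivAt_gradCoeff hadm hs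
  have hzero : HasDerivAt (fun _ : ℝ => (0 : E → C(unitInterval, ℝ))) 0 0 :=
    hasDerivAt_const _ _
  have hzero' : HasDerivAt (fun _ : ℝ => (0 : E → ℝ)) 0 0 := hasDerivAt_const _ _
  refine ⟨?_, hasFormDeriv_energyForm (G := G) hK hn (hzero'.prodMk hw)⟩
  have h1 := hasFormDeriv_energyForm (G := G) hK hn (hℓ.smul (hp.prodMk hzero))
  have h2 : (totalLength (g 0) * totalMass (g 0) (ρ 0)) •
      ((fun e => -s' e / g 0 e, 0) : (E → ℝ) × (E → C(unitInterval, ℝ))) +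
      normDeriv (g 0) (ρ 0) s' w' • (fun e => (√(g 0 e))⁻¹, 0) =
      (fun e => normDeriv (g 0) (ρ 0) s' w' * (√(g 0 e))⁻¹ -
          totalLength (g 0) * totalMass (g 0) (ρ 0) * (s' e / g 0 e), 0) := by
    refine Prod.ext (funext fun e => ?_) (by simp)
    simp only [Prod.fst_add, Prod.smul_fst, Pi.add_apply, Pi.smul_apply, smul_eq_mul]
    ring
  rw [h2] at h1
  have h3 : ∀ t, (totalLength (g t) * totalMass (g t) (ρ t)) • gradForm G (g t) =
      energyForm G ((totalLength (g t) * totalMass (g t) (ρ t)) • (fun e => (√(g t e))⁻¹, 0)) :=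
    fun t => (map_smul _ _ _).symm
  simp only [h3]
  exact h1

theorem variationForm_eq (g : E → ℝ) (ρ : EdgeFun E ℝ) (F : ℝ) (s' : E → ℝ)
    (w' : E → C(unitInterval, ℝ)) :
    energyForm G (fun e => normDeriv g ρ s' w' * (√(g e))⁻¹ -
      totalLength g * totalMass g ρ * (s' e / g e), 0) - F • energyForm G (0, w') =
      variationForm G g ρ F s' w' := by
  have h : ((fun e => normDeriv g ρ s' w' * (√(g e))⁻¹ -
      totalLength g * totalMass g ρ * (s' e / g e), -(F • w')) :
      (E → ℝ) × (E → C(unitInterval, ℝ))) = (fun e => normDeriv g ρ s' w' * (√(g e))⁻¹ -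
      totalLength g * totalMass g ρ * (s' e / g e), 0) - F • (0, w') := by
    refine Prod.ext (funext fun e => ?_) (funext fun e => ?_) <;> simp
  rw [variationForm, h, map_sub, map_smul]

/-! ### First-order bounds for the normalised eigenvalue -/

variable [Fintype V] [Nonempty E]

theorem normalisedEigenvalue_eq {g : E → ℝ} {ρ : EdgeFun E ℝ} (h : Admissible g ρ) (k : ℕ) :
    normalisedEigenvalue G k g ρ =
      totalLength g * totalMass g ρ * weakEigenvalue (gradForm G g) (massForm G g ρ) k := by
  rw [normalisedEigenvalue, eigenvalue_eq_weakEigenvalue h]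
  ring

variable {g : ℝ → E → ℝ} {ρ : ℝ → EdgeFun E ℝ}

theorem eventually_normalisedEigenvalue_le (hadm : ∀ᶠ t in 𝓝 (0 : ℝ), Admissible (g t) (ρ t))
    {s' : E → ℝ} {w' : E → C(unitInterval, ℝ)} (hs : HasDerivAt (fun t e => √(g t e)) s' 0)
    (hw : HasDerivAt (fun t => massCoeff (g t) (ρ t)) w' 0) {k : ℕ}
    {Y : Submodule ℝ (energySpace G)} [FiniteDimensional ℝ Y]
    (hY : Y ≤ weakEigenspace (gradForm G (g 0)) (massForm G (g 0) (ρ 0))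
      (eigenvalue G k (g 0) (ρ 0))) {δ : ℝ} (hδ : 0 < δ)
    (hk : k + 1 ≤ Module.finrank ℝ (spectralSpan (gradForm G (g 0)) (massForm G (g 0) (ρ 0))
      (eigenvalue G k (g 0) (ρ 0) - δ)) + Module.finrank ℝ Y) (c : ℝ) {η : ℝ} (hη : 0 < η) :
    ∀ᶠ t in 𝓝 (0 : ℝ),
      (∀ y ∈ Y, t * variationForm G (g 0) (ρ 0) (normalisedEigenvalue G k (g 0) (ρ 0)) s' w' y y ≤
        c * |t| * massForm G (g 0) (ρ 0) y y) →
      normalisedEigenvalue G k (g t) (ρ t) ≤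
        normalisedEigenvalue G k (g 0) (ρ 0) + (c + η) * |t| := by
  have h0 := hadm.self_of_nhds
  obtain ⟨hN, hD⟩ := hasFormDeriv_family (G := G) hadm hs hw
  have hev := eventually_eigenvalue_le not_finiteDimensional_energySpace
    (hadm.mono fun t ht => ht.isCompactPair (G := G))
    (hadm.mono fun t ht => mul_pos (totalLength_pos ht) (totalMass_pos ht)) hN hD
    (eigenvalue_eq_weakEigenvalue h0 k) hY hδ hk c hη
  have hF : totalLength (g 0) * totalMass (g 0) (ρ 0) * eigenvalue G k (g 0) (ρ 0) =
      normalisedEigenvalue G k (g 0) (ρ 0) := by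
    rw [normalisedEigenvalue]; ring
  rw [hF, variationForm_eq] at hev
  filter_upwards [hev, hadm] with t ht hat hyp
  rw [normalisedEigenvalue_eq hat]
  exact ht hyp

theorem eventually_le_normalisedEigenvalue (hadm : ∀ᶠ t in 𝓝 (0 : ℝ), Admissible (g t) (ρ t))
    {s' : E → ℝ} {w' : E → C(unitInterval, ℝ)} (hs : HasDerivAt (fun t e => √(g t e)) s' 0)
    (hw : HasDerivAt (fun t => massCoeff (g t) (ρ t)) w' 0) {k : ℕ}
    {Y : Submodule ℝ (energySpace G)}
    (hY : Y ≤ weakEigenspace (gradForm G (g 0)) (massForm G (g 0) (ρ 0))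
      (eigenvalue G k (g 0) (ρ 0)))
    (hk : Module.finrank ℝ (spectralSpan (gradForm G (g 0)) (massForm G (g 0) (ρ 0))
      (eigenvalue G k (g 0) (ρ 0))) ≤ k + Module.finrank ℝ Y) (c : ℝ) {η : ℝ} (hη : 0 < η) :
    ∀ᶠ t in 𝓝 (0 : ℝ),
      (∀ y ∈ Y, c * |t| * massForm G (g 0) (ρ 0) y y ≤
        t * variationForm G (g 0) (ρ 0) (normalisedEigenvalue G k (g 0) (ρ 0)) s' w' y y) →
      normalisedEigenvalue G k (g 0) (ρ 0) + (c - η) * |t| ≤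
        normalisedEigenvalue G k (g t) (ρ t) := by
  have h0 := hadm.self_of_nhds
  obtain ⟨hN, hD⟩ := hasFormDeriv_family (G := G) hadm hs hw
  have hev := eventually_le_eigenvalue not_finiteDimensional_energySpace
    (hadm.mono fun t ht => ht.isCompactPair (G := G))
    (hadm.mono fun t ht => mul_pos (totalLength_pos ht) (totalMass_pos ht)) hN hD
    (eigenvalue_eq_weakEigenvalue h0 k) hY hk c hη
  have hF : totalLength (g 0) * totalMass (g 0) (ρ 0) * eigenvalue G k (g 0) (ρ 0) =
      normalisedEigenvalue G k (g 0) (ρ 0) := by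
    rw [normalisedEigenvalue]; ring
  rw [hF, variationForm_eq] at hev
  filter_upwards [hev, hadm] with t ht hat hyp
  rw [normalisedEigenvalue_eq hat]
  exact ht hyp

end Family

/-! ### The identities imply extremality -/

theorem exists_isLittleO_of_eventually_le {a : ℝ → ℝ}
    (h : ∀ η > 0, ∀ᶠ t in 𝓝 (0 : ℝ), a t ≤ η * |t|) :
    ∃ r : ℝ → ℝ, r =o[𝓝 0] (fun t : ℝ => t) ∧ ∀ t, a t ≤ r t := by
  refine ⟨fun t => max (a t) 0, ?_, fun t => le_max_left _ _⟩
  rw [Asymptotics.isLittleO_iff]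
  intro c hc
  filter_upwards [h c hc] with t ht
  rw [Real.norm_eq_abs, Real.norm_eq_abs, abs_of_nonneg (le_max_right _ _)]
  exact max_le ht (by positivity)

section Identities

variable {V E : Type*} [Fintype E] {G : MultiGraph V E}

theorem variationForm_apply (g : E → ℝ) (ρ : EdgeFun E ℝ) (F : ℝ) (s' : E → ℝ)
    (w' : E → C(unitInterval, ℝ)) (y : energySpace G) : variationForm G g ρ F s' w' y y =
      ∑ e, ((normDeriv g ρ s' w' * (√(g e))⁻¹ - totalLength g * totalMass g ρ * (s' e / g e)) *
        ‖edgeDeriv G e y‖ ^ 2 - F * edgeIntegral (w' e * (edgeVal G e y * edgeVal G e y))) := by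
  rw [variationForm, energyForm_apply]
  refine Finset.sum_congr rfl fun e _ => ?_
  have h1 : (-(F • w')) e * edgeVal G e y * edgeVal G e y =
      -(F • (w' e * (edgeVal G e y * edgeVal G e y))) := by
    rw [Pi.neg_apply, Pi.smul_apply, mul_assoc, neg_mul, smul_mul_assoc]
  rw [real_inner_self_eq_norm_sq, h1, map_neg, map_smul, smul_eq_mul, sub_eq_add_neg]

/-- Summed over `i`, the form becomes `normDeriv * L - L * M * ∑ s' - L² * ∑ ∫ w'`, which is zero by
the definition of `normDeriv`. Only the integrated gradient identity on each edge is needed. -/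
theorem sum_variationForm_eq_zero {g : E → ℝ} {ρ : EdgeFun E ℝ} (hgρ : Admissible g ρ) {F r : ℝ}
    {ι : Type*} [Fintype ι] {y : ι → energySpace G}
    (hF : F * r = totalLength g ^ 2)
    (hderiv : ∀ e, ∑ i, ‖edgeDeriv G e (y i)‖ ^ 2 = g e)
    (hval : ∀ e x, ∑ i, (edgeVal G e (y i) x) ^ 2 = r) (s' : E → ℝ)
    (w' : E → C(unitInterval, ℝ)) : ∑ i, variationForm G g ρ F s' w' (y i) (y i) = 0 := by
  simp only [variationForm_apply]
  rw [Finset.sum_comm]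
  have h1 : ∀ e, ∑ i, ((normDeriv g ρ s' w' * (√(g e))⁻¹ -
      totalLength g * totalMass g ρ * (s' e / g e)) * ‖edgeDeriv G e (y i)‖ ^ 2 -
      F * edgeIntegral (w' e * (edgeVal G e (y i) * edgeVal G e (y i)))) =
      normDeriv g ρ s' w' * √(g e) - totalLength g * totalMass g ρ * s' e -
        totalLength g ^ 2 * edgeIntegral (w' e) := by
    intro e
    have hg := hgρ.metric_pos e
    have h2 : ∑ i, w' e * (edgeVal G e (y i) * edgeVal G e (y i)) = r • w' e := by
      rw [← Finset.mul_sum]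
      ext x
      simp only [ContinuousMap.mul_apply, ContinuousMap.sum_apply, ContinuousMap.smul_apply,
        smul_eq_mul]
      rw [← hval e x, mul_comm]
      simp only [pow_two]
    rw [Finset.sum_sub_distrib, ← Finset.mul_sum, hderiv, ← Finset.mul_sum, ← map_sum, h2, map_smul,
      smul_eq_mul, ← mul_assoc F, hF]
    have h3 : (√(g e))⁻¹ * g e = √(g e) := by rw [inv_mul_eq_div, Real.div_sqrt]
    have h4 : s' e / g e * g e = s' e := div_mul_cancel₀ _ hg.ne'
    linear_combination normDeriv g ρ s' w' * h3 - totalLength g * totalMass g ρ * h4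
  simp only [h1, Finset.sum_sub_distrib, ← Finset.mul_sum]
  rw [normDeriv, ← totalLength]
  ring

theorem form_le_of_mem_span_singleton {H : Type*} [AddCommGroup H] [Module ℝ H]
    {A B : LinearMap.BilinForm ℝ H} {y z : H} (h : A y y ≤ B y y) (hz : z ∈ Submodule.span ℝ {y}) :
    A z z ≤ B z z := by
  obtain ⟨c, rfl⟩ := Submodule.mem_span_singleton.1 hz
  simp only [map_smul, LinearMap.smul_apply, smul_eq_mul, ← mul_assoc]
  exact mul_le_mul_of_nonneg_left h (mul_self_nonneg c)

theorem QuantumGraph.IsSmoothFamily.eventually_admissible {ε : ℝ} (hε : 0 < ε) {g : ℝ → E → ℝ}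
    {ρ : ℝ → EdgeFun E ℝ} (h : IsSmoothFamily ε g ρ) :
    ∀ᶠ t in 𝓝 (0 : ℝ), Admissible (g t) (ρ t) := by
  filter_upwards [Ioo_mem_nhds (neg_lt_zero.2 hε) hε] with t ht using h.admissible t ht

variable [Fintype V] [Nonempty E]

/-- As the values of `Q` at the `y i` sum to zero, one of them is `≤ 0` and another `≥ 0`. Whichever
side the gap is on, the sign of `t` selects which of the two vectors spans `Y`, so one and the same
inequality holds for both signs. -/
theorem isExtremal_of_satisfiesIdentities {k : ℕ} (hk : 1 ≤ k) {g₀ : E → ℝ} {ρ₀ : EdgeFun E ℝ}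
    (hgρ : Admissible g₀ ρ₀) {n : ℕ} {f : Fin n → EdgeFun E ℝ}
    (hf : ∀ i, IsEigenfunction G g₀ ρ₀ (eigenvalue G k g₀ ρ₀) (f i))
    (hid : SatisfiesIdentities G k g₀ ρ₀ f)
    (hgap : eigenvalue G (k - 1) g₀ ρ₀ < eigenvalue G k g₀ ρ₀ ∨
      eigenvalue G k g₀ ρ₀ < eigenvalue G (k + 1) g₀ ρ₀) :
    IsExtremal (normalisedEigenvalue G k) g₀ ρ₀ := by
  refine ⟨hgρ, fun ε hε g ρ hfam hg0 hρ0 => ?_⟩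
  subst hg0 hρ0
  have hpair := hgρ.isCompactPair (G := G)
  have hinf := not_finiteDimensional_energySpace (G := G)
  set lam := eigenvalue G k (g 0) (ρ 0) with hlam
  set N := gradForm G (g 0) with hN
  set D := massForm G (g 0) (ρ 0) with hD
  set L := totalLength (g 0) with hL
  set M := totalMass (g 0) (ρ 0) with hM
  have hLpos : 0 < L := totalLength_pos hgρ
  have hMpos : 0 < M := totalMass_pos hgρ
  obtain ⟨e₀⟩ := ‹Nonempty E›
  -- The value identity has a positive right-hand side, so connectedness is not needed here.
  have hlam0 : lam ≠ 0 := by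
    intro h0
    have h1 := (hid e₀ 0).2
    rw [← hlam, h0, zero_mul] at h1
    exact (div_pos hLpos hMpos).ne h1
  choose y hy using fun i => exists_toEdgeFun_eq (G := G)
    (fun e => ((hf i).smooth e).of_le (by norm_num)) (hf i).continuous
  have hyeig : ∀ i, y i ∈ weakEigenspace N D lam := fun i =>
    mem_weakEigenspace_of_isEigenfunction hgρ (by rw [hy]; exact hf i)
  have hy0 : ∀ i, y i ≠ 0 := fun i h0 => (hf i).ne_zero (by rw [← hy, h0, map_zero])
  have hval : ∀ e x, ∑ i, (edgeVal G e (y i) x) ^ 2 = L / M / lam := fun e x => by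
    rw [eq_div_iff hlam0, mul_comm, ← (hid e x).2]
    simp only [← toEdgeFun_apply, hy]
    rfl
  have hderiv : ∀ e, ∑ i, ‖edgeDeriv G e (y i)‖ ^ 2 = g 0 e := fun e => by
    have hg := hgρ.metric_pos e
    choose u hu _ using fun i => exists_edgeDeriv_of_mem_weakEigenspace hgρ (hyeig i) e
    have hdx : ∀ i, (f i).dx e = u i := fun i => by
      rw [← hy i]
      exact IsEdgeDeriv.dx_eq (f := toEdgeFun G (y i)) (hu i)
    have h1 : ∑ i, u i * u i = ContinuousMap.const _ (g 0 e) := by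
      ext x
      have h2 := (hid e x).1
      simp only [gradSq, hdx, ← Finset.sum_div] at h2
      rw [div_eq_iff hg.ne', one_mul] at h2
      simpa [pow_two] using h2
    simp only [fun i => edgeDeriv_eq_of_isEdgeDeriv (hu i), ← real_inner_self_eq_norm_sq,
      inner_toEdgeL2_toEdgeL2]
    rw [← map_sum, h1, edgeIntegral_const]
  have hn : (Finset.univ : Finset (Fin n)).Nonempty := by
    by_contra hne
    have h1 := (hid e₀ 0).1
    rw [Finset.not_nonempty_iff_eq_empty.1 hne, Finset.sum_empty] at h1
    exact zero_ne_one h1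
  have hadm := hfam.eventually_admissible hε
  obtain ⟨s', w', hs, hw⟩ := hfam.exists_hasDerivAt hε
  set F := normalisedEigenvalue G k (g 0) (ρ 0) with hF
  set Q := variationForm G (g 0) (ρ 0) F s' w' with hQ
  have hsum : ∑ i, Q (y i) (y i) = 0 := by
    refine sum_variationForm_eq_zero hgρ (r := L / M / lam) ?_ hderiv hval s' w'
    rw [hF, normalisedEigenvalue, ← hlam, ← hL, ← hM]
    field_simp
  obtain ⟨i, -, hi⟩ := Finset.exists_le_of_sum_le hn (f := fun i => Q (y i) (y i))
    (g := fun _ => 0) (by rw [hsum, Finset.sum_const_zero])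
  obtain ⟨j, -, hj⟩ := Finset.exists_le_of_sum_le hn (g := fun i => Q (y i) (y i))
    (f := fun _ => 0) (by rw [hsum, Finset.sum_const_zero])
  have hspan : ∀ i, Submodule.span ℝ {y i} ≤ weakEigenspace N D lam := fun i => by
    rw [Submodule.span_singleton_le_iff_mem]
    exact hyeig i
  have hrank : ∀ i, Module.finrank ℝ (Submodule.span ℝ {y i}) = 1 := fun i =>
    finrank_span_singleton (hy0 i)
  have hneg : ∀ z ∈ Submodule.span ℝ {y i}, Q z z ≤ 0 := fun z hz =>
    form_le_of_mem_span_singleton (B := 0) (by simpa using hi) hz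
  have hpos : ∀ z ∈ Submodule.span ℝ {y j}, 0 ≤ Q z z := fun z hz =>
    form_le_of_mem_span_singleton (A := 0) (by simpa using hj) hz
  rcases hgap with hgap | hgap
  · left
    -- Taking the gap `δ = λ_k - λ_{k-1}` gives `k` dimensions at level `λ_{k-1}`, so one
    -- eigenvector completes a trial space of dimension `k + 1`.
    have hdim : k ≤ Module.finrank ℝ
        (spectralSpan N D (lam - (lam - eigenvalue G (k - 1) (g 0) (ρ 0)))) := by
      rw [sub_sub_cancel]
      have h1 := (hpair.weakEigenvalue_le_iff hinf (k - 1) _).1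
        (eigenvalue_eq_weakEigenvalue hgρ (k - 1)).ge
      omega
    have key : ∀ η > 0, ∀ᶠ t in 𝓝 (0 : ℝ),
        normalisedEigenvalue G k (g t) (ρ t) - F ≤ η * |t| := by
      intro η hη
      filter_upwards [eventually_normalisedEigenvalue_le hadm hs hw (hspan i) (sub_pos.2 hgap)
          (by rw [hrank]; exact Nat.add_le_add_right hdim 1) 0 hη,
        eventually_normalisedEigenvalue_le hadm hs hw (hspan j) (sub_pos.2 hgap)
          (by rw [hrank]; exact Nat.add_le_add_right hdim 1) 0 hη] with t hti htj
      rw [zero_add] at hti htj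
      rcases le_total 0 t with ht | ht
      · linarith [hti fun z hz => by
          rw [zero_mul, zero_mul]
          exact mul_nonpos_of_nonneg_of_nonpos ht (hneg z hz)]
      · linarith [htj fun z hz => by
          rw [zero_mul, zero_mul]
          exact mul_nonpos_of_nonpos_of_nonneg ht (hpos z hz)]
    obtain ⟨r, hr, hle⟩ := exists_isLittleO_of_eventually_le key
    exact ⟨r, hr, Eventually.of_forall fun t => by linarith [hle t]⟩
  · right
    -- The gap above `λ_k` bounds the spectral span, so a line `Y` leaves at most `k` constraints.
    have hdim : Module.finrank ℝ (spectralSpan N D lam) ≤ k + 1 := by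
      by_contra! hlt
      have h1 := (hpair.weakEigenvalue_le_iff hinf (k + 1) lam).2 (by omega)
      rw [← eigenvalue_eq_weakEigenvalue hgρ] at h1
      exact absurd h1 (not_le.2 hgap)
    have key : ∀ η > 0, ∀ᶠ t in 𝓝 (0 : ℝ),
        F - normalisedEigenvalue G k (g t) (ρ t) ≤ η * |t| := by
      intro η hη
      filter_upwards [eventually_le_normalisedEigenvalue hadm hs hw (hspan i)
          (by rw [hrank]; exact hdim) 0 hη,
        eventually_le_normalisedEigenvalue hadm hs hw (hspan j)
          (by rw [hrank]; exact hdim) 0 hη] with t hti htj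
      rw [zero_sub, neg_mul] at hti htj
      rcases le_total 0 t with ht | ht
      · linarith [htj fun z hz => by
          rw [zero_mul, zero_mul]
          exact mul_nonneg ht (hpos z hz)]
      · linarith [hti fun z hz => by
          rw [zero_mul, zero_mul]
          exact mul_nonneg_of_nonpos_of_nonpos ht (hneg z hz)]
    obtain ⟨r, hr, hle⟩ := exists_isLittleO_of_eventually_le key
    refine ⟨fun t => -r t, hr.neg_left, Eventually.of_forall fun t => by linarith [hle t]⟩

end Identities

/-! ### A theorem of the alternative for quadratic forms -/

section Alternative

/-- By Carathéodory the hull is the image of a fixed simplex times a power of `K`; shorter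
combinations are padded with weight zero at `z₀`. -/
theorem IsCompact.convexHull_of_finiteDimensional {F : Type*} [NormedAddCommGroup F]
    [NormedSpace ℝ F] [FiniteDimensional ℝ F] {K : Set F} (hK : IsCompact K) :
    IsCompact (convexHull ℝ K) := by
  rcases K.eq_empty_or_nonempty with rfl | ⟨z₀, hz₀⟩
  · simp
  set n := Module.finrank ℝ F + 1
  have himg : convexHull ℝ K = (fun p : (Fin n → ℝ) × (Fin n → F) => ∑ i, p.1 i • p.2 i) ''
      (stdSimplex ℝ (Fin n) ×ˢ Set.univ.pi fun _ => K) := by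
    ext x
    constructor
    · intro hx
      obtain ⟨ι, hι, z, w, hz, hind, hw, hw1, hwz⟩ := eq_pos_convex_span_of_mem_convexHull hx
      have hcard : Fintype.card ι ≤ n := hind.card_le_finrank_succ.trans
        (Nat.add_le_add_right (Submodule.finrank_le _) 1)
      let σ : ι → Fin n := fun i => Fin.castLE hcard (Fintype.equivFin ι i)
      have hσ : Function.Injective σ :=
        (Fin.castLE_injective hcard).comp (Fintype.equivFin ι).injective
      have hout : ∀ j, j ∉ Set.range σ → Function.extend σ w 0 j = 0 := fun j hj =>
        Function.extend_apply' _ _ _ hj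
      refine ⟨(Function.extend σ w 0, Function.extend σ z fun _ => z₀),
        ⟨⟨fun j => ?_, ?_⟩, fun j _ => ?_⟩, ?_⟩
      · by_cases hj : j ∈ Set.range σ
        · obtain ⟨i, rfl⟩ := hj
          simp only [hσ.extend_apply]
          exact (hw i).le
        · exact (hout j hj).ge
      · rw [← hw1]
        exact (Fintype.sum_of_injective σ hσ _ _ hout fun i => (hσ.extend_apply _ _ i).symm).symm
      · by_cases hj : j ∈ Set.range σ
        · obtain ⟨i, rfl⟩ := hj
          simp only [hσ.extend_apply]
          exact hz ⟨i, rfl⟩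
        · simp only [Function.extend_apply' _ _ _ hj]
          exact hz₀
      · rw [← hwz]
        refine (Fintype.sum_of_injective σ hσ _ _ (fun j hj => ?_) fun i => ?_).symm
        · simp only [hout j hj, zero_smul]
        · simp only [hσ.extend_apply]
    · rintro ⟨⟨w, z⟩, ⟨hw, hz⟩, rfl⟩
      exact (convex_convexHull ℝ K).sum_mem (fun i _ => hw.1 i) hw.2
        fun i _ => subset_convexHull ℝ K (hz i trivial)
  rw [himg]
  exact ((isCompact_stdSimplex ℝ _).prod (isCompact_univ_pi fun _ => hK)).image (by fun_prop)

variable {Y : Type*} [NormedAddCommGroup Y] [NormedSpace ℝ Y] [FiniteDimensional ℝ Y]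

theorem continuous_bilinForm_self (B : LinearMap.BilinForm ℝ Y) : Continuous fun y => B y y := by
  have h1 : Continuous fun y => LinearMap.toContinuousLinearMap (B y) :=
    ((LinearMap.toContinuousLinearMap (𝕜 := ℝ) (E := Y) (F' := ℝ)).toLinearMap.comp
      B).continuous_of_finiteDimensional
  exact h1.clm_apply continuous_id

theorem bilinForm_self_eq_norm_sq_mul (B : LinearMap.BilinForm ℝ Y) {y : Y} (hy : y ≠ 0) :
    B y y = ‖y‖ ^ 2 * B (‖y‖⁻¹ • y) (‖y‖⁻¹ • y) := by
  have h : ‖y‖ ≠ 0 := norm_ne_zero_iff.2 hy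
  simp only [map_smul, LinearMap.smul_apply, smul_eq_mul]
  field_simp

theorem norm_inv_smul_mem_sphere {y : Y} (hy : y ≠ 0) :
    ‖y‖⁻¹ • y ∈ Metric.sphere (0 : Y) 1 := by
  rw [mem_sphere_zero_iff_norm, norm_smul, norm_inv, norm_norm,
    inv_mul_cancel₀ (norm_ne_zero_iff.2 hy)]

theorem exists_pos_mul_le_bilinForm {A : LinearMap.BilinForm ℝ Y} (hA : ∀ y, y ≠ 0 → 0 < A y y)
    (B : LinearMap.BilinForm ℝ Y) : ∃ c > 0, ∀ y, c * B y y ≤ A y y := by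
  have : ProperSpace Y := FiniteDimensional.proper_real Y
  have hS : IsCompact (Metric.sphere (0 : Y) 1) := isCompact_sphere _ _
  rcases (Metric.sphere (0 : Y) 1).eq_empty_or_nonempty with hemp | hne
  · refine ⟨1, one_pos, fun y => ?_⟩
    by_cases hy : y = 0
    · simp [hy]
    · exact absurd (norm_inv_smul_mem_sphere hy) (by rw [hemp]; exact Set.notMem_empty _)
  obtain ⟨s, hs, hmin⟩ := hS.exists_isMinOn hne (continuous_bilinForm_self A).continuousOn
  obtain ⟨b, hb⟩ := hS.exists_bound_of_continuousOn (continuous_bilinForm_self B).continuousOn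
  have hs0 : s ≠ 0 := ne_zero_of_mem_unit_sphere ⟨s, hs⟩
  have ha := hA s hs0
  have hb0 : 0 ≤ b := (norm_nonneg _).trans (hb s hs)
  refine ⟨A s s / (b + 1), by positivity, fun y => ?_⟩
  by_cases hy : y = 0
  · simp [hy]
  rw [bilinForm_self_eq_norm_sq_mul A hy, bilinForm_self_eq_norm_sq_mul B hy, mul_left_comm]
  refine mul_le_mul_of_nonneg_left ?_ (sq_nonneg _)
  have hmem := norm_inv_smul_mem_sphere hy
  refine le_trans ?_ (hmin hmem)
  rw [div_mul_eq_mul_div, div_le_iff₀ (by linarith)]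
  exact mul_le_mul_of_nonneg_left (by linarith [(abs_le.1 (hb _ hmem)).2]) ha.le

/-- If no form in a linear family is positive definite, then finitely many nonzero vectors
annihilate the family. -/
theorem exists_posDef_or_exists_sum_eq_zero {X : Type*} [AddCommGroup X] [Module ℝ X]
    (T : X →ₗ[ℝ] LinearMap.BilinForm ℝ Y) : (∃ x, ∀ y, y ≠ 0 → 0 < T x y y) ∨
      ∃ (n : ℕ) (y : Fin n → Y), 0 < n ∧ (∀ i, y i ≠ 0) ∧ ∀ x, ∑ i, T x (y i) (y i) = 0 := by
  have : ProperSpace Y := FiniteDimensional.proper_real Y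
  -- `X` may be infinite-dimensional, but its forms lie in a finite-dimensional space of matrices. A
  -- basis of the range gives coordinates `q` in which every `T x` is a linear functional of `q y`.
  let ι := LinearMap.BilinForm.toMatrix (Module.finBasis ℝ Y)
  let R := LinearMap.range (ι.toLinearMap.comp T)
  let b := Module.finBasis ℝ R
  let B : Fin (Module.finrank ℝ R) → LinearMap.BilinForm ℝ Y := fun j => ι.symm (b j)
  have hB : ∀ v : R, ι.symm v = ∑ j, b.repr v j • B j := fun v => by
    simp only [B, ← map_smul, ← map_sum]
    congr 1
    conv_lhs => rw [← b.sum_repr v]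
    simp only [Submodule.coe_sum, Submodule.coe_smul]
  let q : Y → (Fin (Module.finrank ℝ R) → ℝ) := fun y j => B j y y
  have hq : Continuous q := continuous_pi fun j => continuous_bilinForm_self _
  have hK : IsCompact (convexHull ℝ (q '' Metric.sphere (0 : Y) 1)) :=
    ((isCompact_sphere (0 : Y) 1).image hq).convexHull_of_finiteDimensional
  by_cases h0 : 0 ∈ convexHull ℝ (q '' Metric.sphere (0 : Y) 1)
  · right
    obtain ⟨κ, hκ, z, w, hz, -, hw, hw1, hwz⟩ := eq_pos_convex_span_of_mem_convexHull h0
    choose s hs hsz using fun i => hz ⟨i, rfl⟩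
    have hpos : 0 < Fintype.card κ := by
      rw [Fintype.card_pos_iff]
      by_contra hemp
      rw [not_nonempty_iff] at hemp
      rw [Finset.univ_eq_empty, Finset.sum_empty] at hw1
      exact zero_ne_one hw1
    let σ := Fintype.equivFin κ
    -- The forms are quadratic, so convex weights are absorbed as square roots into the vectors.
    refine ⟨Fintype.card κ, fun i => √(w (σ.symm i)) • s (σ.symm i), hpos, fun i => ?_, fun x => ?_⟩
    · exact smul_ne_zero (Real.sqrt_pos.2 (hw _)).ne' (ne_zero_of_mem_unit_sphere ⟨_, hs _⟩)
    · rw [σ.symm.sum_comp (fun i => T x (√(w i) • s i) (√(w i) • s i))]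
      have h1 : ∀ C : LinearMap.BilinForm ℝ Y,
          ∑ i, C (√(w i) • s i) (√(w i) • s i) = ∑ i, w i * C (s i) (s i) := fun C => by
        refine Finset.sum_congr rfl fun i _ => ?_
        simp only [map_smul, LinearMap.smul_apply, smul_eq_mul]
        rw [← mul_assoc, Real.mul_self_sqrt (hw i).le]
      have h2 : ∀ j, ∑ i, w i * B j (s i) (s i) = 0 := fun j => by
        have h3 := congrFun hwz j
        simp only [Finset.sum_apply, Pi.smul_apply, smul_eq_mul, Pi.zero_apply, ← hsz] at h3
        exact h3
      have h4 : T x = ∑ j, b.repr ⟨ι (T x), LinearMap.mem_range_self _ x⟩ j • B j := by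
        rw [← hB]
        exact (ι.symm_apply_apply _).symm
      rw [h1, h4]
      simp only [LinearMap.sum_apply, LinearMap.smul_apply, smul_eq_mul, Finset.mul_sum]
      rw [Finset.sum_comm]
      refine Finset.sum_eq_zero fun j _ => ?_
      simp only [mul_left_comm (w _), ← Finset.mul_sum, h2, mul_zero]
  · left
    obtain ⟨f, u, hf0, hfu⟩ :=
      geometric_hahn_banach_point_closed (convex_convexHull ℝ _) hK.isClosed h0
    rw [map_zero] at hf0
    -- The separating functional is itself given by a member of the family, and its positivity on
    -- the unit sphere is definiteness.
    obtain ⟨x, hx⟩ := (∑ j, f (Pi.single j 1) • b j).2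
    refine ⟨x, fun y hy => ?_⟩
    have hT : T x = ∑ j, f (Pi.single j 1) • B j := by
      have h1 := congrArg ι.symm hx
      simp only [LinearMap.comp_apply, LinearEquiv.coe_coe, LinearEquiv.symm_apply_apply] at h1
      rw [h1]
      simp [B]
    have hq1 : ∀ s, T x s s = f (q s) := fun s => by
      have h1 : q s = ∑ j, q s j • Pi.single j (1 : ℝ) := by
        funext i
        simp [Pi.single_apply]
      rw [h1, hT, map_sum]
      simp only [LinearMap.sum_apply, LinearMap.smul_apply, smul_eq_mul, map_smul, q]
      exact Finset.sum_congr rfl fun j _ => mul_comm _ _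
    rw [bilinForm_self_eq_norm_sq_mul _ hy, hq1]
    refine mul_pos (pow_pos (norm_pos_iff.2 hy) 2) (hf0.trans (hfu _ (subset_convexHull ℝ _ ?_)))
    exact Set.mem_image_of_mem _ (norm_inv_smul_mem_sphere hy)

end Alternative

/-! ### Exponential families -/

section Exponential

variable {V E : Type*} [Fintype E] {G : MultiGraph V E}

/-- The metrics `g_e e^{2 t α_e}`. -/
noncomputable def expMetric (g : E → ℝ) (α : E → ℝ) (t : ℝ) (e : E) : ℝ :=
  g e * Real.exp (2 * t * α e)

/-- The densities `ρ_e e^{t (P_e - α_e)}`. -/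
noncomputable def expDensity (ρ : EdgeFun E ℝ) (α : E → ℝ) (P : E → Polynomial ℝ) (t : ℝ) :
    EdgeFun E ℝ :=
  fun e x => ρ e x * Real.exp (t * ((P e).eval (x : ℝ) - α e))

variable {g : E → ℝ} {ρ : EdgeFun E ℝ}

theorem isSmoothFamily_exp (h : Admissible g ρ) (α : E → ℝ) (P : E → Polynomial ℝ) :
    IsSmoothFamily 1 (expMetric g α) (expDensity ρ α P) := by
  have hsmooth : ∀ e, ContDiffOn ℝ ∞ (fun p : ℝ × ℝ => (expDensity ρ α P p.1).onEdge e p.2)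
      (Set.univ ×ˢ Set.Icc 0 1) := fun e => by
    have h1 : ContDiffOn ℝ ∞ (fun p : ℝ × ℝ => ρ.onEdge e p.2) (Set.univ ×ˢ Set.Icc 0 1) :=
      (h.density_smooth e).comp contDiff_snd.contDiffOn fun p hp => hp.2
    have h2 : ContDiff ℝ ∞ (fun p : ℝ × ℝ => Real.exp (p.1 * ((P e).eval p.2 - α e))) :=
      (contDiff_fst.mul (((contDiff_polynomial_eval (P e) ∞).comp contDiff_snd).sub
        contDiff_const)).exp
    refine (h1.mul h2.contDiffOn).congr fun p hp => ?_
    simp only [EdgeFun.onEdge]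
    rw [Set.IccExtend_of_mem _ _ hp.2, Set.IccExtend_of_mem _ _ hp.2]
    rfl
  refine ⟨fun t _ => ⟨fun e => mul_pos (h.metric_pos e) (Real.exp_pos _),
    fun e x => mul_pos (h.density_pos e x) (Real.exp_pos _), fun e => ?_⟩, fun e => ?_, fun e => ?_⟩
  · exact (hsmooth e).comp (f := fun x : ℝ => (t, x)) (by fun_prop) fun x hx => ⟨trivial, hx⟩
  · have h1 : ContDiff ℝ ∞ fun t => expMetric g α t e := by
      unfold expMetric
      fun_prop
    exact h1.contDiffOn
  · exact (hsmooth e).mono (Set.prod_mono (Set.subset_univ _) le_rfl)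

theorem expMetric_zero (α : E → ℝ) : expMetric g α 0 = g := by
  funext e
  simp [expMetric]

theorem expDensity_zero (α : E → ℝ) (P : E → Polynomial ℝ) : expDensity ρ α P 0 = ρ := by
  funext e x
  simp [expDensity]

/-- The coefficients evolve as `√g e^{tα}` and `√g ρ e^{tP}`: the `-α` in the exponent of the
density cancels the growth of the length, so the two directions are independent. -/
theorem hasDerivAt_expFamily (h : Admissible g ρ) (α : E → ℝ) (P : E → Polynomial ℝ) :
    HasDerivAt (fun t e => √(expMetric g α t e)) (fun e => √(g e) * α e) 0 ∧
      HasDerivAt (fun t => massCoeff (expMetric g α t) (expDensity ρ α P t))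
        (fun e => (P e).toContinuousMapOn _ * massCoeff g ρ e) 0 := by
  have hfam := isSmoothFamily_exp h α P
  obtain ⟨s', w', hs, hw⟩ := hfam.exists_hasDerivAt one_pos
  have hsq : ∀ t e, √(expMetric g α t e) = √(g e) * Real.exp (t * α e) := fun t e => by
    rw [expMetric, Real.sqrt_mul (h.metric_pos e).le, mul_assoc, two_mul, Real.exp_add,
      Real.sqrt_mul_self (Real.exp_pos _).le]
  have hexp : ∀ a c : ℝ, HasDerivAt (fun t : ℝ => c * Real.exp (t * a)) (c * a) 0 := fun a c => by
    have h1 := (((hasDerivAt_id (0 : ℝ)).mul_const a).exp).const_mul c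
    simpa using h1
  have hs' : s' = fun e => √(g e) * α e := by
    funext e
    have h1 := hasDerivAt_pi.1 hs e
    simp only [hsq] at h1
    exact h1.unique (hexp _ _)
  have hw' : w' = fun e => (P e).toContinuousMapOn _ * massCoeff g ρ e := by
    funext e
    ext x
    have h1 := (ContinuousMap.evalCLM ℝ x).hasFDerivAt.comp_hasDerivAt 0 (hasDerivAt_pi.1 hw e)
    have h2 : (fun t => √(g e) * ρ e x * Real.exp (t * (P e).eval (x : ℝ))) =ᶠ[𝓝 0]
        (ContinuousMap.evalCLM ℝ x) ∘
          fun t => massCoeff (expMetric g α t) (expDensity ρ α P t) e := by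
      filter_upwards [hfam.eventually_admissible one_pos] with t ht
      rw [Function.comp_apply, ContinuousMap.evalCLM_apply, massCoeff_apply ht, hsq, expDensity,
        mul_mul_mul_comm, ← Real.exp_add]
      congr 2
      ring
    have h3 := (h1.congr_of_eventuallyEq h2).unique (hexp _ _)
    rw [ContinuousMap.evalCLM_apply] at h3
    rw [h3, ContinuousMap.mul_apply, massCoeff_apply h]
    simp [mul_comm]
  exact ⟨hs' ▸ hs, hw' ▸ hw⟩

end Exponential

/-! ### First-order conditions at an extremal pair -/

section FirstOrder

variable {V E : Type*} [Fintype E] {G : MultiGraph V E}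

theorem normDeriv_add (g : E → ℝ) (ρ : EdgeFun E ℝ) (s₁ s₂ : E → ℝ)
    (w₁ w₂ : E → C(unitInterval, ℝ)) :
    normDeriv g ρ (s₁ + s₂) (w₁ + w₂) = normDeriv g ρ s₁ w₁ + normDeriv g ρ s₂ w₂ := by
  simp only [normDeriv, Pi.add_apply, map_add, Finset.sum_add_distrib]
  ring

theorem normDeriv_smul (g : E → ℝ) (ρ : EdgeFun E ℝ) (c : ℝ) (s : E → ℝ)
    (w : E → C(unitInterval, ℝ)) : normDeriv g ρ (c • s) (c • w) = c * normDeriv g ρ s w := by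
  simp only [normDeriv, Pi.smul_apply, map_smul, smul_eq_mul, ← Finset.mul_sum]
  ring

/-- The first variation of the normalised eigenvalue along the exponential families, as a family
of quadratic forms on the energy space. -/
noncomputable def expVariation (G : MultiGraph V E) (g : E → ℝ) (ρ : EdgeFun E ℝ) (F : ℝ) :
    ((E → ℝ) × (E → Polynomial ℝ)) →ₗ[ℝ] LinearMap.BilinForm ℝ (energySpace G) where
  toFun x := variationForm G g ρ F (fun e => √(g e) * x.1 e)
    (fun e => (x.2 e).toContinuousMapOn unitInterval * massCoeff g ρ e)
  map_add' x y := by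
    have h1 : (fun e => √(g e) * (x + y).1 e) =
        (fun e => √(g e) * x.1 e) + fun e => √(g e) * y.1 e := by
      funext e
      simp [mul_add]
    have h2 : (fun e => ((x + y).2 e).toContinuousMapOn unitInterval * massCoeff g ρ e) =
        (fun e => (x.2 e).toContinuousMapOn unitInterval * massCoeff g ρ e) +
          fun e => (y.2 e).toContinuousMapOn unitInterval * massCoeff g ρ e := by
      funext e
      ext x
      simp [add_mul]
    rw [h1, h2, variationForm, variationForm, variationForm, ← map_add, normDeriv_add]
    congr 1
    refine Prod.ext (funext fun e => ?_) ?_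
    · simp only [Prod.fst_add, Pi.add_apply]
      ring
    · rw [Prod.snd_add, smul_add, neg_add]
  map_smul' c x := by
    have h1 : (fun e => √(g e) * (c • x).1 e) = c • fun e => √(g e) * x.1 e := by
      funext e
      simp [mul_left_comm]
    have h2 : (fun e => ((c • x).2 e).toContinuousMapOn unitInterval * massCoeff g ρ e) =
        c • fun e => (x.2 e).toContinuousMapOn unitInterval * massCoeff g ρ e := by
      funext e
      ext x
      simp [mul_assoc]
    rw [h1, h2, variationForm, variationForm, RingHom.id_apply, ← map_smul, normDeriv_smul]
    congr 1
    refine Prod.ext (funext fun e => ?_) ?_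
    · simp only [Prod.smul_fst, Pi.smul_apply, smul_eq_mul]
      ring
    · rw [Prod.smul_snd, smul_comm, smul_neg]

theorem not_isLittleO_of_linear_growth {a : ℝ → ℝ} {c : ℝ} (hc : 0 < c)
    (hpos : ∀ᶠ t in 𝓝 (0 : ℝ), 0 < t → c * t ≤ a t) :
    ¬ ∃ r : ℝ → ℝ, r =o[𝓝 0] (fun t : ℝ => t) ∧ ∀ᶠ t in 𝓝 0, a t ≤ r t := by
  rintro ⟨r, hr, hle⟩
  rw [Asymptotics.isLittleO_iff] at hr
  have h1 := (hpos.and (hle.and (hr (half_pos hc)))).filter_mono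
    (nhdsWithin_le_nhds (s := Set.Ioi (0 : ℝ)))
  obtain ⟨t, ⟨h2, h3, h4⟩, ht⟩ := (h1.and self_mem_nhdsWithin).exists
  have ht : 0 < t := ht
  rw [Real.norm_eq_abs, Real.norm_eq_abs, abs_of_pos ht] at h4
  nlinarith [h2 ht, le_abs_self (r t), mul_pos hc ht]

variable [Fintype V] [Nonempty E]

/-- With no other eigenvalue within `δ` of `λ_k`, the span at `λ_k` is the span at `λ_k - δ`, of
dimension at most `k`, joined with the eigenspace. Hence the whole eigenspace may serve as `Y` in
both first-order bounds. -/
theorem exists_eigenspace_dimensions {g : E → ℝ} {ρ : EdgeFun E ℝ} (h : Admissible g ρ) (k : ℕ) :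
    ∃ δ > 0,
      k + 1 ≤ Module.finrank ℝ (spectralSpan (gradForm G g) (massForm G g ρ)
        (eigenvalue G k g ρ - δ)) + Module.finrank ℝ
          (weakEigenspace (gradForm G g) (massForm G g ρ) (eigenvalue G k g ρ)) ∧
      Module.finrank ℝ (spectralSpan (gradForm G g) (massForm G g ρ) (eigenvalue G k g ρ)) ≤
        k + Module.finrank ℝ
          (weakEigenspace (gradForm G g) (massForm G g ρ) (eigenvalue G k g ρ)) := by
  have hpair := h.isCompactPair (G := G)
  have hinf := not_finiteDimensional_energySpace (G := G)
  rw [eigenvalue_eq_weakEigenvalue h]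
  set N := gradForm G g
  set D := massForm G g ρ
  set Λ := weakEigenvalue N D k with hΛ
  obtain ⟨δ, hδ, hgap⟩ := hpair.exists_gap Λ
  have := fun Λ => hpair.finiteDimensional_spectralSpan Λ
  have hfin : FiniteDimensional ℝ (weakEigenspace N D Λ) :=
    Submodule.finiteDimensional_of_le (weakEigenspace_le_spectralSpan le_rfl)
  have hsup : spectralSpan N D Λ ≤ spectralSpan N D (Λ - δ) ⊔ weakEigenspace N D Λ := by
    refine iSup_le fun μ => ?_
    have hμ : (μ : ℝ) ≤ Λ := μ.2
    by_cases h1 : (μ : ℝ) ≤ Λ - δ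
    · exact (weakEigenspace_le_spectralSpan h1).trans le_sup_left
    by_cases h2 : weakEigenspace N D (μ : ℝ) = ⊥
    · rw [h2]
      exact bot_le
    · rw [hgap μ (abs_le.2 ⟨by linarith, by linarith⟩) h2]
      exact le_sup_right
  have h1 : Module.finrank ℝ (spectralSpan N D Λ) ≤
      Module.finrank ℝ (spectralSpan N D (Λ - δ)) + Module.finrank ℝ (weakEigenspace N D Λ) :=
    (Submodule.finrank_mono hsup).trans (Submodule.finrank_add_le_finrank_add_finrank _ _)
  have h2 : k + 1 ≤ Module.finrank ℝ (spectralSpan N D Λ) :=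
    (hpair.weakEigenvalue_le_iff hinf k Λ).1 le_rfl
  have h3 : Module.finrank ℝ (spectralSpan N D (Λ - δ)) ≤ k := by
    by_contra! hlt
    have h4 := (hpair.weakEigenvalue_le_iff hinf k (Λ - δ)).2 hlt
    linarith
  exact ⟨δ, hδ, by omega, by omega⟩

/-- A direction with positive definite variation would violate both alternatives of extremality. The
family is linear, so negative definite directions are covered by a change of sign. -/
theorem exists_sum_expVariation_eq_zero {k : ℕ} {g : E → ℝ} {ρ : EdgeFun E ℝ}
    (hext : IsExtremal (normalisedEigenvalue G k) g ρ) :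
    ∃ (n : ℕ) (y : Fin n → energySpace G), 0 < n ∧ (∀ i, y i ≠ 0) ∧
      (∀ i, y i ∈ weakEigenspace (gradForm G g) (massForm G g ρ) (eigenvalue G k g ρ)) ∧
      ∀ x, ∑ i, expVariation G g ρ (normalisedEigenvalue G k g ρ) x (y i) (y i) = 0 := by
  obtain ⟨hgρ, hext⟩ := hext
  have hpair := hgρ.isCompactPair (G := G)
  set F := normalisedEigenvalue G k g ρ with hF
  set Y := weakEigenspace (gradForm G g) (massForm G g ρ) (eigenvalue G k g ρ) with hY
  have := hpair.finiteDimensional_spectralSpan (eigenvalue G k g ρ)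
  have hfin : FiniteDimensional ℝ Y :=
    Submodule.finiteDimensional_of_le (weakEigenspace_le_spectralSpan le_rfl)
  let T : ((E → ℝ) × (E → Polynomial ℝ)) →ₗ[ℝ] LinearMap.BilinForm ℝ Y :=
    { toFun := fun x => (expVariation G g ρ F x).restrict Y
      map_add' := fun x y => by
        rw [map_add]
        rfl
      map_smul' := fun c x => by
        rw [map_smul]
        rfl }
  rcases exists_posDef_or_exists_sum_eq_zero (Y := Y) T with ⟨⟨α, P⟩, hpos⟩ | ⟨n, y, hn, hy, hsum⟩
  · exfalso
    obtain ⟨c, hc, hle⟩ := exists_pos_mul_le_bilinForm hpos ((massForm G g ρ).restrict Y)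
    obtain ⟨δ, hδ, hdim₁, hdim₂⟩ := exists_eigenspace_dimensions (G := G) hgρ k
    have hfam := isSmoothFamily_exp hgρ α P
    have h0 : expMetric g α 0 = g := expMetric_zero α
    have h0' : expDensity ρ α P 0 = ρ := expDensity_zero α P
    have hadm := hfam.eventually_admissible one_pos
    obtain ⟨hs, hw⟩ := hasDerivAt_expFamily hgρ α P
    have hform : ∀ y ∈ Y, c * massForm G g ρ y y ≤ expVariation G g ρ F (α, P) y y :=
      fun y hy => hle ⟨y, hy⟩
    -- Used for `t < 0`, where definiteness reads `t Q ≤ -c |t| D`; half of `c` is sacrificed to the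
    -- error. The lower bound plays the same role for `t > 0`.
    have hup := eventually_normalisedEigenvalue_le (G := G) (k := k) (Y := Y) hadm hs hw
      (by rw [h0, h0']) hδ (by rw [h0, h0']; exact hdim₁) (-c) (half_pos hc)
    have hlow := eventually_le_normalisedEigenvalue (G := G) (k := k) (Y := Y) hadm hs hw
      (by rw [h0, h0']) (by rw [h0, h0']; exact hdim₂) c (half_pos hc)
    rw [h0, h0', ← hF] at hup hlow
    have hgrow : ∀ᶠ t in 𝓝 (0 : ℝ), 0 < t →
        c / 2 * t ≤ normalisedEigenvalue G k (expMetric g α t) (expDensity ρ α P t) - F := by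
      filter_upwards [hlow] with t ht htpos
      have h1 := ht fun y hy => by
        rw [abs_of_pos htpos, mul_comm c, mul_assoc]
        exact mul_le_mul_of_nonneg_left (hform y hy) htpos.le
      rw [abs_of_pos htpos] at h1
      linarith
    have hdecay : ∀ᶠ t in 𝓝 (0 : ℝ), t < 0 →
        normalisedEigenvalue G k (expMetric g α t) (expDensity ρ α P t) - F ≤ c / 2 * t := by
      filter_upwards [hup] with t ht htneg
      have h1 := ht fun y hy => by
        rw [abs_of_neg htneg, neg_mul_neg, mul_comm c, mul_assoc]
        exact mul_le_mul_of_nonpos_left (hform y hy) htneg.le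
      rw [abs_of_neg htneg] at h1
      linarith
    rcases hext 1 one_pos _ _ hfam h0 h0' with ⟨r, hr, hle⟩ | ⟨r, hr, hle⟩
    · exact not_isLittleO_of_linear_growth (half_pos hc) hgrow
        ⟨r, hr, hle.mono fun t ht => by linarith⟩
    -- The second alternative is refuted by the decay for `t < 0`, reflected to positive times.
    · have hneg : Tendsto (fun t : ℝ => -t) (𝓝 0) (𝓝 0) := by
        simpa using (continuous_neg (G := ℝ)).tendsto 0
      refine not_isLittleO_of_linear_growth (half_pos hc) (a := fun t =>
        F - normalisedEigenvalue G k (expMetric g α (-t)) (expDensity ρ α P (-t)))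
        ((hneg.eventually hdecay).mono fun t ht htpos => ?_) ⟨fun t => -r (-t), ?_, ?_⟩
      · linarith [ht (by linarith)]
      · have h1 := (hr.comp_tendsto hneg).neg_left
        exact h1.trans_isBigO (Asymptotics.isBigO_of_le _ fun t => by simp)
      · exact (hneg.eventually hle).mono fun t ht => by linarith
  · exact ⟨n, fun i => y i, hn, fun i h => hy i (Subtype.ext h), fun i => (y i).2, hsum⟩

end FirstOrder

/-! ### The identities at an extremal pair -/

/-- By Weierstrass approximation `ψ` itself is admitted as a multiplier, whence `∫ ψ² = 0`. -/
theorem eq_zero_of_edgeIntegral_polynomial {ψ : C(unitInterval, ℝ)}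
    (h : ∀ P : Polynomial ℝ, edgeIntegral (P.toContinuousMapOn unitInterval * ψ) = 0) : ψ = 0 := by
  have hclosed : IsClosed {φ : C(unitInterval, ℝ) | edgeIntegral (φ * ψ) = 0} :=
    isClosed_singleton.preimage (edgeIntegralCLM.continuous.comp (continuous_mul_const ψ))
  have hmem : ψ ∈ closure (polynomialFunctions unitInterval : Set C(unitInterval, ℝ)) := by
    have h1 := polynomialFunctions_closure_eq_top (0 : ℝ) 1
    have h2 : ψ ∈ (polynomialFunctions (Set.Icc (0 : ℝ) 1)).topologicalClosure := by
      rw [h1]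
      trivial
    exact h2
  have hsub : (polynomialFunctions unitInterval : Set C(unitInterval, ℝ)) ⊆
      {φ : C(unitInterval, ℝ) | edgeIntegral (φ * ψ) = 0} := by
    intro φ hφ
    rw [polynomialFunctions_coe] at hφ
    obtain ⟨P, rfl⟩ := hφ
    exact h P
  have h0 : edgeIntegral (ψ * ψ) = 0 := closure_minimal hsub hclosed hmem
  by_contra hne
  obtain ⟨x, hx⟩ : ∃ x, ψ x ≠ 0 := by
    by_contra! hall
    exact hne (ContinuousMap.ext hall)
  exact (edgeIntegral_pos (φ := ψ * ψ) (fun y => mul_self_nonneg _) (x := x)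
    (mul_self_pos.2 hx)).ne' h0

section Identities

variable {V E : Type*} [Fintype E] {G : MultiGraph V E}

theorem sum_variationForm (g : E → ℝ) (ρ : EdgeFun E ℝ) (F : ℝ) (s' : E → ℝ)
    (w' : E → C(unitInterval, ℝ)) {ι : Type*} [Fintype ι] (y : ι → energySpace G) :
    ∑ i, variationForm G g ρ F s' w' (y i) (y i) =
      normDeriv g ρ s' w' * ∑ i, gradForm G g (y i) (y i) -
        totalLength g * totalMass g ρ * ∑ e, s' e / g e * ∑ i, ‖edgeDeriv G e (y i)‖ ^ 2 -
        F * ∑ e, edgeIntegral (w' e * ∑ i, edgeVal G e (y i) * edgeVal G e (y i)) := by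
  simp only [variationForm_apply, gradForm_apply, real_inner_self_eq_norm_sq, sub_mul,
    Finset.sum_sub_distrib, Finset.mul_sum, map_sum, mul_assoc]
  congr 1
  · congr 1
    exact Finset.sum_comm
  · exact Finset.sum_comm

/-- Zero energy means constant on each edge, and connectedness propagates one constant over the
graph. This is what makes `λ_1` positive. -/
theorem finrank_spectralSpan_zero_le (hG : G.Connected) [Nonempty E] {g : E → ℝ} {ρ : EdgeFun E ℝ}
    (h : Admissible g ρ) :
    Module.finrank ℝ (spectralSpan (gradForm G g) (massForm G g ρ) 0) ≤ 1 := by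
  have hpair := h.isCompactPair (G := G)
  have := hpair.finiteDimensional_spectralSpan 0
  obtain ⟨e₀⟩ := ‹Nonempty E›
  have hzero : ∀ f ∈ spectralSpan (gradForm G g) (massForm G g ρ) 0,
      edgeVal G e₀ f 0 = 0 → f = 0 := by
    intro f hf hf0
    have h1 := hpair.form_le_of_mem_spectralSpan hf
    rw [zero_mul, gradForm_apply] at h1
    have hterm : ∀ e, 0 ≤ (√(g e))⁻¹ * inner ℝ (edgeDeriv G e f) (edgeDeriv G e f) := fun e =>
      mul_nonneg (inv_nonneg.2 (Real.sqrt_nonneg _)) real_inner_self_nonneg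
    have hder : ∀ e, edgeDeriv G e f = 0 := fun e => by
      have h2 := (Finset.sum_eq_zero_iff_of_nonneg fun e _ => hterm e).1
        (le_antisymm h1 (Finset.sum_nonneg fun e _ => hterm e)) e (Finset.mem_univ e)
      rcases mul_eq_zero.1 h2 with h3 | h3
      · exact absurd h3 (inv_ne_zero (Real.sqrt_pos.2 (h.metric_pos e)).ne')
      · exact inner_self_eq_zero.1 h3
    have hval : ∀ e x, edgeVal G e f x = edgeVal G e f 0 := fun e x => by
      have h0 : primitive (0 : EdgeL2) = 0 := by
        simpa using primitive_smul 0 (0 : EdgeL2)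
      rw [edgeVal_apply, hder, h0, ContinuousMap.zero_apply, add_zero]
    obtain ⟨a, ha⟩ := exists_vertexValue f
    have hconst : ∀ u v, a u = a v := fun u v => by
      have h2 := hG u v
      induction h2 with
      | rel u v huv =>
        obtain ⟨e, rfl, rfl⟩ := huv
        rw [← (ha e).1, ← (ha e).2, hval e 1]
      | refl u => rfl
      | symm u v _ ih => exact ih.symm
      | trans u v w _ _ ih₁ ih₂ => exact ih₁.trans ih₂
    refine energySpace_ext fun e x => ?_
    rw [hval, (ha e).1, hconst _ (G.src e₀), ← (ha e₀).1, hf0]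
    simp
  let T : spectralSpan (gradForm G g) (massForm G g ρ) 0 →ₗ[ℝ] ℝ :=
    { toFun := fun f => edgeVal G e₀ f 0
      map_add' := fun f k => by simp
      map_smul' := fun c f => by simp }
  have hT : Function.Injective T := by
    rintro ⟨a, ha⟩ ⟨b, hb⟩ hab
    have hab : edgeVal G e₀ a 0 = edgeVal G e₀ b 0 := hab
    refine Subtype.ext (sub_eq_zero.1 (hzero _ (Submodule.sub_mem _ ha hb) ?_))
    rw [map_sub, ContinuousMap.sub_apply, hab, sub_self]
  simpa using LinearMap.finrank_le_finrank_of_injective hT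

variable [Fintype V] [Nonempty E]

theorem eigenvalue_pos (hG : G.Connected) {g : E → ℝ} {ρ : EdgeFun E ℝ}
    (h : Admissible g ρ) {k : ℕ} (hk : 1 ≤ k) : 0 < eigenvalue G k g ρ := by
  rw [eigenvalue_eq_weakEigenvalue h]
  by_contra! hle
  have h1 := ((h.isCompactPair (G := G)).weakEigenvalue_le_iff
    not_finiteDimensional_energySpace k 0).1 hle
  have h2 := finrank_spectralSpan_zero_le hG h
  omega

/-- Length and density directions localised to a single edge decouple the two identities. The
gradient one is obtained only in integrated form, since a metric has one parameter per edge. -/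
theorem identities_of_sum_expVariation_eq_zero {g : E → ℝ} {ρ : EdgeFun E ℝ}
    (h : Admissible g ρ) {μ : ℝ} (hμ : 0 < μ) {ι : Type*} [Fintype ι] {y : ι → energySpace G}
    (hy : ∀ i, y i ∈ weakEigenspace (gradForm G g) (massForm G g ρ) μ)
    (hsum : ∀ x, ∑ i, expVariation G g ρ (μ * totalLength g * totalMass g ρ) x (y i) (y i) = 0) :
    (∀ e, ∑ i, ‖edgeDeriv G e (y i)‖ ^ 2 =
      μ * (∑ i, massForm G g ρ (y i) (y i)) / totalLength g * g e) ∧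
    ∀ e x, ∑ i, (edgeVal G e (y i) x) ^ 2 =
      (∑ i, massForm G g ρ (y i) (y i)) / totalMass g ρ := by
  classical
  set d := ∑ i, massForm G g ρ (y i) (y i) with hd
  set L := totalLength g with hL
  set M := totalMass g ρ with hM
  have hLpos : 0 < L := totalLength_pos h
  have hMpos : 0 < M := totalMass_pos h
  have hgrad : ∑ i, gradForm G g (y i) (y i) = μ * d := by
    rw [hd, Finset.mul_sum]
    exact Finset.sum_congr rfl fun i _ => hy i (y i)
  have hform : ∀ (α : E → ℝ) (P : E → Polynomial ℝ),
      normDeriv g ρ (fun e => √(g e) * α e)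
        (fun e => (P e).toContinuousMapOn unitInterval * massCoeff g ρ e) * (μ * d) -
      L * M * ∑ e, √(g e) * α e / g e * ∑ i, ‖edgeDeriv G e (y i)‖ ^ 2 -
      μ * L * M * ∑ e, edgeIntegral ((P e).toContinuousMapOn unitInterval * massCoeff g ρ e *
        ∑ i, edgeVal G e (y i) * edgeVal G e (y i)) = 0 := fun α P => by
    refine Eq.trans ?_ (hsum (α, P))
    rw [← hgrad]
    exact (sum_variationForm g ρ _ _ _ y).symm
  constructor
  · intro e
    have h1 := hform (Pi.single e 1) 0
    have hg := h.metric_pos e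
    have hs : 0 < √(g e) := Real.sqrt_pos.2 hg
    have h2 : ∀ c : E → ℝ, ∑ e', √(g e') * (Pi.single e 1 : E → ℝ) e' / g e' * c e' =
        √(g e) / g e * c e := fun c => by
      rw [Finset.sum_eq_single e (fun e' _ hne => by simp [hne]) (fun hne => by simp at hne)]
      simp
    have h3 : (∑ e', √(g e') * (Pi.single e 1 : E → ℝ) e') = √(g e) := by
      rw [Finset.sum_eq_single e (fun e' _ hne => by simp [hne]) (fun hne => by simp at hne)]
      simp
    have h4 : ((0 : Polynomial ℝ).toContinuousMapOn unitInterval) = 0 := by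
      ext x
      simp
    simp only [normDeriv, h2, h3, Pi.zero_apply, h4, zero_mul, map_zero, Finset.sum_const_zero,
      mul_zero, add_zero, sub_zero, ← hM] at h1
    rw [div_mul_eq_mul_div, eq_div_iff hLpos.ne']
    have h5 : √(g e) * M * (g e * (μ * d) - L * ∑ i, ‖edgeDeriv G e (y i)‖ ^ 2) = 0 := by
      have h6 : √(g e) / g e * g e = √(g e) := div_mul_cancel₀ _ hg.ne'
      have h7 := congrArg (g e * ·) h1
      simp only [mul_zero] at h7
      linear_combination h7 + (L * M * ∑ i, ‖edgeDeriv G e (y i)‖ ^ 2) * h6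
    have h8 := (mul_eq_zero.1 h5).resolve_left (mul_pos hs hMpos).ne'
    linarith
  · intro e
    set φ := ∑ i, edgeVal G e (y i) * edgeVal G e (y i) with hφ
    have hφx : ∀ x, φ x = ∑ i, (edgeVal G e (y i) x) ^ 2 := fun x => by
      rw [hφ, ContinuousMap.sum_apply]
      simp only [ContinuousMap.mul_apply, pow_two]
    have h0 : massCoeff g ρ e * (ContinuousMap.const _ d - M • φ) = 0 := by
      refine eq_zero_of_edgeIntegral_polynomial fun P => ?_
      have h1 := hform 0 (Pi.single e P)
      have h2 : ∀ c : E → C(unitInterval, ℝ), ∑ e', edgeIntegral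
          (((Pi.single e P : E → Polynomial ℝ) e').toContinuousMapOn unitInterval * c e') =
          edgeIntegral (P.toContinuousMapOn unitInterval * c e) := fun c => by
        have h4 : ((0 : Polynomial ℝ).toContinuousMapOn unitInterval) = 0 := by
          ext x
          simp
        rw [Finset.sum_eq_single e (fun e' _ hne => by simp [hne, h4]) (fun hne => by simp at hne)]
        simp
      simp only [normDeriv, mul_assoc, h2, Pi.zero_apply, mul_zero, zero_mul, zero_div,
        Finset.sum_const_zero, zero_add, sub_zero, ← hL] at h1
      have h3 : P.toContinuousMapOn unitInterval *
          (massCoeff g ρ e * (ContinuousMap.const _ d - M • φ)) =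
          d • (P.toContinuousMapOn unitInterval * massCoeff g ρ e) -
            M • (P.toContinuousMapOn unitInterval * (massCoeff g ρ e * φ)) := by
        ext x
        simp only [ContinuousMap.mul_apply, ContinuousMap.sub_apply, ContinuousMap.smul_apply,
          ContinuousMap.const_apply, smul_eq_mul]
        ring
      rw [h3, map_sub, map_smul, map_smul, smul_eq_mul, smul_eq_mul]
      refine (mul_eq_zero.1 ?_).resolve_left (mul_pos hμ hLpos).ne'
      linear_combination h1
    intro x
    have h1 := DFunLike.congr_fun h0 x
    rw [ContinuousMap.mul_apply, ContinuousMap.zero_apply] at h1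
    have h2 := (mul_eq_zero.1 h1).resolve_left (massCoeff_pos h e x).ne'
    simp only [ContinuousMap.sub_apply, ContinuousMap.smul_apply, ContinuousMap.const_apply,
      smul_eq_mul, hφx] at h2
    rw [eq_div_iff hMpos.ne']
    linarith

end Identities

/-! ### Geodesic nets -/

section EdgeODE

theorem IsEdgeDeriv.mul {f f' k k' : unitInterval → ℝ} (hf : IsEdgeDeriv f f')
    (hk : IsEdgeDeriv k k') :
    IsEdgeDeriv (fun x => f x * k x) (fun x => f' x * k x + f x * k' x) := fun x => by
  have h1 := (hf x).mul (hk x)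
  rw [Set.IccExtend_val, Set.IccExtend_val] at h1
  exact h1

theorem IsEdgeDeriv.sum {ι : Type*} [Fintype ι] {f f' : ι → unitInterval → ℝ}
    (hf : ∀ i, IsEdgeDeriv (f i) (f' i)) :
    IsEdgeDeriv (fun x => ∑ i, f i x) (fun x => ∑ i, f' i x) := fun x =>
  HasDerivWithinAt.fun_sum fun i _ => hf i x

theorem IsEdgeDeriv.sub {f f' k k' : unitInterval → ℝ} (hf : IsEdgeDeriv f f')
    (hk : IsEdgeDeriv k k') : IsEdgeDeriv (fun x => f x - k x) (fun x => f' x - k' x) := fun x =>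
  (hf x).sub (hk x)

theorem IsEdgeDeriv.add {f f' k k' : unitInterval → ℝ} (hf : IsEdgeDeriv f f')
    (hk : IsEdgeDeriv k k') : IsEdgeDeriv (fun x => f x + k x) (fun x => f' x + k' x) := fun x =>
  (hf x).add (hk x)

theorem IsEdgeDeriv.unique {f u v : unitInterval → ℝ} (hu : IsEdgeDeriv f u)
    (hv : IsEdgeDeriv f v) (x : unitInterval) : u x = v x :=
  (uniqueDiffOn_unit _ x.2).eq_deriv _ (hu x) (hv x)

theorem IsEdgeDeriv.eq_const {f u : unitInterval → ℝ} (hu : IsEdgeDeriv f u)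
    (h0 : ∀ x, u x = 0) (x : unitInterval) : f x = f 0 := by
  have h1 : IsEdgeDeriv f (0 : C(unitInterval, ℝ)) := fun x => by
    simpa [h0 x] using hu x
  rw [h1.eq_add_primitive x, primitive_toEdgeL2]
  simp [Set.IccExtend]

theorem isEdgeDeriv_const (c : ℝ) : IsEdgeDeriv (fun _ => c) (fun _ => 0) := fun _ =>
  hasDerivWithinAt_const _ _ _

theorem isEdgeDeriv_of_hasDerivAt {φ φ' : ℝ → ℝ} (h : ∀ x, HasDerivAt φ (φ' x) x) :
    IsEdgeDeriv (fun x => φ x) (fun x => φ' x) := fun x =>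
  (h x).hasDerivWithinAt.congr_of_mem (fun _ hy => Set.IccExtend_of_mem _ _ hy) x.2

/-- Differentiating `∑ f² = r` gives `∑ f u = 0`; differentiating that gives `∑ u² = q r`. The
derivative of `∑ u²` is `-2 q ∑ f u = 0`, so `∑ u²` is constant, and therefore so is `q` when `r ≠
0`. -/
theorem sum_sq_identities {ι : Type*} [Fintype ι] {f u : ι → unitInterval → ℝ}
    {q : unitInterval → ℝ} {r : ℝ} (hf : ∀ i, IsEdgeDeriv (f i) (u i))
    (hu : ∀ i, IsEdgeDeriv (u i) (fun x => -q x * f i x)) (hr : ∀ x, ∑ i, (f i x) ^ 2 = r) :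
    (∀ x, ∑ i, f i x * u i x = 0) ∧ (∀ x, ∑ i, (u i x) ^ 2 = q x * r) ∧
      ∀ x, ∑ i, (u i x) ^ 2 = ∑ i, (u i 0) ^ 2 := by
  have h1 : ∀ x, ∑ i, f i x * u i x = 0 := fun x => by
    have h2 := IsEdgeDeriv.sum fun i => (hf i).mul (hf i)
    simp only [← pow_two, hr] at h2
    have h3 := h2.unique (isEdgeDeriv_const r) x
    have h4 : ∑ i, (u i x * f i x + f i x * u i x) = 2 * ∑ i, f i x * u i x := by
      rw [Finset.mul_sum]
      exact Finset.sum_congr rfl fun i _ => by ring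
    rw [h4] at h3
    linarith
  refine ⟨h1, fun x => ?_, ?_⟩
  · have h2 := IsEdgeDeriv.sum fun i => (hf i).mul (hu i)
    simp only [h1] at h2
    have h3 := h2.unique (isEdgeDeriv_const 0) x
    have h4 : ∑ i, (u i x * u i x + f i x * (-q x * f i x)) =
        ∑ i, (u i x) ^ 2 - q x * ∑ i, (f i x) ^ 2 := by
      rw [Finset.mul_sum, ← Finset.sum_sub_distrib]
      exact Finset.sum_congr rfl fun i _ => by ring
    rw [h4, hr] at h3
    linarith
  · have h2 := IsEdgeDeriv.sum fun i => (hu i).mul (hu i)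
    simp only [← pow_two] at h2
    refine h2.eq_const fun x => ?_
    have h4 : ∑ i, (-q x * f i x * u i x + u i x * (-q x * f i x)) =
        -(2 * q x) * ∑ i, f i x * u i x := by
      rw [Finset.mul_sum]
      exact Finset.sum_congr rfl fun i _ => by ring
    rw [h4, h1, mul_zero]

/-- Rotating the phase vector `(b f, u)` by the angle `b x` makes both components constant; the
formula is the inverse rotation. -/
theorem harmonic_oscillator {f u : unitInterval → ℝ} {b : ℝ} (hb : b ≠ 0)
    (hf : IsEdgeDeriv f u) (hu : IsEdgeDeriv u (fun x => -b ^ 2 * f x)) (x : unitInterval) :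
    f x = Real.cos (b * x) * f 0 + Real.sin (b * x) / b * u 0 := by
  have hcos : IsEdgeDeriv (fun x => Real.cos (b * x)) (fun x => -(b * Real.sin (b * x))) :=
    isEdgeDeriv_of_hasDerivAt (φ := fun x => Real.cos (b * x))
      (φ' := fun x => -(b * Real.sin (b * x))) fun x => by
        have h1 := ((hasDerivAt_id x).const_mul b).cos
        simpa [mul_comm] using h1
  have hsin : IsEdgeDeriv (fun x => Real.sin (b * x)) (fun x => b * Real.cos (b * x)) :=
    isEdgeDeriv_of_hasDerivAt (φ := fun x => Real.sin (b * x))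
      (φ' := fun x => b * Real.cos (b * x)) fun x => by
        have h1 := ((hasDerivAt_id x).const_mul b).sin
        simpa [mul_comm] using h1
  have hA := (((hcos.mul hf).mul (isEdgeDeriv_const b)).sub (hsin.mul hu)).eq_const
    (fun x => by ring) x
  have hB := (((hsin.mul hf).mul (isEdgeDeriv_const b)).add (hcos.mul hu)).eq_const
    (fun x => by ring) x
  simp only [Set.Icc.coe_zero, mul_zero, Real.cos_zero, Real.sin_zero, one_mul, zero_mul,
    sub_zero, zero_add] at hA hB
  have h1 := Real.sin_sq_add_cos_sq (b * x)
  field_simp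
  linear_combination Real.cos (b * x) * hA + Real.sin (b * x) * hB - b * f x * h1

end EdgeODE

section Net

variable {V E : Type*} [Fintype E] {G : MultiGraph V E}

theorem dx_coordinateMap {n : ℕ} {f : Fin n → EdgeFun E ℝ}
    (hf : ∀ i e, DifferentiableOn ℝ ((f i).onEdge e) (Set.Icc 0 1)) :
    EdgeFun.dx (coordinateMap f) = coordinateMap fun i => (f i).dx := by
  funext e x
  have h1 : HasDerivWithinAt (fun y i => (f i).onEdge e y) (fun i => (f i).dx e x)
      (Set.Icc 0 1) x := hasDerivWithinAt_pi.2 fun i => isEdgeDeriv_dx (hf i e) x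
  have h2 := (EuclideanSpace.equiv (Fin n) ℝ).symm.toContinuousLinearMap.hasFDerivAt
    |>.comp_hasDerivWithinAt (x : ℝ) h1
  exact h2.derivWithin (uniqueDiffOn_unit _ x.2)

theorem outwardSum_coordinateMap (g : E → ℝ) {n : ℕ} {f : Fin n → EdgeFun E ℝ}
    (hf : ∀ i e, DifferentiableOn ℝ ((f i).onEdge e) (Set.Icc 0 1)) (v : V) :
    outwardSum G g (coordinateMap f) v = WithLp.toLp 2 fun i => outwardSum G g (f i) v := by
  ext i
  simp only [outwardSum, dx_coordinateMap hf, WithLp.ofLp_sum, Finset.sum_apply]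
  refine Finset.sum_congr rfl fun e _ => ?_
  rw [WithLp.ofLp_add, Pi.add_apply]
  congr 1 <;> split_ifs <;> simp [coordinateMap]

theorem norm_toLp_eq {n : ℕ} {a : Fin n → ℝ} {R : ℝ} (hR : 0 ≤ R) (h : ∑ i, (a i) ^ 2 = R ^ 2) :
    ‖(WithLp.toLp 2 a : EuclideanSpace ℝ (Fin n))‖ = R := by
  rw [EuclideanSpace.norm_eq]
  simp only [Real.norm_eq_abs, sq_abs, h]
  exact Real.sqrt_sq hR

variable [Fintype V] [Nonempty E]

/-- Here `q = μ g ρ`, so `g = ∑ u² = μ g ρ L / (μ M)` forces `ρ = M / L`. The oscillator frequency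
is then `√g / R`, which is unit speed on the sphere of radius `R`. -/
theorem isGeodesicNetImmersion_of_sum_sq (hG : G.Connected) {g : E → ℝ} {ρ : EdgeFun E ℝ}
    (h : Admissible g ρ) {μ : ℝ} (hμ : 0 < μ) {n : ℕ} {y : Fin n → energySpace G}
    (hy0 : ∀ i, y i ≠ 0)
    (hy : ∀ i, y i ∈ weakEigenspace (gradForm G g) (massForm G g ρ) μ)
    (hderiv : ∀ e, ∑ i, ‖edgeDeriv G e (y i)‖ ^ 2 = g e)
    (hval : ∀ e x, ∑ i, (edgeVal G e (y i) x) ^ 2 = totalLength g / (μ * totalMass g ρ)) :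
    (∀ e x, ρ e x = totalMass g ρ / totalLength g) ∧
      (∀ e x, ∑ i, gradSq g (toEdgeFun G (y i)) e x = 1) ∧
      IsGeodesicNetImmersion G g (√(totalLength g / (μ * totalMass g ρ)))
        (coordinateMap fun i => toEdgeFun G (y i)) := by
  set L := totalLength g with hL
  set M := totalMass g ρ with hM
  have hLpos : 0 < L := totalLength_pos h
  have hMpos : 0 < M := totalMass_pos h
  have hr : 0 < L / (μ * M) := by positivity
  set R := √(L / (μ * M)) with hR
  have hRpos : 0 < R := Real.sqrt_pos.2 hr
  have hR2 : R ^ 2 = L / (μ * M) := Real.sq_sqrt hr.le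
  choose u hu hu' using fun i => exists_edgeDeriv_of_mem_weakEigenspace h (hy i)
  have hu'' : ∀ i e, IsEdgeDeriv (u i e) (fun x => -(μ * g e * ρ e x) * edgeVal G e (y i) x) :=
    fun i e x => by
      have h1 := hu' i e x
      simp only [ContinuousMap.smul_apply, ContinuousMap.mul_apply, smul_eq_mul,
        massCoeff_apply h] at h1
      have h2 : -(μ * √(g e)) * (√(g e) * ρ e x * edgeVal G e (y i) x) =
          -(μ * g e * ρ e x) * edgeVal G e (y i) x := by
        linear_combination -(μ * ρ e x * edgeVal G e (y i) x) *
          Real.mul_self_sqrt (h.metric_pos e).le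
      rwa [h2] at h1
  have hsum := fun e => sum_sq_identities (fun i => hu i e) (fun i => hu'' i e) (hval e)
  have husq : ∀ e x, ∑ i, (u i e x) ^ 2 = g e := fun e x => by
    have h1 : ∑ i, u i e * u i e = ContinuousMap.const _ (∑ i, (u i e 0) ^ 2) := by
      ext x
      rw [ContinuousMap.const_apply, ← (hsum e).2.2 x, ContinuousMap.sum_apply]
      simp only [ContinuousMap.mul_apply, pow_two]
    have h2 := hderiv e
    simp only [fun i => edgeDeriv_eq_of_isEdgeDeriv (hu i e), ← real_inner_self_eq_norm_sq,
      inner_toEdgeL2_toEdgeL2] at h2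
    rw [← map_sum, h1, edgeIntegral_const] at h2
    rw [(hsum e).2.2 x, h2]
  have hρ : ∀ e x, ρ e x = M / L := fun e x => by
    have hg := h.metric_pos e
    have h1 := (hsum e).2.1 x
    rw [husq] at h1
    field_simp at h1
    rw [eq_div_iff hLpos.ne']
    linarith
  have hdx : ∀ i e, (toEdgeFun G (y i)).dx e = u i e := fun i e =>
    IsEdgeDeriv.dx_eq (f := toEdgeFun G (y i)) (hu i e)
  have heig := fun i => isEigenfunction_of_mem_weakEigenspace h (hy0 i) (hy i)
  refine ⟨hρ, fun e x => ?_, hRpos, ?_, fun e => ?_, fun v => ?_⟩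
  · simp only [gradSq, hdx, ← Finset.sum_div, husq]
    exact div_self (h.metric_pos e).ne'
  · choose a ha using fun i => exists_vertexValue (y i)
    obtain ⟨e₀⟩ := ‹Nonempty E›
    have hsrc : ∀ e, ‖(WithLp.toLp 2 fun i => a i (G.src e) : EuclideanSpace ℝ (Fin n))‖ = R :=
      fun e => norm_toLp_eq hRpos.le (by
        rw [hR2, ← hval e 0]
        simp only [(ha _ e).1])
    have htgt : ∀ e, ‖(WithLp.toLp 2 fun i => a i (G.tgt e) : EuclideanSpace ℝ (Fin n))‖ = R :=
      fun e => norm_toLp_eq hRpos.le (by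
        rw [hR2, ← hval e 1]
        simp only [(ha _ e).2])
    refine ⟨fun v => WithLp.toLp 2 fun i => a i v, fun v => ?_, fun e => ⟨?_, ?_⟩⟩
    -- The norm is known at ends of edges; following paths from an end of `e₀` shows that every
    -- vertex is reached.
    · have h1 : ∀ w w', Relation.EqvGen (fun a b => ∃ e, G.src e = a ∧ G.tgt e = b) w w' →
          (‖(WithLp.toLp 2 fun i => a i w : EuclideanSpace ℝ (Fin n))‖ = R ↔
            ‖(WithLp.toLp 2 fun i => a i w' : EuclideanSpace ℝ (Fin n))‖ = R) := by
        intro w w' hw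
        induction hw with
        | rel w w' hw =>
          obtain ⟨e, rfl, rfl⟩ := hw
          exact iff_of_true (hsrc e) (htgt e)
        | refl w => rfl
        | symm w w' _ ih => exact ih.symm
        | trans w₁ w₂ w₃ _ _ ih₁ ih₂ => exact ih₁.trans ih₂
      exact (h1 _ _ (hG (G.src e₀) v)).1 (hsrc e₀)
    · ext i
      exact (ha i e).1
    · ext i
      exact (ha i e).2
  · have hg := h.metric_pos e
    have hs : 0 < √(g e) := Real.sqrt_pos.2 hg
    refine ⟨WithLp.toLp 2 fun i => edgeVal G e (y i) 0,
      WithLp.toLp 2 fun i => u i e 0 / √(g e), norm_toLp_eq hRpos.le (by rw [hR2, hval]),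
      norm_toLp_eq zero_le_one ?_, ?_, fun x => ?_⟩
    · simp only [div_pow, ← Finset.sum_div, husq, Real.sq_sqrt hg.le]
      rw [div_self hg.ne', one_pow]
    · have h1 : ∑ i, edgeVal G e (y i) 0 * (u i e 0 / √(g e)) = 0 := by
        simp only [← mul_div_assoc, ← Finset.sum_div, (hsum e).1, zero_div]
      rw [PiLp.inner_apply]
      refine Eq.trans ?_ h1
      exact Finset.sum_congr rfl fun i _ => by simp [mul_comm]
    · have hb : √(g e) / R ≠ 0 := (div_pos hs hRpos).ne'
      ext i
      have h1 : IsEdgeDeriv (u i e) (fun x => -(√(g e) / R) ^ 2 * edgeVal G e (y i) x) :=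
        fun x => by
          have h2 := hu'' i e x
          have h3 : μ * g e * ρ e x = (√(g e) / R) ^ 2 := by
            rw [div_pow, hR2, Real.sq_sqrt hg.le, hρ]
            field_simp
          simp only [h3] at h2
          exact h2
      have h4 := harmonic_oscillator hb (hu i e) h1 x
      have h5 : √(g e) / R * (x : ℝ) = √(g e) * x / R := by ring
      rw [h5] at h4
      simp only [coordinateMap, toEdgeFun_apply, PiLp.add_apply, PiLp.smul_apply, smul_eq_mul, h4]
      field_simp
  · rw [outwardSum_coordinateMap g fun i e => ((heig i).smooth e).differentiableOn (by norm_num)]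
    ext i
    simp [(heig i).kirchhoff v]

theorem geodesicNet_of_isExtremal (hG : G.Connected) {k : ℕ} (hk : 1 ≤ k) {g : E → ℝ}
    {ρ : EdgeFun E ℝ} (hext : IsExtremal (normalisedEigenvalue G k) g ρ) :
    (∃ c : ℝ, ∀ e x, ρ e x = c) ∧ ∃ (n : ℕ) (f : Fin n → EdgeFun E ℝ),
      (∀ i, IsEigenfunction G g ρ (eigenvalue G k g ρ) (f i)) ∧
      SatisfiesIdentities G k g ρ f ∧
      IsGeodesicNetImmersion G g (√(totalLength g / (eigenvalue G k g ρ * totalMass g ρ)))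
        (coordinateMap f) := by
  have h := hext.1
  obtain ⟨n, y, hn, hy0, hy, hsum⟩ := exists_sum_expVariation_eq_zero hext
  have hμ := eigenvalue_pos hG h hk
  rw [normalisedEigenvalue] at hsum
  obtain ⟨hder, hval⟩ := identities_of_sum_expVariation_eq_zero h hμ hy hsum
  have hLpos : 0 < totalLength g := totalLength_pos h
  have hMpos : 0 < totalMass g ρ := totalMass_pos h
  have : Nonempty (Fin n) := ⟨⟨0, hn⟩⟩
  set μ := eigenvalue G k g ρ with hμdef
  set d := ∑ i, massForm G g ρ (y i) (y i) with hd
  have hdpos : 0 < d := Finset.sum_pos (fun i _ => h.isCompactPair.pos _ (hy0 i))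
    Finset.univ_nonempty
  have hτpos : 0 < totalLength g / (μ * d) := by positivity
  -- The vectors annihilating the variation are determined only up to a common factor; this one
  -- normalises the gradient sum to `1` and at the same time gives the prescribed value of `∑ f_i²`.
  set τ := √(totalLength g / (μ * d)) with hτ
  have hτ2 : τ ^ 2 = totalLength g / (μ * d) := Real.sq_sqrt hτpos.le
  have hz0 : ∀ i, τ • y i ≠ 0 := fun i => smul_ne_zero (Real.sqrt_pos.2 hτpos).ne' (hy0 i)
  have hz : ∀ i, τ • y i ∈ weakEigenspace (gradForm G g) (massForm G g ρ) μ := fun i =>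
    Submodule.smul_mem _ _ (hy i)
  have hzder : ∀ e, ∑ i, ‖edgeDeriv G e (τ • y i)‖ ^ 2 = g e := fun e => by
    simp only [map_smul, norm_smul, mul_pow, Real.norm_eq_abs, sq_abs, ← Finset.mul_sum, hder, hτ2]
    field_simp
  have hzval : ∀ e x, ∑ i, (edgeVal G e (τ • y i) x) ^ 2 =
      totalLength g / (μ * totalMass g ρ) := fun e x => by
    simp only [map_smul, ContinuousMap.smul_apply, smul_eq_mul, mul_pow, ← Finset.mul_sum, hval,
      hτ2]
    field_simp
  obtain ⟨hρ, hgrad, hnet⟩ := isGeodesicNetImmersion_of_sum_sq hG h hμ hz0 hz hzder hzval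
  refine ⟨⟨_, hρ⟩, n, fun i => toEdgeFun G (τ • y i),
    fun i => isEigenfunction_of_mem_weakEigenspace h (hz0 i) (hz i), fun e x => ⟨hgrad e x, ?_⟩,
    hnet⟩
  simp only [toEdgeFun_apply, hzval, ← hμdef]
  field_simp

end Net

theorem theorem1p2 {V E : Type*} [Fintype V] [Fintype E] [Nonempty E]
    (G : QuantumGraph.MultiGraph V E) (hG : G.Connected) (k : ℕ) (hk : 1 ≤ k) :
    (∀ (g : E → ℝ) (ρ : QuantumGraph.EdgeFun E ℝ),
      QuantumGraph.IsExtremal (QuantumGraph.normalisedEigenvalue G k) g ρ →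
      (∃ c : ℝ, ∀ e x, ρ e x = c) ∧
      ∃ (n : ℕ) (f : Fin n → QuantumGraph.EdgeFun E ℝ),
        (∀ i, QuantumGraph.IsEigenfunction G g ρ (QuantumGraph.eigenvalue G k g ρ) (f i)) ∧
        QuantumGraph.SatisfiesIdentities G k g ρ f ∧
        QuantumGraph.IsGeodesicNetImmersion G g
          (√(QuantumGraph.totalLength g /
            (QuantumGraph.eigenvalue G k g ρ * QuantumGraph.totalMass g ρ)))
          (QuantumGraph.coordinateMap f)) ∧
    (∀ (g : E → ℝ) (ρ : QuantumGraph.EdgeFun E ℝ), QuantumGraph.Admissible g ρ →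
      ∀ (n : ℕ) (f : Fin n → QuantumGraph.EdgeFun E ℝ),
        (∀ i, QuantumGraph.IsEigenfunction G g ρ (QuantumGraph.eigenvalue G k g ρ) (f i)) →
        QuantumGraph.SatisfiesIdentities G k g ρ f →
        (QuantumGraph.eigenvalue G (k - 1) g ρ < QuantumGraph.eigenvalue G k g ρ ∨
          QuantumGraph.eigenvalue G k g ρ < QuantumGraph.eigenvalue G (k + 1) g ρ) →
        QuantumGraph.IsExtremal (QuantumGraph.normalisedEigenvalue G k) g ρ) := by
  exact ⟨fun _ _ hext => geodesicNet_of_isExtremal hG hk hext,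
    fun _ _ h _ _ hf hid hgap => isExtremal_of_satisfiesIdentities hk h hf hid hgap⟩
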